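/- **Setting.** Let $U$ be a unitary on a finite-dimensional Hilbert space with orthonormal eigenbasis $U|\phi_j\rangle=e^{i\phi_j}|\phi_j\rangle$, $\phi_j\in[0,2\pi)$, let $|\psi\rangle$ be a unit vector and $a_j=|\langle\phi_j|\psi\rangle|^2$. Let $0<\Delta\le\pi$ with $|\phi_j-\phi_0|>\Delta$ for all $j\ne0$, suppose that the overlap $a_0>0$ and the circuit fidelity $F\in(0,1)$ are known, and let $\phi_{guess}$ satisfy $|\phi_0-\phi_{guess}|<\Delta/3$. Put $\mathcal D=[\phi_{guess}-\Delta/2,\phi_{guess}+\Delta/2]$ and assume $\mathcal D\subset[\Delta/6,2\pi-\Delta/6)$ (i.e. the interval with its buffer $\Delta/6$ does not wrap around the circle). Let $f_\sigma$ be the $2\pi$-periodic Gaussian kernel: $f_\sigma(x)\propto e^{-x^2/2\sigma^2}$ on $(-\pi,\pi]$, $\int_{-\pi}^{\pi}f_\sigma=1$. One circuit run under global depolarizing noise outputs $x\in[0,2\pi)$ with density $p(x)=F\sum_j a_jf_\sigma(x-\phi_j)+\frac{1-F}{2\pi}$ and uses $t$ calls to the controlled unitary, where $t=\Theta(\sigma^{-1})$,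 i.e. $\kappa_1\le t\sigma\le\kappa_2$ for fixed $0<\kappa_1\le\kappa_2$. Runs with $x\notin\mathcal D$ are discarded, so the retained samples are independent with density $P=p/\int_{\mathcal D}p$ on $\mathcal D$, and $M$ retained samples cost $T=Mt/\int_{\mathcal D}p$ calls on average. The fMPE (filtered moment projection phase estimator) is a measurable choice of $$\tilde\phi_M\in\operatorname*{argmax}_{\phi\in\mathcal D}\ \frac1M\sum_{j=1}^M\log Q(x_j|\phi),\qquad Q(x|\phi)=\frac{Fa_0f_\sigma(x-\phi)+(1-F)\frac1{2\pi}}{Fa_0\int_{\mathcal D}f_\sigma(y-\phi)\,dy+(1-F)\frac{\Delta}{2\pi}} .$$ **Theorem 4.** There are constants $c,C_T>0$ depending only on $\kappa_1,\kappa_2$, for every $F$ a constant $C_M>0$ depending only on $\kappa_1,\kappa_2,F$, and for all $\Delta,a_0$ a threshold $\varepsilon_0>0$ depending only on $\kappa_1,\kappa_2,F,\Delta,a_0$, such that the following holds for every instance as above with every $t$, $\sigma$ and fMPE. There is $N_0$ such that, for every $0<\varepsilon\le\Delta/3$ with $$t\ \ge\ c\,\Delta^{-1}\log^{1/2}\!\bigl(\Delta\,\varepsilon^{-1}a_0^{-2}F^{-1}\bigr),$$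 the limits $b=\lim_M(\mathbb E[\tilde\phi_M]-\phi_0)$ (asymptotic bias) and $v=\lim_M M\,\mathrm{Var}[\tilde\phi_M]$ (asymptotic variance) exist, and there is a number of samples $M_\varepsilon\ge1$ for which: 1. $M_\varepsilon=O(a_0^{-1}t^{-2}\varepsilon^{-2})$ as $\varepsilon\to0$: if $\varepsilon\le\varepsilon_0$, then $M_\varepsilon\le\max\bigl(1,\ C_M\,a_0^{-1}t^{-2}\varepsilon^{-2}\bigr)$; 2. $T=O(\varepsilon^{-2}t^{-1}F^{-2}a_0^{-2})$: the mean number of calls for $M_\varepsilon$ samples is at most $\max\bigl(T_1,\ C_T\,\varepsilon^{-2}t^{-1}F^{-2}a_0^{-2}\bigr)$, where $T_1=t/\int_{\mathcal D}p$ is the mean cost of a single sample; 3. for every $M\ge M_\varepsilon$ the large-$M$ RMS error satisfies $\sqrt{b^2+v/M}\le\varepsilon$; and if also $M\ge N_0$ (where $N_0$ does not depend on $\varepsilon$), then the actual RMS error satisfies $\sqrt{\mathbb E[(\tilde\phi_M-\phi_0)^2]}\le\varepsilon$. -/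

import Mathlib

open Filter Topology MeasureTheory
open scoped Real

universe u v

noncomputable section

namespace QPE

/-- The input of quantum phase estimation: a unitary `U` on a finite-dimensional Hilbert space `H`
with an orthonormal eigenbasis `U |φ_j⟩ = e^{iφ_j} |φ_j⟩`, `φ_j ∈ [0, 2π)`, and a normalized
initial state `ψ`. -/
structure Input (ι : Type u) (H : Type v) [Fintype ι] [NormedAddCommGroup H]
    [InnerProductSpace ℂ H] where
  /-- the unitary -/
  U : H ≃ₗᵢ[ℂ] H
  /-- the eigenbasis -/
  eigvec : OrthonormalBasis ι ℂ H
  /-- the eigenphases -/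
  phase : ι → ℝ
  phase_mem : ∀ j, phase j ∈ Set.Ico 0 (2 * π)
  eigen : ∀ j, U (eigvec j) = Complex.exp (Complex.I * (phase j : ℂ)) • eigvec j
  /-- the initial state -/
  ψ : H
  norm_ψ : ‖ψ‖ = 1

/-- The weight `a_j = |⟨φ_j|ψ⟩|²` of the phase `φ_j` in the spectral distribution. -/
def Input.weight {ι : Type u} {H : Type v} [Fintype ι] [NormedAddCommGroup H]
    [InnerProductSpace ℂ H] (S : Input ι H) (j : ι) : ℝ :=
  ‖inner ℂ (S.eigvec j) S.ψ‖ ^ 2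

/-- The Gaussian kernel function of width `σ` on the circle `ℝ / 2πℤ`, as a `2π`-periodic function:
on `(-π, π]` it is proportional to `exp (-x² / (2σ²))`, and its integral over a period is `1`. -/
def gaussianKernel (σ x : ℝ) : ℝ :=
  Real.exp (-(toIocMod Real.two_pi_pos (-π) x) ^ 2 / (2 * σ ^ 2)) /
    ∫ y in (-π)..π, Real.exp (-y ^ 2 / (2 * σ ^ 2))

/-- The density on `[0, 2π)` of the outcome of one run of the circuit under global depolarizing
noise with circuit fidelity `F`: `p(x) = F ∑_j a_j f_σ(x - φ_j) + (1 - F) / (2π)`. -/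
def Input.noisyDensity {ι : Type u} {H : Type v} [Fintype ι] [NormedAddCommGroup H]
    [InnerProductSpace ℂ H] (S : Input ι H) (F σ x : ℝ) : ℝ :=
  F * ∑ j, S.weight j * gaussianKernel σ (x - S.phase j) + (1 - F) * (1 / (2 * π))

/-- The filtering interval of length `Δ` centred at the initial guess. -/
def filterInterval (guess Δ : ℝ) : Set ℝ :=
  Set.Icc (guess - Δ / 2) (guess + Δ / 2)

/-- The probability `∫_D p` that the outcome of a run lies in `D`. -/
def Input.acceptProb {ι : Type u} {H : Type v} [Fintype ι] [NormedAddCommGroup H]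
    [InnerProductSpace ℂ H] (S : Input ι H) (F σ : ℝ) (D : Set ℝ) : ℝ :=
  ∫ x in D, S.noisyDensity F σ x

/-- The filtered distribution: it lives on `D` and has density `p(x) / ∫_D p` there. -/
def Input.filtered {ι : Type u} {H : Type v} [Fintype ι] [NormedAddCommGroup H]
    [InnerProductSpace ℂ H] (S : Input ι H) (F σ : ℝ) (D : Set ℝ) : Measure ℝ :=
  (volume.restrict D).withDensity
    fun x => ENNReal.ofReal (S.noisyDensity F σ x / S.acceptProb F σ D)

/-- The joint law of `M` independent samples from the filtered distribution. -/
def Input.samples {ι : Type u} {H : Type v} [Fintype ι] [NormedAddCommGroup H]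
    [InnerProductSpace ℂ H] (S : Input ι H) (F σ : ℝ) (D : Set ℝ) (M : ℕ) :
    Measure (Fin M → ℝ) :=
  Measure.pi fun _ => S.filtered F σ D

/-- The mean number of calls to the controlled unitary needed for `M` accepted samples, when a run
makes `t` calls: a run is accepted with probability `∫_D p`, so `M / ∫_D p` runs are needed on
average. -/
def Input.calls {ι : Type u} {H : Type v} [Fintype ι] [NormedAddCommGroup H]
    [InnerProductSpace ℂ H] (S : Input ι H) (F σ : ℝ) (D : Set ℝ) (t M : ℕ) : ℝ :=
  M * t / S.acceptProb F σ D

/-- The single-phase model of the filtered distribution, `Q(x|φ)` for `x ∈ D`. -/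
def modelDensity (F a₀ σ : ℝ) (D : Set ℝ) (x φ : ℝ) : ℝ :=
  (F * a₀ * gaussianKernel σ (x - φ) + (1 - F) * (1 / (2 * π))) /
    (F * a₀ * (∫ y in D, gaussianKernel σ (y - φ)) + (1 - F) * (volume.real D / (2 * π)))

/-- The log-likelihood `ℓ(φ | x₁, …, x_M) = M⁻¹ ∑_j log Q(x_j|φ)`. -/
def logLikelihood (F a₀ σ : ℝ) (D : Set ℝ) {M : ℕ} (x : Fin M → ℝ) (φ : ℝ) : ℝ :=
  (1 / (M : ℝ)) * ∑ j, Real.log (modelDensity F a₀ σ D (x j) φ)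

/-- `est` is a filtered moment projection phase estimator (one function for each number `M` of
samples): it is measurable, and on samples from `D` it takes a value in `D` that maximizes the
log-likelihood over `D`. -/
structure IsFMPE (F a₀ σ : ℝ) (D : Set ℝ) (est : (M : ℕ) → (Fin M → ℝ) → ℝ) : Prop where
  measurable : ∀ M, Measurable (est M)
  mem : ∀ M (x : Fin M → ℝ), (∀ j, x j ∈ D) → est M x ∈ D
  isMax : ∀ M (x : Fin M → ℝ), (∀ j, x j ∈ D) →
    ∀ φ ∈ D, logLikelihood F a₀ σ D x φ ≤ logLikelihood F a₀ σ D x (est M x)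

/-- The estimators `est`, applied to samples with joint laws `law`, have asymptotic bias `b` and
asymptotic variance `v` as estimators of `θ`: `E[est_M] - θ → b` and `M · Var[est_M] → v`. -/
def HasAsymptoticBiasVariance (law : (M : ℕ) → Measure (Fin M → ℝ))
    (est : (M : ℕ) → (Fin M → ℝ) → ℝ) (θ b v : ℝ) : Prop :=
  Tendsto (fun M : ℕ => (∫ x, est M x ∂(law M)) - θ) atTop (𝓝 b) ∧
    Tendsto (fun M : ℕ => (M : ℝ) * ProbabilityTheory.variance (est M) (law M)) atTop (𝓝 v)

/-- The root-mean-square error at `M` samples for asymptotic bias `b` and asymptotic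
variance `v`. -/
def asymptoticRMS (b v : ℝ) (M : ℕ) : ℝ :=
  √(b ^ 2 + v / M)

/-- The root-mean-square error of the estimate of `θ` from `M` samples. -/
def rmsError (law : (M : ℕ) → Measure (Fin M → ℝ))
    (est : (M : ℕ) → (Fin M → ℝ) → ℝ) (θ : ℝ) (M : ℕ) : ℝ :=
  √(∫ x, (est M x - θ) ^ 2 ∂(law M))

end QPE

end

/-! On the window `D` the noisy density is the model density of the target phase plus a small
nonnegative contamination. The separation, the accuracy of the guess and the buffer around `D` keep
every other phase at circular distance at least `Δ / 6` from `D`, so the other peaks contribute at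
most `η = F exp(-(Δ/6)² / (2σ²)) / N`, with `N` the normalization of the kernel. The fMPE is
therefore a maximum likelihood estimator in an almost correctly specified model, and the theorem
splits into deterministic estimates for this model and a general statement on M-estimators.

Deterministic part. Let `R = Δ / σ`, and let `γ` be an absolute constant. A Gaussian peak of height
`α` over a floor `β` has `snr = σ α² / (α + β)`. Its mean log-likelihood falls off from the true
centre `θ₀` by at least `γ · snr · min(1, d²)` at a distance of `d` widths (`PeakModel.gap`), and
its Fisher information is at least `γ · snr / σ²` (`PeakModel.snr_le_fisher`). The contamination
changes log-likelihood differences by at most about `η Δ R |d|`. Hence every maximizer stays within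
`O(η Δ R / (γ snr))` widths of `θ₀`, and there the curvature remains within a factor two of minus
the Fisher information, so the maximizer `θ` is unique and nondegenerate
(`PeakModel.Contaminated.exists_strict_max`).

Statistical part. For a smooth bounded contrast with such a maximum, Hoeffding bounds on a finite
net localize the estimator outside an event of exponentially small probability, and one Newton step
linearizes it there. This gives convergence of the mean and of `M · Var`
(`RegularContrast.tendsto_mean_and_variance`). The bias is `b = θ - θ₀`, and `v = O(σ² ∫_D p / (γ
snr))`.

Constants. Always `snr ≥ (F a₀)² / 27`; in the number of calls the factor `∫_D p` cancels, and the
second claim follows. If `σ ≤ F a₀`, the peak exceeds the floor and `snr ≥ F a₀ / 6`; this gives the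
sharper dependence on `a₀` in the first claim, and `ε ≤ ε₀` forces `t` to be large enough for it.
With `X = Δ / (ε a₀² F)`, the condition on `t` makes `R ≥ k √(log X)`, so the Gaussian tail beats
the powers of `R` and leaves a factor `X⁻³` (`tail_le_of_condition`). That suffices both for the
smallness of the contamination and for `|b| ≤ ε / 2`. Finally, for fixed `t` the same condition
bounds `ε` from below, which is why `N₀` can be independent of `ε`. -/

namespace QPE

/-! ### M-estimators: concentration, linearization, limits of mean and variance -/

section MEstimation

open ProbabilityTheory

variable {𝒳 : Type*} [MeasurableSpace 𝒳]

/-- The empirical mean of `h` over a sample `x`. -/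
noncomputable def empiricalMean {M : ℕ} (h : 𝒳 → ℝ) (x : Fin M → 𝒳) : ℝ :=
  (1 / (M : ℝ)) * ∑ j, h (x j)

/-- The samples for which the empirical mean of `h` deviates from `∫ h` by at least `δ`. -/
def deviationSet (P : Measure 𝒳) (h : 𝒳 → ℝ) (δ : ℝ) (M : ℕ) : Set (Fin M → 𝒳) :=
  {x | δ ≤ |empiricalMean h x - ∫ y, h y ∂P|}

lemma measurable_empiricalMean {h : 𝒳 → ℝ} (hm : Measurable h) (M : ℕ) :
    Measurable (fun x : Fin M → 𝒳 => empiricalMean h x) := by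
  unfold empiricalMean
  refine Measurable.const_mul ?_ _
  exact Finset.measurable_sum _ fun j _ => hm.comp (measurable_pi_apply j)

lemma measurableSet_deviationSet (P : Measure 𝒳) {h : 𝒳 → ℝ} (hm : Measurable h) (δ : ℝ) (M : ℕ) :
    MeasurableSet (deviationSet P h δ M) :=
  measurableSet_le measurable_const
    ((measurable_empiricalMean hm M).sub measurable_const).norm

/-- Hoeffding's inequality: `h` takes values in an interval of length `2B`, so after centring it is
sub-Gaussian with parameter `B²`, and the parameters of independent summands add. -/
lemma measureReal_sum_ge_le (P : Measure 𝒳) [IsProbabilityMeasure P] {h : 𝒳 → ℝ}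
    (hm : Measurable h) {B : ℝ} (hB0 : 0 < B) (hB : ∀ᵐ x ∂P, |h x| ≤ B) {δ : ℝ} (hδ : 0 < δ)
    {M : ℕ} (hM : 0 < M) :
    (Measure.pi fun _ : Fin M => P).real
      {x | M * δ ≤ ∑ j, (h (x j) - ∫ y, h y ∂P)} ≤ Real.exp (-(δ ^ 2 / (2 * B ^ 2)) * M) := by
  have hsub : HasSubgaussianMGF (fun x => h x - ∫ y, h y ∂P) ((‖B - (-B)‖₊ / 2) ^ 2) P :=
    hasSubgaussianMGF_of_mem_Icc hm.aemeasurable (hB.mono fun x hx => abs_le.mp hx)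
  have hind : iIndepFun (fun (j : Fin M) (x : Fin M → 𝒳) => h (x j) - ∫ y, h y ∂P)
      (Measure.pi fun _ : Fin M => P) :=
    iIndepFun_pi (X := fun _ y => h y - ∫ y, h y ∂P) fun _ => (hm.sub_const _).aemeasurable
  have hsg : ∀ j ∈ (Finset.univ : Finset (Fin M)),
      HasSubgaussianMGF (fun x : Fin M → 𝒳 => h (x j) - ∫ y, h y ∂P) ((‖B - (-B)‖₊ / 2) ^ 2)
        (Measure.pi fun _ : Fin M => P) := by
    intro j _
    have hmp := measurePreserving_eval (fun _ : Fin M => P) j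
    refine HasSubgaussianMGF.of_map (Y := Function.eval j)
      (X := fun y => h y - ∫ y, h y ∂P) hmp.aemeasurable ?_
    rw [hmp.map_eq]
    exact hsub
  refine (HasSubgaussianMGF.measure_sum_ge_le_of_iIndepFun hind hsg
    (by positivity : (0 : ℝ) ≤ M * δ)).trans (le_of_eq ?_)
  congr 1
  have hMr : (0 : ℝ) < M := by exact_mod_cast hM
  have hnn : ‖B - (-B)‖ = 2 * B := by
    rw [Real.norm_of_nonneg (by linarith)]
    ring
  simp only [Finset.sum_const, Finset.card_univ, Fintype.card_fin, nsmul_eq_mul]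
  push_cast
  rw [hnn]
  field_simp

lemma tendsto_mul_measureReal_deviationSet (P : Measure 𝒳) [IsProbabilityMeasure P] {h : 𝒳 → ℝ}
    (hm : Measurable h) {B : ℝ} (hB : ∀ᵐ x ∂P, |h x| ≤ B) {δ : ℝ} (hδ : 0 < δ) :
    Tendsto (fun M : ℕ => (M : ℝ) *
      (Measure.pi fun _ : Fin M => P).real (deviationSet P h δ M)) atTop (𝓝 0) := by
  -- `B` may be zero, and the exponent divides by the square of the bound.
  set C : ℝ := |B| + 1 with hC
  have hC0 : 0 < C := by positivity
  have hCh : ∀ᵐ x ∂P, |h x| ≤ C := hB.mono fun x hx => by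
    have := le_abs_self B
    linarith
  have hCn : ∀ᵐ x ∂P, |-h x| ≤ C := by simpa only [abs_neg] using hCh
  set k : ℝ := δ ^ 2 / (2 * C ^ 2) with hk
  have hk0 : 0 < k := by positivity
  have hlim : Tendsto (fun M : ℕ => (M : ℝ) * (2 * Real.exp (-k * M))) atTop (𝓝 0) := by
    have h1 := (Real.tendsto_pow_mul_exp_neg_atTop_nhds_zero 1).comp
      (tendsto_natCast_atTop_atTop.const_mul_atTop hk0 : Tendsto (fun M : ℕ => k * (M : ℝ)) _ _)
    have h2 := h1.const_mul (2 / k)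
    rw [mul_zero] at h2
    refine h2.congr fun M => ?_
    simp only [Function.comp_apply, pow_one, neg_mul]
    field_simp
  refine squeeze_zero' (Eventually.of_forall fun M => by positivity) ?_ hlim
  filter_upwards [eventually_gt_atTop 0] with M hM
  have hMr : (0 : ℝ) < M := by exact_mod_cast hM
  refine mul_le_mul_of_nonneg_left ?_ hMr.le
  have hsubset : deviationSet P h δ M ⊆
      {x | M * δ ≤ ∑ j, (h (x j) - ∫ y, h y ∂P)} ∪
      {x | M * δ ≤ ∑ j, (-h (x j) - ∫ y, -h y ∂P)} := by
    intro x hx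
    have hx' : δ ≤ |empiricalMean h x - ∫ y, h y ∂P| := hx
    have hsum : ∑ j, (h (x j) - ∫ y, h y ∂P) = M * (empiricalMean h x - ∫ y, h y ∂P) := by
      rw [Finset.sum_sub_distrib, Finset.sum_const, Finset.card_univ, Fintype.card_fin,
        nsmul_eq_mul, empiricalMean]
      field_simp
    have hsum' : ∑ j, (-h (x j) - ∫ y, -h y ∂P) = -∑ j, (h (x j) - ∫ y, h y ∂P) := by
      rw [integral_neg, ← Finset.sum_neg_distrib]
      exact Finset.sum_congr rfl fun j _ => by ring
    simp only [Set.mem_union, Set.mem_ofPred_eq, hsum', hsum]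
    rcases le_abs.mp hx' with h1 | h1
    · left
      exact mul_le_mul_of_nonneg_left h1 hMr.le
    · right
      rw [← mul_neg]
      exact mul_le_mul_of_nonneg_left h1 hMr.le
  refine (measureReal_mono hsubset).trans ((measureReal_union_le _ _).trans ?_)
  have e1 := measureReal_sum_ge_le P hm hC0 hCh hδ hM
  have e2 := measureReal_sum_ge_le P hm.neg hC0 hCn hδ hM
  simp only [Pi.neg_apply] at e2
  linarith

/-- If `e` maximizes `A` over `[l, u]`, then it is, to first order, one Newton step away from any
nearby point `θ`. -/
lemma abs_argmax_sub_newton_le {A A₁ A₂ : ℝ → ℝ} {l u θ e B D κ : ℝ}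
    (hA : ∀ φ ∈ Set.Icc l u, HasDerivAt A (A₁ φ) φ)
    (hA₁ : ∀ φ ∈ Set.Icc l u, HasDerivAt A₁ (A₂ φ) φ)
    (hLip : ∀ φ ∈ Set.Icc l u, |A₂ φ - A₂ θ| ≤ B * |φ - θ|) (hB : 0 ≤ B)
    (hθ : θ ∈ Set.Ioo l u) (he : e ∈ Set.Ioo l u) (hmax : ∀ φ ∈ Set.Icc l u, A φ ≤ A e)
    (hD : D < 0) (hκ : 0 ≤ κ) (hκ' : κ ≤ 1 / 2) (h₁ : |A₂ θ - D| ≤ κ / 2 * |D|)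
    (h₂ : B * |e - θ| ≤ κ / 2 * |D|) :
    |e - θ - (-(A₁ θ) / D)| ≤ 2 * κ * |A₁ θ / D| := by
  have hA₁e : A₁ e = 0 :=
    IsLocalMax.hasDerivAt_eq_zero
      (Filter.eventually_of_mem (Icc_mem_nhds he.1 he.2) fun φ hφ => hmax φ hφ)
      (hA e (Set.Ioo_subset_Icc_self he))
  -- Mean value theorem for `A₁`. Since `A₁ e = 0`, the error is exactly `-A₁ θ / A₂ ξ`, and it
  -- remains to replace `A₂ ξ` by `D`.
  obtain ⟨ξ, hξ, hξe⟩ : ∃ ξ, |ξ - θ| ≤ |e - θ| ∧ ξ ∈ Set.Icc l u ∧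
      A₁ e - A₁ θ = A₂ ξ * (e - θ) := by
    rcases lt_trichotomy θ e with h | h | h
    · obtain ⟨ξ, hξ, hs⟩ := exists_hasDerivAt_eq_slope A₁ A₂ h
        (fun φ hφ => (hA₁ φ ⟨hθ.1.le.trans hφ.1, hφ.2.trans he.2.le⟩).continuousAt.continuousWithinAt)
        (fun φ hφ => hA₁ φ ⟨hθ.1.le.trans hφ.1.le, hφ.2.le.trans he.2.le⟩)
      refine ⟨ξ, ?_, ⟨hθ.1.le.trans hξ.1.le, hξ.2.le.trans he.2.le⟩, ?_⟩
      · rw [abs_of_pos (sub_pos.2 hξ.1), abs_of_pos (sub_pos.2 h)]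
        linarith [hξ.2]
      · rw [hs, div_mul_cancel₀ _ (sub_pos.2 h).ne']
    · exact ⟨θ, by simp, Set.Ioo_subset_Icc_self hθ, by simp [h]⟩
    · obtain ⟨ξ, hξ, hs⟩ := exists_hasDerivAt_eq_slope A₁ A₂ h
        (fun φ hφ => (hA₁ φ ⟨he.1.le.trans hφ.1, hφ.2.trans hθ.2.le⟩).continuousAt.continuousWithinAt)
        (fun φ hφ => hA₁ φ ⟨he.1.le.trans hφ.1.le, hφ.2.le.trans hθ.2.le⟩)
      refine ⟨ξ, ?_, ⟨he.1.le.trans hξ.1.le, hξ.2.le.trans hθ.2.le⟩, ?_⟩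
      · rw [abs_of_neg (sub_neg.2 hξ.2), abs_of_neg (sub_neg.2 h)]
        linarith [hξ.1]
      · rw [hs]
        have : θ - e ≠ 0 := (sub_pos.2 h).ne'
        field_simp
        ring
  obtain ⟨hξD, hs⟩ := hξe
  have hclose : |A₂ ξ - D| ≤ κ * |D| := by
    have t1 := hLip ξ hξD
    have t2 : B * |ξ - θ| ≤ B * |e - θ| := mul_le_mul_of_nonneg_left hξ hB
    have t3 : |A₂ ξ - D| ≤ |A₂ ξ - A₂ θ| + |A₂ θ - D| := abs_sub_le _ _ _
    linarith
  have hD' : |D| = -D := abs_of_neg hD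
  have hDpos : 0 < |D| := by rw [hD']; linarith
  -- Here `κ ≤ 1/2` enters; the lost half is the factor `2` in the conclusion.
  have hneg : |D| / 2 ≤ |A₂ ξ| := by
    have t1 := abs_sub_abs_le_abs_sub D (A₂ ξ)
    rw [abs_sub_comm] at t1
    have t2 : κ * |D| ≤ 1 / 2 * |D| := mul_le_mul_of_nonneg_right hκ' (abs_nonneg _)
    linarith
  have hne : A₂ ξ ≠ 0 := by
    intro h0
    rw [h0, abs_zero] at hneg
    linarith
  have heq : e - θ - (-(A₁ θ) / D) = (A₁ θ / D) * ((A₂ ξ - D) / A₂ ξ) := by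
    have h3 : e - θ = -A₁ θ / A₂ ξ := by
      rw [eq_div_iff hne, mul_comm, ← hs, hA₁e]
      ring
    have hD0 : D ≠ 0 := hD.ne
    rw [h3]
    field_simp
    ring
  rw [heq, abs_mul, mul_comm]
  refine mul_le_mul_of_nonneg_right ?_ (abs_nonneg _)
  rw [abs_div, div_le_iff₀ (lt_of_lt_of_le (by positivity) hneg)]
  calc |A₂ ξ - D| ≤ κ * |D| := hclose
    _ = 2 * κ * (|D| / 2) := by ring
    _ ≤ 2 * κ * |A₂ ξ| := mul_le_mul_of_nonneg_left hneg (by positivity)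

/-- A strict maximum of a continuous function on `[l, u]` is well separated. -/
lemma exists_gap_of_strict_max {L : ℝ → ℝ} {l u θ r : ℝ} (hL : ContinuousOn L (Set.Icc l u))
    (hθ : ∀ φ ∈ Set.Icc l u, φ ≠ θ → L φ < L θ) (hr : 0 < r) :
    ∃ g > 0, ∀ φ ∈ Set.Icc l u, r ≤ |φ - θ| → L φ ≤ L θ - 4 * g := by
  have hcl : IsClosed {φ : ℝ | r ≤ |φ - θ|} :=
    isClosed_le continuous_const (continuous_id.sub continuous_const).abs
  have hK : IsCompact (Set.Icc l u ∩ {φ | r ≤ |φ - θ|}) := isCompact_Icc.inter_right hcl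
  rcases (Set.Icc l u ∩ {φ | r ≤ |φ - θ|}).eq_empty_or_nonempty with h | h
  · refine ⟨1, one_pos, fun φ hφ hr' => ?_⟩
    have : φ ∈ Set.Icc l u ∩ {φ | r ≤ |φ - θ|} := ⟨hφ, hr'⟩
    rw [h] at this
    exact this.elim
  · obtain ⟨x, hx, hmax⟩ := hK.exists_isMaxOn h (hL.mono Set.inter_subset_left)
    have hne : x ≠ θ := by
      rintro rfl
      have := hx.2
      simp only [Set.mem_ofPred_eq, sub_self, abs_zero] at this
      linarith
    refine ⟨(L θ - L x) / 4, by linarith [hθ x hx.1 hne], fun φ hφ hr' => ?_⟩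
    have : L φ ≤ L x := hmax ⟨hφ, hr'⟩
    linarith

/-- If `A` is close to `L` on a fine enough net, then a maximizer of `A` is close to the strict
maximum `θ` of `L`. -/
lemma abs_argmax_sub_lt_of_net {A L : ℝ → ℝ} {l u θ e B r g ρ : ℝ} {t : Set ℝ}
    (hA : ∀ φ ∈ Set.Icc l u, ∀ φ' ∈ Set.Icc l u, |A φ - A φ'| ≤ B * |φ - φ'|)
    (hL : ∀ φ ∈ Set.Icc l u, ∀ φ' ∈ Set.Icc l u, |L φ - L φ'| ≤ B * |φ - φ'|)
    (hB : 0 ≤ B) (hBρ : B * ρ < g) (hg : ∀ φ ∈ Set.Icc l u, r ≤ |φ - θ| → L φ ≤ L θ - 4 * g)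
    (ht : t ⊆ Set.Icc l u) (hcov : Set.Icc l u ⊆ ⋃ x ∈ t, Metric.ball x ρ)
    (hclose : ∀ φ ∈ t, |A φ - L φ| < g) (hcloseθ : |A θ - L θ| < g)
    (he : e ∈ Set.Icc l u) (hmax : A θ ≤ A e) : |e - θ| < r := by
  -- Four errors share the gap `4 * g`: the deviations of `A` from `L` at `θ` and at the net point
  -- `x`, and the moves from `e` to `x` in `A` and in `L`. Each is below `g`.
  by_contra hcon
  have hgap := hg e he (not_lt.mp hcon)
  obtain ⟨x, hx, hex⟩ := Set.mem_iUnion₂.mp (hcov he)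
  have hd : |e - x| ≤ ρ := by
    have := Metric.mem_ball.mp hex
    rw [Real.dist_eq] at this
    exact this.le
  have h1 := hA e he x (ht hx)
  have h2 := hL e he x (ht hx)
  have h3 : B * |e - x| ≤ B * ρ := mul_le_mul_of_nonneg_left hd hB
  have h4 := abs_lt.mp (hclose x hx)
  have h5 := abs_lt.mp hcloseθ
  have h6 := abs_le.mp (h1.trans h3)
  have h7 := abs_le.mp (h2.trans h3)
  linarith [h4.1, h4.2, h5.1, h5.2, h6.1, h6.2, h7.1, h7.2]


/-- The regularity conditions under which a maximum likelihood type estimator is asymptotically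
normal: the contrast `m x φ` is smooth in `φ ∈ [l, u]` with derivatives `m₁`, `m₂`, everything is
bounded, and the mean contrast has a strict, nondegenerate maximum at an interior point `θ`. -/
structure RegularContrast (P : Measure 𝒳) (K : Set 𝒳) (l u θ B : ℝ) (m m₁ m₂ : 𝒳 → ℝ → ℝ) :
    Prop where
  ae_mem : ∀ᵐ x ∂P, x ∈ K
  meas : ∀ φ, Measurable fun x => m x φ
  meas₁ : ∀ φ, Measurable fun x => m₁ x φ
  meas₂ : ∀ φ, Measurable fun x => m₂ x φ
  deriv : ∀ x ∈ K, ∀ φ ∈ Set.Icc l u, HasDerivAt (m x) (m₁ x φ) φ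
  deriv₁ : ∀ x ∈ K, ∀ φ ∈ Set.Icc l u, HasDerivAt (m₁ x) (m₂ x φ) φ
  bound : ∀ x ∈ K, ∀ φ ∈ Set.Icc l u, |m x φ| ≤ B
  bound₁ : ∀ x ∈ K, ∀ φ ∈ Set.Icc l u, |m₁ x φ| ≤ B
  bound₂ : ∀ x ∈ K, ∀ φ ∈ Set.Icc l u, |m₂ x φ| ≤ B
  lip₂ : ∀ x ∈ K, ∀ φ ∈ Set.Icc l u, ∀ φ' ∈ Set.Icc l u, |m₂ x φ - m₂ x φ'| ≤ B * |φ - φ'|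
  mem : θ ∈ Set.Ioo l u
  strict_max : ∀ φ ∈ Set.Icc l u, φ ≠ θ → ∫ x, m x φ ∂P < ∫ x, m x θ ∂P
  nondeg : ∫ x, m₂ x θ ∂P < 0

namespace RegularContrast

variable {P : Measure 𝒳} [IsProbabilityMeasure P] {K : Set 𝒳} {l u θ B : ℝ}
  {m m₁ m₂ : 𝒳 → ℝ → ℝ}

omit [IsProbabilityMeasure P] in
lemma mem_Icc (h : RegularContrast P K l u θ B m m₁ m₂) : θ ∈ Set.Icc l u :=
  Set.Ioo_subset_Icc_self h.mem

lemma bound_nonneg (h : RegularContrast P K l u θ B m m₁ m₂) : 0 ≤ B := by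
  obtain ⟨x, hx⟩ := h.ae_mem.exists
  exact (abs_nonneg _).trans (h.bound x hx θ h.mem_Icc)

lemma integrable (h : RegularContrast P K l u θ B m m₁ m₂) {φ : ℝ} (hφ : φ ∈ Set.Icc l u) :
    Integrable (fun x => m x φ) P :=
  Integrable.of_bound (h.meas φ).aestronglyMeasurable B
    (h.ae_mem.mono fun x hx => h.bound x hx φ hφ)

lemma integrable₁ (h : RegularContrast P K l u θ B m m₁ m₂) {φ : ℝ} (hφ : φ ∈ Set.Icc l u) :
    Integrable (fun x => m₁ x φ) P :=
  Integrable.of_bound (h.meas₁ φ).aestronglyMeasurable B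
    (h.ae_mem.mono fun x hx => h.bound₁ x hx φ hφ)

omit [IsProbabilityMeasure P] in
lemma lip (h : RegularContrast P K l u θ B m m₁ m₂) {x : 𝒳} (hx : x ∈ K) {φ φ' : ℝ}
    (hφ : φ ∈ Set.Icc l u) (hφ' : φ' ∈ Set.Icc l u) : |m x φ - m x φ'| ≤ B * |φ - φ'| :=
  Convex.norm_image_sub_le_of_norm_hasDerivWithin_le (f' := m₁ x)
    (fun ψ hψ => (h.deriv x hx ψ hψ).hasDerivWithinAt) (fun ψ hψ => h.bound₁ x hx ψ hψ)
    (convex_Icc l u) hφ' hφ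

lemma lip_integral (h : RegularContrast P K l u θ B m m₁ m₂) {φ φ' : ℝ}
    (hφ : φ ∈ Set.Icc l u) (hφ' : φ' ∈ Set.Icc l u) :
    |(∫ x, m x φ ∂P) - ∫ x, m x φ' ∂P| ≤ B * |φ - φ'| := by
  rw [← integral_sub (h.integrable hφ) (h.integrable hφ')]
  have := norm_integral_le_of_norm_le_const (μ := P) (f := fun x => m x φ - m x φ')
    (h.ae_mem.mono fun x hx => h.lip hx hφ hφ')
  simpa using this

lemma continuousOn_integral (h : RegularContrast P K l u θ B m m₁ m₂) :
    ContinuousOn (fun φ => ∫ x, m x φ ∂P) (Set.Icc l u) := by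
  have : LipschitzOnWith (Real.toNNReal B) (fun φ => ∫ x, m x φ ∂P) (Set.Icc l u) := by
    refine LipschitzOnWith.of_dist_le_mul fun φ hφ φ' hφ' => ?_
    rw [Real.dist_eq, Real.dist_eq, Real.coe_toNNReal _ h.bound_nonneg]
    exact h.lip_integral hφ hφ'
  exact this.continuousOn

/-- The mean contrast can be differentiated under the integral and has an interior maximum at `θ`.
This is what centres the linearized error. -/
lemma integral_deriv_eq_zero (h : RegularContrast P K l u θ B m m₁ m₂) :
    ∫ x, m₁ x θ ∂P = 0 := by
  have hnhds : Set.Icc l u ∈ 𝓝 θ := Icc_mem_nhds h.mem.1 h.mem.2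
  have hd := (hasDerivAt_integral_of_dominated_loc_of_deriv_le (μ := P) (F := fun φ x => m x φ)
    (F' := fun φ x => m₁ x φ) (bound := fun _ => B) hnhds
    (Eventually.of_forall fun φ => (h.meas φ).aestronglyMeasurable) (h.integrable h.mem_Icc)
    (h.meas₁ θ).aestronglyMeasurable
    (h.ae_mem.mono fun x hx φ hφ => h.bound₁ x hx φ hφ) (integrable_const _)
    (h.ae_mem.mono fun x hx φ hφ => h.deriv x hx φ hφ)).2
  refine IsLocalMax.hasDerivAt_eq_zero (Filter.eventually_of_mem hnhds fun φ hφ => ?_) hd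
  rcases eq_or_ne φ θ with rfl | hne
  · exact le_rfl
  · exact (h.strict_max φ hφ hne).le

omit [IsProbabilityMeasure P] in
lemma hasDerivAt_empiricalMean (h : RegularContrast P K l u θ B m m₁ m₂) {M : ℕ}
    {x : Fin M → 𝒳} (hx : ∀ j, x j ∈ K) {φ : ℝ} (hφ : φ ∈ Set.Icc l u) :
    HasDerivAt (fun φ => empiricalMean (fun y => m y φ) x) (empiricalMean (fun y => m₁ y φ) x) φ := by
  unfold empiricalMean
  refine HasDerivAt.const_mul _ ?_
  exact HasDerivAt.fun_sum fun j _ => h.deriv _ (hx j) φ hφ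

omit [IsProbabilityMeasure P] in
lemma hasDerivAt_empiricalMean₁ (h : RegularContrast P K l u θ B m m₁ m₂) {M : ℕ}
    {x : Fin M → 𝒳} (hx : ∀ j, x j ∈ K) {φ : ℝ} (hφ : φ ∈ Set.Icc l u) :
    HasDerivAt (fun φ => empiricalMean (fun y => m₁ y φ) x)
      (empiricalMean (fun y => m₂ y φ) x) φ := by
  unfold empiricalMean
  refine HasDerivAt.const_mul _ ?_
  exact HasDerivAt.fun_sum fun j _ => h.deriv₁ _ (hx j) φ hφ

end RegularContrast

omit [MeasurableSpace 𝒳] in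
lemma empiricalMean_sub {M : ℕ} (h h' : 𝒳 → ℝ) (x : Fin M → 𝒳) :
    empiricalMean h x - empiricalMean h' x = empiricalMean (fun y => h y - h' y) x := by
  unfold empiricalMean
  rw [Finset.sum_sub_distrib, mul_sub]

omit [MeasurableSpace 𝒳] in
lemma abs_empiricalMean_le {M : ℕ} {h : 𝒳 → ℝ} {x : Fin M → 𝒳} {C : ℝ} (hC : 0 ≤ C)
    (hx : ∀ j, |h (x j)| ≤ C) : |empiricalMean h x| ≤ C := by
  unfold empiricalMean
  have h1 : |∑ j, h (x j)| ≤ M * C := by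
    refine (Finset.abs_sum_le_sum_abs _ _).trans ((Finset.sum_le_sum fun j _ => hx j).trans ?_)
    simp
  rw [abs_mul, abs_of_nonneg (by positivity : (0 : ℝ) ≤ 1 / M)]
  rcases Nat.eq_zero_or_pos M with rfl | hM
  · simpa using hC
  · have hMr : (0 : ℝ) < M := by exact_mod_cast hM
    calc 1 / (M : ℝ) * |∑ j, h (x j)| ≤ 1 / M * (M * C) := by gcongr
      _ = C := by field_simp

lemma ae_forall_mem_pi {P : Measure 𝒳} [IsProbabilityMeasure P] {K : Set 𝒳}
    (hK : ∀ᵐ x ∂P, x ∈ K) (M : ℕ) :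
    ∀ᵐ x ∂(Measure.pi fun _ : Fin M => P), ∀ j, x j ∈ K :=
  ae_all_iff.mpr fun j => (measurePreserving_eval (fun _ : Fin M => P) j).quasiMeasurePreserving.ae hK

lemma integral_empiricalMean {P : Measure 𝒳} [IsProbabilityMeasure P] {h : 𝒳 → ℝ}
    (hm : Measurable h) (hi : Integrable h P) {M : ℕ} (hM : 0 < M) :
    ∫ x, empiricalMean h x ∂(Measure.pi fun _ : Fin M => P) = ∫ y, h y ∂P := by
  unfold empiricalMean
  have hMr : (0 : ℝ) < M := by exact_mod_cast hM
  rw [integral_const_mul, integral_finsetSum]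
  · simp_rw [integral_comp_eval (μ := fun _ : Fin M => P) hm.aestronglyMeasurable]
    simp only [Finset.sum_const, Finset.card_univ, Fintype.card_fin, nsmul_eq_mul]
    field_simp
  · intro j _
    exact (measurePreserving_eval (fun _ : Fin M => P) j).integrable_comp_of_integrable hi

lemma integral_sq_empiricalMean {P : Measure 𝒳} [IsProbabilityMeasure P] {h : 𝒳 → ℝ}
    (hm : Measurable h) {B : ℝ} (hB : ∀ᵐ x ∂P, |h x| ≤ B) (h0 : ∫ y, h y ∂P = 0)
    {M : ℕ} (hM : 0 < M) :
    M * ∫ x, empiricalMean h x ^ 2 ∂(Measure.pi fun _ : Fin M => P) = ∫ y, h y ^ 2 ∂P := by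
  have hMr : (0 : ℝ) < M := by exact_mod_cast hM
  have hL : MemLp h 2 P := MemLp.of_bound hm.aestronglyMeasurable B hB
  have hv := variance_sum_pi (μ := fun _ : Fin M => P) (X := fun _ => h) fun _ => hL
  have hsum : (∑ i, fun x : Fin M → 𝒳 => h (x i)) = fun x => M * empiricalMean h x := by
    ext x
    simp only [Finset.sum_apply, empiricalMean]
    field_simp
  rw [hsum, variance_const_mul, variance_of_integral_eq_zero, variance_of_integral_eq_zero] at hv
  · simp only [Finset.sum_const, Finset.card_univ, Fintype.card_fin, nsmul_eq_mul] at hv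
    rw [sq, mul_assoc] at hv
    exact mul_left_cancel₀ hMr.ne' hv
  · exact hm.aemeasurable
  · exact h0
  · exact (measurable_empiricalMean hm M).aemeasurable
  · rw [integral_empiricalMean hm (hL.integrable (by norm_num)) hM, h0]

namespace RegularContrast

variable {P : Measure 𝒳} [IsProbabilityMeasure P] {K : Set 𝒳} {l u θ B : ℝ}
  {m m₁ m₂ : 𝒳 → ℝ → ℝ}

/-- The first-order approximation of the error of the estimator. -/
noncomputable def linearError (P : Measure 𝒳) (θ : ℝ) (m₁ m₂ : 𝒳 → ℝ → ℝ) {M : ℕ}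
    (x : Fin M → 𝒳) : ℝ :=
  -(empiricalMean (fun y => m₁ y θ) x) / ∫ y, m₂ y θ ∂P

/-- Outside a finite union of deviation sets the error of a maximizer is its first-order
approximation, up to a small factor. -/
lemma exists_finite_net (h : RegularContrast P K l u θ B m m₁ m₂) {κ : ℝ} (hκ : 0 < κ)
    (hκ' : κ ≤ 1 / 2) :
    ∃ t : Set ℝ, t.Finite ∧ ∃ g > 0, ∃ δ > 0, t ⊆ Set.Icc l u ∧
      ∀ (M : ℕ) (x : Fin M → 𝒳) (e : ℝ), (∀ j, x j ∈ K) → e ∈ Set.Icc l u →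
        (∀ φ ∈ Set.Icc l u, empiricalMean (fun y => m y φ) x ≤ empiricalMean (fun y => m y e) x) →
        (∀ φ ∈ t, x ∉ deviationSet P (fun y => m y φ) g M) →
        x ∉ deviationSet P (fun y => m₂ y θ) δ M →
        |e - θ - linearError P θ m₁ m₂ x| ≤ 2 * κ * |linearError P θ m₁ m₂ x| := by
  set D : ℝ := ∫ y, m₂ y θ ∂P with hD
  have hDneg : D < 0 := h.nondeg
  have hDpos : 0 < |D| := abs_pos.mpr hDneg.ne
  have hB := h.bound_nonneg
  have hl := h.mem.1
  have hu := h.mem.2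
  -- Within distance `r` of `θ` the estimate is interior and the second derivative varies by at most
  -- `κ / 2 * |D|`. The other `κ / 2 * |D|` is left for the sampling error of the curvature at `θ`.
  obtain ⟨r, hr0, hrl, hru, hrB⟩ : ∃ r > 0, r ≤ θ - l ∧ r ≤ u - θ ∧ B * r ≤ κ / 2 * |D| := by
    refine ⟨min (min (θ - l) (u - θ)) (κ / 2 * |D| / (B + 1)), ?_, ?_, ?_, ?_⟩
    · exact lt_min (lt_min (by linarith) (by linarith)) (by positivity)
    · exact (min_le_left _ _).trans (min_le_left _ _)
    · exact (min_le_left _ _).trans (min_le_right _ _)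
    · calc B * min (min (θ - l) (u - θ)) (κ / 2 * |D| / (B + 1))
          ≤ (B + 1) * (κ / 2 * |D| / (B + 1)) := by
            refine mul_le_mul (by linarith) (min_le_right _ _) ?_ (by linarith)
            exact le_min (le_min (by linarith) (by linarith)) (by positivity)
        _ = κ / 2 * |D| := by field_simp
  obtain ⟨g, hg0, hg⟩ := exists_gap_of_strict_max h.continuousOn_integral h.strict_max hr0
  set ρ : ℝ := g / (2 * (B + 1)) with hρ
  have hρ0 : 0 < ρ := by positivity
  have hBρ : B * ρ < g := by
    rw [hρ, mul_div_assoc', div_lt_iff₀ (by positivity)]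
    nlinarith
  obtain ⟨t, htD, htf, htc⟩ := (isCompact_Icc (a := l) (b := u)).finite_cover_balls hρ0
  refine ⟨insert θ t, htf.insert θ, g, hg0, κ / 2 * |D|, by positivity,
    Set.insert_subset h.mem_Icc htD, ?_⟩
  intro M x e hx he hmax hdev hdev₂
  have hdev' : ∀ φ ∈ insert θ t, |empiricalMean (fun y => m y φ) x - ∫ y, m y φ ∂P| < g :=
    fun φ hφ => not_le.mp (hdev φ hφ)
  have hdev₂' : |empiricalMean (fun y => m₂ y θ) x - D| < κ / 2 * |D| := not_le.mp hdev₂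
  have hloc : |e - θ| < r := by
    refine abs_argmax_sub_lt_of_net (A := fun φ => empiricalMean (fun y => m y φ) x)
      (L := fun φ => ∫ y, m y φ ∂P) (t := t) ?_ (fun φ hφ φ' hφ' => h.lip_integral hφ hφ')
      hB hBρ hg htD htc (fun φ hφ => hdev' φ (Set.mem_insert_of_mem _ hφ))
      (hdev' θ (Set.mem_insert _ _)) he (hmax θ h.mem_Icc)
    intro φ hφ φ' hφ'
    simp only [empiricalMean_sub]
    exact abs_empiricalMean_le (by positivity) fun j => h.lip (hx j) hφ hφ'
  have he' : e ∈ Set.Ioo l u := by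
    have := abs_lt.mp hloc
    exact ⟨by linarith, by linarith⟩
  have hkey := abs_argmax_sub_newton_le (A := fun φ => empiricalMean (fun y => m y φ) x)
    (A₁ := fun φ => empiricalMean (fun y => m₁ y φ) x)
    (A₂ := fun φ => empiricalMean (fun y => m₂ y φ) x) (B := B) (κ := κ) (D := D)
    (fun φ hφ => h.hasDerivAt_empiricalMean hx hφ) (fun φ hφ => h.hasDerivAt_empiricalMean₁ hx hφ)
    (fun φ hφ => by
      simp only [empiricalMean_sub]
      exact abs_empiricalMean_le (by positivity) fun j => h.lip₂ _ (hx j) φ hφ θ h.mem_Icc)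
    hB h.mem he' hmax hDneg hκ.le hκ' hdev₂'.le
    ((mul_le_mul_of_nonneg_left hloc.le hB).trans hrB)
  unfold linearError
  rw [← hD, neg_div, abs_neg, ← neg_div]
  exact hkey

omit [IsProbabilityMeasure P] in
lemma measurable_linearError (h : RegularContrast P K l u θ B m m₁ m₂) (M : ℕ) :
    Measurable fun x : Fin M → 𝒳 => linearError P θ m₁ m₂ x :=
  (measurable_empiricalMean (h.meas₁ θ) M).neg.div_const _

lemma abs_linearError_le (h : RegularContrast P K l u θ B m m₁ m₂) {M : ℕ} {x : Fin M → 𝒳}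
    (hx : ∀ j, x j ∈ K) : |linearError P θ m₁ m₂ x| ≤ B / |∫ y, m₂ y θ ∂P| := by
  unfold linearError
  rw [abs_div, abs_neg]
  refine div_le_div_of_nonneg_right ?_ (abs_nonneg _)
  exact abs_empiricalMean_le h.bound_nonneg fun j => h.bound₁ _ (hx j) θ h.mem_Icc

lemma integral_linearError (h : RegularContrast P K l u θ B m m₁ m₂) {M : ℕ} (hM : 0 < M) :
    ∫ x, linearError P θ m₁ m₂ x ∂(Measure.pi fun _ : Fin M => P) = 0 := by
  unfold linearError
  rw [integral_div, integral_neg,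
    integral_empiricalMean (h.meas₁ θ) (h.integrable₁ h.mem_Icc) hM, h.integral_deriv_eq_zero]
  simp

lemma integral_sq_linearError (h : RegularContrast P K l u θ B m m₁ m₂) {M : ℕ} (hM : 0 < M) :
    M * ∫ x, linearError P θ m₁ m₂ x ^ 2 ∂(Measure.pi fun _ : Fin M => P) =
      (∫ x, m₁ x θ ^ 2 ∂P) / (∫ x, m₂ x θ ∂P) ^ 2 := by
  unfold linearError
  simp_rw [div_pow, neg_sq]
  rw [integral_div, ← mul_div_assoc, integral_sq_empiricalMean (h.meas₁ θ)
    (h.ae_mem.mono fun x hx => h.bound₁ x hx θ h.mem_Icc) h.integral_deriv_eq_zero hM]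

variable {est : (M : ℕ) → (Fin M → 𝒳) → ℝ}

/-- The mean squared error of the first-order approximation is `o(1 / M)`. -/
lemma tendsto_integral_sq_remainder (h : RegularContrast P K l u θ B m m₁ m₂)
    (hmem : ∀ M (x : Fin M → 𝒳), (∀ j, x j ∈ K) → est M x ∈ Set.Icc l u)
    (hmax : ∀ M (x : Fin M → 𝒳), (∀ j, x j ∈ K) → ∀ φ ∈ Set.Icc l u,
      empiricalMean (fun y => m y φ) x ≤ empiricalMean (fun y => m y (est M x)) x) :
    Tendsto (fun M : ℕ => (M : ℝ) * ∫ x, (est M x - θ - linearError P θ m₁ m₂ x) ^ 2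
      ∂(Measure.pi fun _ : Fin M => P)) atTop (𝓝 0) := by
  set v : ℝ := (∫ x, m₁ x θ ^ 2 ∂P) / (∫ x, m₂ x θ ∂P) ^ 2 with hv
  have hv0 : 0 ≤ v := div_nonneg (integral_nonneg fun x => sq_nonneg _) (sq_nonneg _)
  -- A crude bound on the remainder, enough on the exceptional set because that set has probability
  -- `o(1 / M)`.
  set C : ℝ := (u - l) + B / |∫ y, m₂ y θ ∂P| with hC
  rw [Metric.tendsto_atTop']
  intro η hη
  -- Off the exceptional set the remainder is at most `2κ` times the linear error, whose second
  -- moment times `M` is exactly `v`.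
  obtain ⟨κ, hκ0, hκ1, hκv⟩ : ∃ κ > 0, κ ≤ 1 / 2 ∧ 4 * κ ^ 2 * v ≤ η / 2 := by
    refine ⟨min (1 / 2) (η / (4 * (v + 1))), lt_min (by norm_num) (by positivity),
      min_le_left _ _, ?_⟩
    set k := min (1 / 2) (η / (4 * (v + 1))) with hk
    have hk0 : 0 < k := lt_min (by norm_num) (by positivity)
    have hk1 : k ≤ 1 / 2 := min_le_left _ _
    have hk2 : k ≤ η / (4 * (v + 1)) := min_le_right _ _
    rw [le_div_iff₀ (by positivity)] at hk2
    have h3 : k ^ 2 ≤ 1 / 2 * k := by nlinarith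
    nlinarith
  obtain ⟨t, htf, g, hg0, δ, hδ0, htD, hdet⟩ := h.exists_finite_net hκ0 hκ1
  set N : (M : ℕ) → Set (Fin M → 𝒳) := fun M =>
    (⋃ φ ∈ htf.toFinset, deviationSet P (fun y => m y φ) g M) ∪
      deviationSet P (fun y => m₂ y θ) δ M with hN
  have hNmeas : ∀ M, MeasurableSet (N M) := fun M =>
    (Finset.measurableSet_biUnion _ fun φ _ =>
      measurableSet_deviationSet P (h.meas φ) g M).union
      (measurableSet_deviationSet P (h.meas₂ θ) δ M)
  have hNlim : Tendsto (fun M : ℕ => C ^ 2 * ((M : ℝ) *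
      (Measure.pi fun _ : Fin M => P).real (N M))) atTop (𝓝 0) := by
    rw [← mul_zero (C ^ 2)]
    refine Tendsto.const_mul _ ?_
    have h1 : Tendsto (fun M : ℕ =>
        (∑ φ ∈ htf.toFinset, (M : ℝ) * (Measure.pi fun _ : Fin M => P).real
          (deviationSet P (fun y => m y φ) g M)) +
        (M : ℝ) * (Measure.pi fun _ : Fin M => P).real
          (deviationSet P (fun y => m₂ y θ) δ M)) atTop (𝓝 0) := by
      rw [← add_zero (0 : ℝ)]
      refine Tendsto.add ?_ (tendsto_mul_measureReal_deviationSet P (h.meas₂ θ)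
        (h.ae_mem.mono fun x hx => h.bound₂ x hx θ h.mem_Icc) hδ0)
      rw [← Finset.sum_const_zero (s := htf.toFinset)]
      refine tendsto_finsetSum _ fun φ hφ => ?_
      exact tendsto_mul_measureReal_deviationSet P (h.meas φ)
        (h.ae_mem.mono fun x hx => h.bound x hx φ (htD (htf.mem_toFinset.mp hφ))) hg0
    refine squeeze_zero (fun M => by positivity) (fun M => ?_) h1
    rw [← Finset.mul_sum, ← mul_add]
    refine mul_le_mul_of_nonneg_left ?_ (Nat.cast_nonneg _)
    refine (measureReal_union_le _ _).trans ?_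
    gcongr
    exact measureReal_biUnion_finset_le _ _
  obtain ⟨M₀, hM₀⟩ := (Metric.tendsto_atTop.mp hNlim) (η / 2) (by positivity)
  refine ⟨M₀, fun M hM => ?_⟩
  have hMpos : 0 < M := lt_of_le_of_lt (Nat.zero_le _) hM
  have hMr : (0 : ℝ) < M := by exact_mod_cast hMpos
  set μ : Measure (Fin M → 𝒳) := Measure.pi fun _ : Fin M => P with hμ
  have hNM := hM₀ M hM.le
  rw [Real.dist_eq, sub_zero] at hNM
  have hNM' := (abs_lt.mp hNM).2
  have hae := ae_forall_mem_pi h.ae_mem M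
  have hWsq : Integrable (fun x => linearError P θ m₁ m₂ x ^ 2) μ := by
    refine Integrable.of_bound ((h.measurable_linearError M).pow_const 2).aestronglyMeasurable
      ((B / |∫ y, m₂ y θ ∂P|) ^ 2) (hae.mono fun x hx => ?_)
    rw [Real.norm_eq_abs, abs_pow]
    exact pow_le_pow_left₀ (abs_nonneg _) (h.abs_linearError_le hx) 2
  have hind : Integrable ((N M).indicator fun _ => C ^ 2) μ :=
    (integrable_const _).indicator (hNmeas M)
  have hle : ∫ x, (est M x - θ - linearError P θ m₁ m₂ x) ^ 2 ∂μ ≤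
      ∫ x, (4 * κ ^ 2 * linearError P θ m₁ m₂ x ^ 2 + (N M).indicator (fun _ => C ^ 2) x) ∂μ := by
    refine integral_mono_of_nonneg (Eventually.of_forall fun x => sq_nonneg _)
      ((hWsq.const_mul _).add hind) ?_
    filter_upwards [hae] with x hx
    by_cases hxN : x ∈ N M
    · rw [Set.indicator_of_mem hxN]
      have h1 : |est M x - θ - linearError P θ m₁ m₂ x| ≤ C := by
        have h2 := hmem M x hx
        have h3 := h.mem_Icc
        have h4 : |est M x - θ| ≤ u - l :=
          abs_le.mpr ⟨by linarith [h2.1, h3.2], by linarith [h2.2, h3.1]⟩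
        calc |est M x - θ - linearError P θ m₁ m₂ x|
            ≤ |est M x - θ| + |linearError P θ m₁ m₂ x| := abs_sub _ _
          _ ≤ C := add_le_add h4 (h.abs_linearError_le hx)
      have h5 := sq_le_sq' (by linarith [(abs_le.mp h1).1]) (abs_le.mp h1).2
      have h6 : 0 ≤ 4 * κ ^ 2 * linearError P θ m₁ m₂ x ^ 2 := by positivity
      linarith
    · rw [Set.indicator_of_notMem hxN, add_zero]
      simp only [hN, Set.mem_union, Set.mem_iUnion, not_or, not_exists] at hxN
      have h1 := hdet M x (est M x) hx (hmem M x hx) (hmax M x hx)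
        (fun φ hφ => hxN.1 φ (htf.mem_toFinset.mpr hφ)) hxN.2
      rw [← sq_abs (est M x - θ - _), ← sq_abs (linearError P θ m₁ m₂ x)]
      calc |est M x - θ - linearError P θ m₁ m₂ x| ^ 2
          ≤ (2 * κ * |linearError P θ m₁ m₂ x|) ^ 2 := pow_le_pow_left₀ (abs_nonneg _) h1 2
        _ = _ := by ring
  rw [integral_add (hWsq.const_mul _) hind, integral_const_mul,
    integral_indicator_const _ (hNmeas M), smul_eq_mul] at hle
  have hWv := h.integral_sq_linearError hMpos
  rw [← hv] at hWv
  rw [Real.dist_eq, sub_zero, abs_of_nonneg (mul_nonneg hMr.le (integral_nonneg fun x => sq_nonneg _))]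
  calc (M : ℝ) * ∫ x, (est M x - θ - linearError P θ m₁ m₂ x) ^ 2 ∂μ
      ≤ M * (4 * κ ^ 2 * ∫ x, linearError P θ m₁ m₂ x ^ 2 ∂μ + μ.real (N M) * C ^ 2) :=
        mul_le_mul_of_nonneg_left hle hMr.le
    _ = 4 * κ ^ 2 * (M * ∫ x, linearError P θ m₁ m₂ x ^ 2 ∂μ) + C ^ 2 * (M * μ.real (N M)) := by
        ring
    _ < η / 2 + η / 2 := by
        rw [hWv]
        exact add_lt_add_of_le_of_lt hκv hNM'
    _ = η := by ring

/-- Consistency and asymptotic variance of an estimator that maximizes a regular contrast. -/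
theorem tendsto_mean_and_variance (h : RegularContrast P K l u θ B m m₁ m₂)
    (hmeas : ∀ M, Measurable (est M))
    (hmem : ∀ M (x : Fin M → 𝒳), (∀ j, x j ∈ K) → est M x ∈ Set.Icc l u)
    (hmax : ∀ M (x : Fin M → 𝒳), (∀ j, x j ∈ K) → ∀ φ ∈ Set.Icc l u,
      empiricalMean (fun y => m y φ) x ≤ empiricalMean (fun y => m y (est M x)) x) :
    Tendsto (fun M : ℕ => ∫ x, est M x ∂(Measure.pi fun _ : Fin M => P)) atTop (𝓝 θ) ∧
    Tendsto (fun M : ℕ => (M : ℝ) * variance (est M) (Measure.pi fun _ : Fin M => P)) atTop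
      (𝓝 ((∫ x, m₁ x θ ^ 2 ∂P) / (∫ x, m₂ x θ ∂P) ^ 2)) := by
  set v : ℝ := (∫ x, m₁ x θ ^ 2 ∂P) / (∫ x, m₂ x θ ∂P) ^ 2 with hv
  have hv0 : 0 ≤ v := div_nonneg (integral_nonneg fun x => sq_nonneg _) (sq_nonneg _)
  set μ : (M : ℕ) → Measure (Fin M → 𝒳) := fun M => Measure.pi fun _ : Fin M => P with hμ
  set W : (M : ℕ) → (Fin M → 𝒳) → ℝ := fun M x => linearError P θ m₁ m₂ x with hW
  set Y : (M : ℕ) → (Fin M → 𝒳) → ℝ := fun M x => est M x - θ - W M x with hY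
  have hylim := h.tendsto_integral_sq_remainder hmem hmax
  set y : ℕ → ℝ := fun M => (M : ℝ) * ∫ x, Y M x ^ 2 ∂(μ M) with hy
  change Tendsto y atTop (𝓝 0) at hylim
  have hWmeas : ∀ M, Measurable (W M) := h.measurable_linearError
  have hYmeas : ∀ M, Measurable (Y M) := fun M => ((hmeas M).sub_const _).sub (hWmeas M)
  have hWL : ∀ M, MemLp (W M) 2 (μ M) := fun M =>
    MemLp.of_bound (hWmeas M).aestronglyMeasurable (B / |∫ y, m₂ y θ ∂P|)
      ((ae_forall_mem_pi h.ae_mem M).mono fun x hx => h.abs_linearError_le hx)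
  have heL : ∀ M, MemLp (est M) 2 (μ M) := fun M =>
    MemLp.of_bound (hmeas M).aestronglyMeasurable (max |l| |u|)
      ((ae_forall_mem_pi h.ae_mem M).mono fun x hx =>
        abs_le_max_abs_abs (hmem M x hx).1 (hmem M x hx).2)
  have hYL : ∀ M, MemLp (Y M) 2 (μ M) := fun M => ((heL M).sub (memLp_const θ)).sub (hWL M)
  have hmean : ∀ M, 0 < M → ∫ x, est M x ∂(μ M) - θ = ∫ x, Y M x ∂(μ M) := by
    intro M hM
    have hei := (heL M).integrable (by norm_num)
    have hWi := (hWL M).integrable (by norm_num)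
    have hsplit : ∫ x, Y M x ∂(μ M) = ∫ x, (est M x - θ) ∂(μ M) - ∫ x, W M x ∂(μ M) :=
      integral_sub (hei.sub (integrable_const _)) hWi
    rw [hsplit, integral_sub hei (integrable_const _)]
    have : ∫ x, W M x ∂(μ M) = 0 := h.integral_linearError hM
    rw [this]
    simp
  -- Jensen's inequality, in the form that the variance of `Y` is nonnegative. Since `W` is centred,
  -- the mean of `Y` is the whole bias at `M` samples.
  have hJ : ∀ M : ℕ, 0 < M → (M : ℝ) * (∫ x, Y M x ∂(μ M)) ^ 2 ≤ y M := by
    intro M hM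
    have h1 := variance_nonneg (Y M) (μ M)
    rw [variance_eq_sub (hYL M)] at h1
    refine mul_le_mul_of_nonneg_left ?_ (Nat.cast_nonneg _)
    simp only [Pi.pow_apply] at h1
    linarith
  have hbias : Tendsto (fun M : ℕ => (M : ℝ) * (∫ x, Y M x ∂(μ M)) ^ 2) atTop (𝓝 0) :=
    squeeze_zero' (Eventually.of_forall fun M => by positivity)
      ((eventually_gt_atTop 0).mono fun M hM => hJ M hM) hylim
  constructor
  · have h1 : Tendsto (fun M : ℕ => ∫ x, Y M x ∂(μ M)) atTop (𝓝 0) := by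
      have h2 : Tendsto (fun M : ℕ => (∫ x, Y M x ∂(μ M)) ^ 2) atTop (𝓝 0) := by
        refine squeeze_zero' (Eventually.of_forall fun M => by positivity) ?_ hylim
        filter_upwards [eventually_gt_atTop 0] with M hM
        have hMr : (1 : ℝ) ≤ M := by exact_mod_cast hM
        refine le_trans ?_ (hJ M hM)
        nlinarith [sq_nonneg (∫ x, Y M x ∂(μ M))]
      have h3 := h2.sqrt
      simp only [Real.sqrt_sq_eq_abs, Real.sqrt_zero] at h3
      exact (tendsto_zero_iff_abs_tendsto_zero _).mpr h3
    have h4 := h1.add_const θ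
    rw [zero_add] at h4
    refine h4.congr' ?_
    filter_upwards [eventually_gt_atTop 0] with M hM
    rw [← hmean M hM]
    ring
  -- Weighted AM-GM, `2|WY| ≤ s W² + Y² / s`: with `s` fixed and small, the first term contributes
  -- `s v` and the second is `o(1)` after multiplication by `M`.
  · have hcross : Tendsto (fun M : ℕ => (M : ℝ) * ∫ x, 2 * (W M x * Y M x) ∂(μ M)) atTop
        (𝓝 0) := by
      rw [Metric.tendsto_atTop']
      intro η hη
      set s : ℝ := η / (2 * (v + 1)) with hs
      have hs0 : 0 < s := by positivity
      have hsv : s * v < η / 2 := by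
        rw [hs, div_mul_eq_mul_div, div_lt_iff₀ (by positivity)]
        nlinarith
      obtain ⟨M₀, hM₀⟩ := (Metric.tendsto_atTop.mp hylim) (η / 2 * s) (by positivity)
      refine ⟨M₀, fun M hM => ?_⟩
      have hMpos : 0 < M := lt_of_le_of_lt (Nat.zero_le _) hM
      have hyM := hM₀ M hM.le
      rw [Real.dist_eq, sub_zero] at hyM
      have hyM' := (abs_lt.mp hyM).2
      have hWv : (M : ℝ) * ∫ x, W M x ^ 2 ∂(μ M) = v := h.integral_sq_linearError hMpos
      have hWi := (hWL M).integrable_sq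
      have hYi := (hYL M).integrable_sq
      have hle : |∫ x, 2 * (W M x * Y M x) ∂(μ M)| ≤
          ∫ x, (s * W M x ^ 2 + Y M x ^ 2 / s) ∂(μ M) := by
        refine (abs_integral_le_integral_abs).trans (integral_mono_of_nonneg
          (Eventually.of_forall fun x => abs_nonneg _) ((hWi.const_mul s).add (hYi.div_const s))
          (Eventually.of_forall fun x => ?_))
        simp only
        rw [abs_le]
        have e1 : s * W M x ^ 2 + Y M x ^ 2 / s + 2 * (W M x * Y M x) =
            (s * W M x + Y M x) ^ 2 / s := by field_simp; ring
        have e2 : s * W M x ^ 2 + Y M x ^ 2 / s - 2 * (W M x * Y M x) =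
            (s * W M x - Y M x) ^ 2 / s := by field_simp; ring
        have p1 : 0 ≤ (s * W M x + Y M x) ^ 2 / s := by positivity
        have p2 : 0 ≤ (s * W M x - Y M x) ^ 2 / s := by positivity
        constructor <;> linarith
      rw [integral_add (hWi.const_mul s) (hYi.div_const s), integral_const_mul (r := s),
        integral_div] at hle
      rw [Real.dist_eq, sub_zero, abs_mul, Nat.abs_cast]
      calc (M : ℝ) * |∫ x, 2 * (W M x * Y M x) ∂(μ M)|
          ≤ M * (s * ∫ x, W M x ^ 2 ∂(μ M) + (∫ x, Y M x ^ 2 ∂(μ M)) / s) :=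
            mul_le_mul_of_nonneg_left hle (Nat.cast_nonneg _)
        _ = s * (M * ∫ x, W M x ^ 2 ∂(μ M)) + y M / s := by rw [hy]; ring
        _ < η / 2 + η / 2 := by
            rw [hWv]
            refine add_lt_add hsv ?_
            rw [div_lt_iff₀ hs0]
            exact hyM'
        _ = η := by ring
    have hsum : Tendsto (fun M : ℕ => v + (M : ℝ) * ∫ x, 2 * (W M x * Y M x) ∂(μ M) + y M -
        (M : ℝ) * (∫ x, Y M x ∂(μ M)) ^ 2) atTop (𝓝 (v + 0 + 0 - 0)) :=
      ((tendsto_const_nhds.add hcross).add hylim).sub hbias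
    rw [add_zero, add_zero, sub_zero] at hsum
    refine hsum.congr' ?_
    filter_upwards [eventually_gt_atTop 0] with M hM
    have hWv : (M : ℝ) * ∫ x, W M x ^ 2 ∂(μ M) = v := h.integral_sq_linearError hM
    have hWi := (hWL M).integrable_sq
    have hYi := (hYL M).integrable_sq
    have hWY : Integrable (fun x => 2 * (W M x * Y M x)) (μ M) :=
      ((hWL M).integrable_mul (hYL M)).const_mul 2
    have hei := (heL M).integrable (by norm_num)
    have hvar : variance (est M) (μ M) =
        (∫ x, (est M x - θ) ^ 2 ∂(μ M)) - (∫ x, est M x ∂(μ M) - θ) ^ 2 := by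
      rw [← variance_sub_const (heL M).aestronglyMeasurable θ, variance_eq_sub
        (X := fun x => est M x - θ) ((heL M).sub (memLp_const θ))]
      simp only [Pi.pow_apply]
      rw [integral_sub hei (integrable_const _)]
      simp
    have hexp : ∫ x, (est M x - θ) ^ 2 ∂(μ M) = ∫ x, W M x ^ 2 ∂(μ M) +
        ∫ x, 2 * (W M x * Y M x) ∂(μ M) + ∫ x, Y M x ^ 2 ∂(μ M) := by
      have hWWY : Integrable (fun x => W M x ^ 2 + 2 * (W M x * Y M x)) (μ M) := hWi.add hWY
      rw [← integral_add hWi hWY, ← integral_add hWWY hYi]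
      refine integral_congr_ae (Eventually.of_forall fun x => ?_)
      simp only [hY]
      ring
    change _ = (M : ℝ) * variance (est M) (μ M)
    rw [hvar, hexp, hmean M hM, ← hWv, hy]
    ring

end RegularContrast

end MEstimation

/-! ### Gaussian bumps -/

/-- The Gaussian bump of width `σ` and height one centred at `φ`. -/
noncomputable def bump (σ x φ : ℝ) : ℝ := Real.exp (-(x - φ) ^ 2 / (2 * σ ^ 2))

section Bump

variable {σ : ℝ}

lemma bump_pos (σ x φ : ℝ) : 0 < bump σ x φ := Real.exp_pos _

lemma bump_le_one (σ x φ : ℝ) : bump σ x φ ≤ 1 := by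
  refine Real.exp_le_one_iff.mpr ?_
  rw [neg_div]
  exact neg_nonpos.mpr (by positivity)

lemma continuous_bump (σ φ : ℝ) : Continuous fun x => bump σ x φ := by
  unfold bump
  fun_prop

lemma hasDerivAt_bump_right (hσ : 0 < σ) (x φ : ℝ) :
    HasDerivAt (fun φ => bump σ x φ) (bump σ x φ * ((x - φ) / σ ^ 2)) φ := by
  unfold bump
  have h1 : HasDerivAt (fun φ => -(x - φ) ^ 2 / (2 * σ ^ 2)) ((x - φ) / σ ^ 2) φ := by
    have h2 := ((((hasDerivAt_id φ).const_sub x).pow 2).neg).div_const (2 * σ ^ 2)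
    refine (h2.congr_deriv ?_)
    simp only [id_eq]
    field_simp
    norm_num
    ring
  exact h1.exp

lemma hasDerivAt_bump_left (hσ : 0 < σ) (x φ : ℝ) :
    HasDerivAt (fun x => bump σ x φ) (-(bump σ x φ * ((x - φ) / σ ^ 2))) x := by
  unfold bump
  have h1 : HasDerivAt (fun x => -(x - φ) ^ 2 / (2 * σ ^ 2)) (-((x - φ) / σ ^ 2)) x := by
    have h2 := ((((hasDerivAt_id x).sub_const φ).pow 2).neg).div_const (2 * σ ^ 2)
    refine (h2.congr_deriv ?_)
    simp only [id_eq]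
    field_simp
    norm_num
    ring
  rw [← mul_neg]
  exact h1.exp

/-- The integral over the whole line is `σ √(2π)`, and `2π < 9`. -/
lemma integral_bump_le (hσ : 0 < σ) {l u : ℝ} (hlu : l ≤ u) (φ : ℝ) :
    ∫ x in l..u, bump σ x φ ≤ 3 * σ := by
  have hb : 0 < 1 / (2 * σ ^ 2) := by positivity
  have hfun : (fun x => bump σ x φ) = fun x => Real.exp (-(1 / (2 * σ ^ 2)) * (x - φ) ^ 2) := by
    ext x
    unfold bump
    congr 1
    ring
  have hi : Integrable (fun x => bump σ x φ) := by
    rw [hfun]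
    exact (integrable_exp_neg_mul_sq hb).comp_sub_right φ
  rw [intervalIntegral.integral_of_le hlu]
  refine (setIntegral_le_integral hi (Eventually.of_forall fun x => (bump_pos σ x φ).le)).trans ?_
  rw [hfun, integral_sub_right_eq_self (fun x => Real.exp (-(1 / (2 * σ ^ 2)) * x ^ 2)),
    integral_gaussian]
  refine Real.sqrt_le_iff.mpr ⟨by positivity, ?_⟩
  rw [div_div_eq_mul_div, div_one]
  have := Real.pi_lt_four
  nlinarith [sq_nonneg σ]

lemma half_le_bump (hσ : 0 < σ) {x φ : ℝ} (h : |x - φ| ≤ σ) : 1 / 2 ≤ bump σ x φ := by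
  have h1 : (x - φ) ^ 2 / (2 * σ ^ 2) ≤ 1 / 2 := by
    rw [div_le_div_iff₀ (by positivity) (by norm_num)]
    have := sq_le_sq' (by linarith [(abs_le.mp h).1]) (abs_le.mp h).2
    linarith
  have h2 := Real.add_one_le_exp (-(x - φ) ^ 2 / (2 * σ ^ 2))
  unfold bump
  rw [neg_div] at h2 ⊢
  linarith

lemma integral_le_of_subinterval {f : ℝ → ℝ} (hf : Continuous f) (hf0 : ∀ x, 0 ≤ f x)
    {l a b u : ℝ} (hla : l ≤ a) (hab : a ≤ b) (hbu : b ≤ u) :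
    ∫ x in a..b, f x ≤ ∫ x in l..u, f x :=
  intervalIntegral.integral_mono_interval hla hab hbu (Eventually.of_forall hf0)
    (hf.intervalIntegrable _ _)

lemma const_mul_le_integral {f : ℝ → ℝ} (hf : Continuous f) {a b c : ℝ} (hab : a ≤ b)
    (h : ∀ x ∈ Set.Icc a b, c ≤ f x) : (b - a) * c ≤ ∫ x in a..b, f x := by
  have := intervalIntegral.integral_mono_on hab (μ := volume) (f := fun _ => c) (g := f)
    intervalIntegrable_const (hf.intervalIntegrable _ _) h
  simpa using this

/-- A window of length `2σ` contains an interval of length `σ` that starts or ends at `φ`, and the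
bump is at least `1/2` there. -/
lemma le_integral_bump (hσ : 0 < σ) {l u φ : ℝ} (hlu : 2 * σ ≤ u - l) (hφ : φ ∈ Set.Icc l u) :
    σ / 2 ≤ ∫ x in l..u, bump σ x φ := by
  have key : ∀ a, l ≤ a → a + σ ≤ u → (∀ x ∈ Set.Icc a (a + σ), |x - φ| ≤ σ) →
      σ / 2 ≤ ∫ x in l..u, bump σ x φ := by
    intro a hla hau hx
    refine le_trans ?_ (integral_le_of_subinterval (continuous_bump σ φ)
      (fun x => (bump_pos σ x φ).le) hla (by linarith) hau)
    have := const_mul_le_integral (continuous_bump σ φ) (a := a) (b := a + σ) (by linarith)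
      fun x hx' => half_le_bump hσ (hx x hx')
    linarith
  by_cases h : φ + σ ≤ u
  · refine key φ hφ.1 h fun x hx => ?_
    rw [abs_of_nonneg (by linarith [hx.1])]
    linarith [hx.2]
  · refine key (φ - σ) (by linarith) (by linarith [hφ.2]) fun x hx => ?_
    rw [abs_of_nonpos (by linarith [hx.2])]
    linarith [hx.1]

end Bump

/-! ### The peak model: density, normalization and their derivatives -/

/-- The first three derivatives of `log f` in terms of those of `f`. -/
lemma hasDerivAt_log_chain {f f₁ f₂ f₃ : ℝ → ℝ} {x : ℝ} (hf : HasDerivAt f (f₁ x) x)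
    (hf₁ : HasDerivAt f₁ (f₂ x) x) (hf₂ : HasDerivAt f₂ (f₃ x) x) (h0 : 0 < f x) :
    HasDerivAt (fun x => Real.log (f x)) (f₁ x / f x) x ∧
    HasDerivAt (fun x => f₁ x / f x) (f₂ x / f x - (f₁ x / f x) ^ 2) x ∧
    HasDerivAt (fun x => f₂ x / f x - (f₁ x / f x) ^ 2)
      (f₃ x / f x - 3 * (f₂ x / f x) * (f₁ x / f x) + 2 * (f₁ x / f x) ^ 3) x := by
  have hne := h0.ne'
  have h1 : HasDerivAt (fun x => f₁ x / f x) (f₂ x / f x - (f₁ x / f x) ^ 2) x := by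
    refine (hf₁.div hf hne).congr_deriv ?_
    field_simp
  refine ⟨hf.log hne, h1, ?_⟩
  refine ((hf₂.div hf hne).sub (h1.pow 2)).congr_deriv ?_
  simp only [Nat.add_one_sub_one, pow_one, Nat.cast_ofNat]
  field_simp
  ring

/-- A Gaussian peak of height `α` and width `σ` above a uniform floor of height `β`, observed in
the window `[l, u]`, whose true centre is `θ₀`. -/
structure PeakModel where
  α : ℝ
  β : ℝ
  σ : ℝ
  l : ℝ
  u : ℝ
  θ₀ : ℝ
  hα : 0 < α
  hβ : 0 < β
  hσ : 0 < σ
  hR : 48 ≤ (u - l) / σ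
  hl : l + (u - l) / 6 ≤ θ₀
  hu : θ₀ ≤ u - (u - l) / 6

namespace PeakModel

variable (G : PeakModel)

/-- The length of the window in units of the width of the peak. -/
noncomputable def R : ℝ := (G.u - G.l) / G.σ

/-- The unnormalized density. -/
noncomputable def q (x φ : ℝ) : ℝ := G.α * bump G.σ x φ + G.β

/-- The first derivative of `q` with respect to the centre. -/
noncomputable def q₁ (x φ : ℝ) : ℝ := G.α * (bump G.σ x φ * ((x - φ) / G.σ ^ 2))

/-- The second derivative of `q` with respect to the centre. -/
noncomputable def q₂ (x φ : ℝ) : ℝ :=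
  G.α * (bump G.σ x φ * ((x - φ) ^ 2 / G.σ ^ 4 - 1 / G.σ ^ 2))

/-- The third derivative of `q` with respect to the centre. -/
noncomputable def q₃ (x φ : ℝ) : ℝ :=
  G.α * (bump G.σ x φ * ((x - φ) ^ 3 / G.σ ^ 6 - 3 * (x - φ) / G.σ ^ 4))

/-- The mass of the unnormalized density in the window. -/
noncomputable def Z (φ : ℝ) : ℝ := ∫ x in G.l..G.u, G.q x φ

/-- The first derivative of `Z`. -/
noncomputable def Z₁ (φ : ℝ) : ℝ := G.α * (bump G.σ G.l φ - bump G.σ G.u φ)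

/-- The second derivative of `Z`. -/
noncomputable def Z₂ (φ : ℝ) : ℝ := G.q₁ G.l φ - G.q₁ G.u φ

/-- The third derivative of `Z`. -/
noncomputable def Z₃ (φ : ℝ) : ℝ := G.q₂ G.l φ - G.q₂ G.u φ

/-- The logarithm of the normalized density. -/
noncomputable def m (x φ : ℝ) : ℝ := Real.log (G.q x φ) - Real.log (G.Z φ)

/-- The score, i.e. the first derivative of `m` with respect to the centre. -/
noncomputable def m₁ (x φ : ℝ) : ℝ := G.q₁ x φ / G.q x φ - G.Z₁ φ / G.Z φ

/-- The second derivative of `m` with respect to the centre. -/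
noncomputable def m₂ (x φ : ℝ) : ℝ :=
  (G.q₂ x φ / G.q x φ - (G.q₁ x φ / G.q x φ) ^ 2) - (G.Z₂ φ / G.Z φ - (G.Z₁ φ / G.Z φ) ^ 2)

/-- The third derivative of `m` with respect to the centre. -/
noncomputable def m₃ (x φ : ℝ) : ℝ :=
  (G.q₃ x φ / G.q x φ - 3 * (G.q₂ x φ / G.q x φ) * (G.q₁ x φ / G.q x φ) +
    2 * (G.q₁ x φ / G.q x φ) ^ 3) -
  (G.Z₃ φ / G.Z φ - 3 * (G.Z₂ φ / G.Z φ) * (G.Z₁ φ / G.Z φ) + 2 * (G.Z₁ φ / G.Z φ) ^ 3)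

lemma R_ge : 48 ≤ G.R := G.hR

lemma R_pos : 0 < G.R := by linarith [G.R_ge]

lemma length_eq : G.u - G.l = G.R * G.σ := by
  have := G.hσ.ne'
  unfold R
  field_simp

lemma length_pos : 0 < G.u - G.l := by
  rw [G.length_eq]
  exact mul_pos G.R_pos G.hσ

lemma le_length : 48 * G.σ ≤ G.u - G.l := by
  rw [G.length_eq]
  exact mul_le_mul_of_nonneg_right G.R_ge G.hσ.le

lemma l_lt_u : G.l < G.u := by linarith [G.length_pos]

lemma center_mem : G.θ₀ ∈ Set.Icc G.l G.u :=
  ⟨by linarith [G.hl, G.length_pos], by linarith [G.hu, G.length_pos]⟩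

lemma q_pos (x φ : ℝ) : 0 < G.q x φ := by
  have := mul_pos G.hα (bump_pos G.σ x φ)
  have := G.hβ
  unfold q
  linarith

lemma q_le (x φ : ℝ) : G.q x φ ≤ G.α + G.β := by
  have := mul_le_mul_of_nonneg_left (bump_le_one G.σ x φ) G.hα.le
  unfold q
  linarith

lemma continuous_q (φ : ℝ) : Continuous fun x => G.q x φ := by
  have := continuous_bump G.σ φ
  unfold q
  fun_prop

lemma continuous_q₁ (φ : ℝ) : Continuous fun x => G.q₁ x φ := by
  have := continuous_bump G.σ φ
  unfold q₁
  fun_prop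

lemma continuous_q₂ (φ : ℝ) : Continuous fun x => G.q₂ x φ := by
  have := continuous_bump G.σ φ
  unfold q₂
  fun_prop

lemma continuous_m (φ : ℝ) : Continuous fun x => G.m x φ := by
  unfold m
  exact ((G.continuous_q φ).log fun x => (G.q_pos x φ).ne').sub continuous_const

lemma continuous_m₁ (φ : ℝ) : Continuous fun x => G.m₁ x φ := by
  unfold m₁
  exact ((G.continuous_q₁ φ).div (G.continuous_q φ) fun x => (G.q_pos x φ).ne').sub
    continuous_const

lemma continuous_m₂ (φ : ℝ) : Continuous fun x => G.m₂ x φ := by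
  unfold m₂
  exact (((G.continuous_q₂ φ).div (G.continuous_q φ) fun x => (G.q_pos x φ).ne').sub
    (((G.continuous_q₁ φ).div (G.continuous_q φ) fun x => (G.q_pos x φ).ne').pow 2)).sub
    continuous_const

lemma hasDerivAt_q (x φ : ℝ) : HasDerivAt (fun φ => G.q x φ) (G.q₁ x φ) φ :=
  ((hasDerivAt_bump_right G.hσ x φ).const_mul G.α).add_const G.β

lemma hasDerivAt_q₁ (x φ : ℝ) : HasDerivAt (fun φ => G.q₁ x φ) (G.q₂ x φ) φ := by
  have hσ := G.hσ.ne'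
  have h1 : HasDerivAt (fun φ => (x - φ) / G.σ ^ 2) (-1 / G.σ ^ 2) φ :=
    ((hasDerivAt_id φ).const_sub x).div_const _
  refine (((hasDerivAt_bump_right G.hσ x φ).mul h1).const_mul G.α).congr_deriv ?_
  unfold q₂
  field_simp
  ring

lemma hasDerivAt_q₂ (x φ : ℝ) : HasDerivAt (fun φ => G.q₂ x φ) (G.q₃ x φ) φ := by
  have hσ := G.hσ.ne'
  have h1 : HasDerivAt (fun φ => (x - φ) ^ 2 / G.σ ^ 4 - 1 / G.σ ^ 2)
      (-2 * (x - φ) / G.σ ^ 4) φ := by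
    refine ((((hasDerivAt_id φ).const_sub x).pow 2).div_const (G.σ ^ 4)).sub_const _
      |>.congr_deriv ?_
    simp
  refine (((hasDerivAt_bump_right G.hσ x φ).mul h1).const_mul G.α).congr_deriv ?_
  unfold q₃
  field_simp
  ring

lemma integral_q (φ : ℝ) :
    G.Z φ = G.α * (∫ x in G.l..G.u, bump G.σ x φ) + G.β * (G.u - G.l) := by
  unfold Z q
  rw [intervalIntegral.integral_add, intervalIntegral.integral_const_mul,
    intervalIntegral.integral_const, smul_eq_mul, mul_comm G.β]
  · exact ((continuous_bump G.σ φ).const_mul G.α).intervalIntegrable _ _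
  · exact intervalIntegrable_const

/-- The bump depends on `x - φ` only, so a derivative in `φ` is minus a derivative in `x` and
integrates to boundary values. -/
lemma integral_q₁ (φ : ℝ) : ∫ x in G.l..G.u, G.q₁ x φ = G.Z₁ φ := by
  have h := intervalIntegral.integral_eq_sub_of_hasDerivAt (a := G.l) (b := G.u)
    (f := fun x => -(G.α * bump G.σ x φ)) (f' := fun x => G.q₁ x φ)
    (fun x _ => (((hasDerivAt_bump_left G.hσ x φ).const_mul G.α).neg).congr_deriv
      (by unfold q₁; ring))
    ((G.continuous_q₁ φ).intervalIntegrable _ _)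
  rw [h]
  unfold Z₁
  ring

lemma integral_q₂ (φ : ℝ) : ∫ x in G.l..G.u, G.q₂ x φ = G.Z₂ φ := by
  have hσ := G.hσ.ne'
  have hd : ∀ x, HasDerivAt (fun x => -(G.q₁ x φ)) (G.q₂ x φ) x := by
    intro x
    have h1 : HasDerivAt (fun x => (x - φ) / G.σ ^ 2) (1 / G.σ ^ 2) x :=
      ((hasDerivAt_id x).sub_const φ).div_const _
    refine (((hasDerivAt_bump_left G.hσ x φ).mul h1).const_mul G.α).neg.congr_deriv ?_
    unfold q₂
    field_simp
    ring
  rw [intervalIntegral.integral_eq_sub_of_hasDerivAt (fun x _ => hd x)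
    ((G.continuous_q₂ φ).intervalIntegrable _ _)]
  unfold Z₂
  ring

lemma hasDerivAt_Z (φ : ℝ) : HasDerivAt G.Z (G.Z₁ φ) φ := by
  set f : ℝ → ℝ := fun z => bump G.σ z 0 with hf
  have hfc : Continuous f := continuous_bump G.σ 0
  have hF : ∀ t, HasDerivAt (fun t => ∫ z in (0 : ℝ)..t, f z) (f t) t := fun t =>
    intervalIntegral.integral_hasDerivAt_right (hfc.intervalIntegrable _ _)
      (hfc.stronglyMeasurableAtFilter _ _) hfc.continuousAt
  -- After the translation `φ` occurs only in the limits of integration, so the fundamental theorem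
  -- of calculus gives the derivative.
  have hZ : G.Z = fun φ => G.α * ((∫ z in (0 : ℝ)..(G.u - φ), f z) -
      ∫ z in (0 : ℝ)..(G.l - φ), f z) + G.β * (G.u - G.l) := by
    ext φ
    rw [G.integral_q, intervalIntegral.integral_interval_sub_left (hfc.intervalIntegrable _ _)
      (hfc.intervalIntegrable _ _), ← intervalIntegral.integral_comp_sub_right f φ]
    simp only [hf, bump, sub_zero]
  rw [hZ]
  have hu : HasDerivAt (fun φ => ∫ z in (0 : ℝ)..(G.u - φ), f z) (f (G.u - φ) * -1) φ :=
    (hF (G.u - φ)).comp φ ((hasDerivAt_id φ).const_sub G.u)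
  have hl : HasDerivAt (fun φ => ∫ z in (0 : ℝ)..(G.l - φ), f z) (f (G.l - φ) * -1) φ :=
    (hF (G.l - φ)).comp φ ((hasDerivAt_id φ).const_sub G.l)
  refine (((hu.sub hl).const_mul G.α).add_const _).congr_deriv ?_
  simp only [hf, bump, Z₁, sub_zero]
  ring

lemma hasDerivAt_Z₁ (φ : ℝ) : HasDerivAt G.Z₁ (G.Z₂ φ) φ := by
  refine (((hasDerivAt_bump_right G.hσ G.l φ).sub (hasDerivAt_bump_right G.hσ G.u φ)).const_mul
    G.α).congr_deriv ?_
  unfold Z₂ q₁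
  ring

lemma hasDerivAt_Z₂ (φ : ℝ) : HasDerivAt G.Z₂ (G.Z₃ φ) φ :=
  (G.hasDerivAt_q₁ G.l φ).sub (G.hasDerivAt_q₁ G.u φ)

lemma le_Z {φ : ℝ} (hφ : φ ∈ Set.Icc G.l G.u) :
    G.α * G.σ / 2 + G.β * (G.u - G.l) ≤ G.Z φ := by
  rw [G.integral_q]
  have := mul_le_mul_of_nonneg_left
    (le_integral_bump G.hσ (by linarith [G.le_length, G.hσ]) hφ) G.hα.le
  linarith

lemma Z_le (φ : ℝ) : G.Z φ ≤ 3 * (G.α * G.σ) + G.β * (G.u - G.l) := by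
  rw [G.integral_q]
  have := mul_le_mul_of_nonneg_left (integral_bump_le G.hσ G.l_lt_u.le φ) G.hα.le
  linarith

lemma Z_pos (φ : ℝ) : 0 < G.Z φ := by
  have h1 : 0 ≤ ∫ x in G.l..G.u, bump G.σ x φ :=
    intervalIntegral.integral_nonneg G.l_lt_u.le fun x _ => (bump_pos G.σ x φ).le
  have h2 := mul_nonneg G.hα.le h1
  have h3 := mul_pos G.hβ G.length_pos
  rw [G.integral_q]
  linarith

/-- The mass of the peak is at most `3ασ` for every centre and at least `ασ / 2` for a centre in the
window, and the mass of the floor is the same for both. Hence the factor does not depend on `α / β`.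
-/
lemma Z_le_six_mul_Z {φ φ' : ℝ} (hφ' : φ' ∈ Set.Icc G.l G.u) : G.Z φ ≤ 6 * G.Z φ' := by
  have h1 := G.Z_le φ
  have h2 := G.le_Z hφ'
  have h3 := mul_pos G.hβ G.length_pos
  linarith

lemma hasDerivAt_m (x φ : ℝ) : HasDerivAt (fun φ => G.m x φ) (G.m₁ x φ) φ :=
  (hasDerivAt_log_chain (G.hasDerivAt_q x φ) (G.hasDerivAt_q₁ x φ) (G.hasDerivAt_q₂ x φ)
    (G.q_pos x φ)).1.sub
  (hasDerivAt_log_chain (G.hasDerivAt_Z φ) (G.hasDerivAt_Z₁ φ) (G.hasDerivAt_Z₂ φ)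
    (G.Z_pos φ)).1

lemma hasDerivAt_m₁ (x φ : ℝ) : HasDerivAt (fun φ => G.m₁ x φ) (G.m₂ x φ) φ :=
  (hasDerivAt_log_chain (G.hasDerivAt_q x φ) (G.hasDerivAt_q₁ x φ) (G.hasDerivAt_q₂ x φ)
    (G.q_pos x φ)).2.1.sub
  (hasDerivAt_log_chain (G.hasDerivAt_Z φ) (G.hasDerivAt_Z₁ φ) (G.hasDerivAt_Z₂ φ)
    (G.Z_pos φ)).2.1

lemma hasDerivAt_m₂ (x φ : ℝ) : HasDerivAt (fun φ => G.m₂ x φ) (G.m₃ x φ) φ :=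
  (hasDerivAt_log_chain (G.hasDerivAt_q x φ) (G.hasDerivAt_q₁ x φ) (G.hasDerivAt_q₂ x φ)
    (G.q_pos x φ)).2.2.sub
  (hasDerivAt_log_chain (G.hasDerivAt_Z φ) (G.hasDerivAt_Z₁ φ) (G.hasDerivAt_Z₂ φ)
    (G.Z_pos φ)).2.2

end PeakModel

/-! ### Uniform bounds on the derivatives of the log-density -/

namespace PeakModel

variable (G : PeakModel)

/-- Here `w` is the posterior probability that `x` comes from the peak and not from the floor, and
`y` is the standardized position; the ratios are `w` times Hermite polynomials in `y`. Since `w ≤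
1`, bounds follow that involve neither `α` nor `β`. -/
lemma exists_scaled_q {x φ : ℝ} (hx : x ∈ Set.Icc G.l G.u) (hφ : φ ∈ Set.Icc G.l G.u) :
    ∃ w y : ℝ, 0 ≤ w ∧ w ≤ 1 ∧ |y| ≤ G.R ∧ x - φ = y * G.σ ∧ G.α * bump G.σ x φ = w * G.q x φ ∧
      G.q₁ x φ / G.q x φ = w * y / G.σ ∧
      G.q₂ x φ / G.q x φ = w * (y ^ 2 - 1) / G.σ ^ 2 ∧
      G.q₃ x φ / G.q x φ = w * (y ^ 3 - 3 * y) / G.σ ^ 3 := by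
  have hσ := G.hσ.ne'
  have hq := G.q_pos x φ
  have hq' := hq.ne'
  have hb := mul_pos G.hα (bump_pos G.σ x φ)
  refine ⟨G.α * bump G.σ x φ / G.q x φ, (x - φ) / G.σ, by positivity, ?_, ?_, ?_, ?_, ?_, ?_, ?_⟩
  · rw [div_le_one hq]
    unfold q
    linarith [G.hβ]
  · rw [abs_div, abs_of_pos G.hσ, div_le_iff₀ G.hσ, ← G.length_eq, abs_le]
    constructor <;> linarith [hx.1, hx.2, hφ.1, hφ.2]
  · field_simp
  · field_simp
  · unfold q₁
    field_simp
  · unfold q₂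
    field_simp
  · unfold q₃
    field_simp

lemma abs_q_ratio_le {x φ : ℝ} (hx : x ∈ Set.Icc G.l G.u) (hφ : φ ∈ Set.Icc G.l G.u) :
    |G.q₁ x φ / G.q x φ| ≤ G.R / G.σ ∧ |G.q₂ x φ / G.q x φ| ≤ G.R ^ 2 / G.σ ^ 2 ∧
      |G.q₃ x φ / G.q x φ| ≤ 2 * G.R ^ 3 / G.σ ^ 3 := by
  obtain ⟨w, y, hw0, hw1, hy, -, -, h1, h2, h3⟩ := G.exists_scaled_q hx hφ
  have hσ := G.hσ
  have hR := G.R_ge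
  have hy2 : y ^ 2 ≤ G.R ^ 2 := sq_le_sq' (by linarith [(abs_le.mp hy).1]) (abs_le.mp hy).2
  have aux : ∀ a b : ℝ, |a| ≤ b → |w * a| ≤ b := fun a b hab => by
    rw [abs_mul, abs_of_nonneg hw0]
    calc w * |a| ≤ 1 * |a| := mul_le_mul_of_nonneg_right hw1 (abs_nonneg _)
      _ ≤ b := by linarith
  rw [h1, h2, h3, abs_div, abs_div, abs_div, abs_of_pos hσ, abs_of_pos (pow_pos hσ 2),
    abs_of_pos (pow_pos hσ 3)]
  refine ⟨?_, ?_, ?_⟩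
  · exact div_le_div_of_nonneg_right (aux _ _ hy) hσ.le
  · refine div_le_div_of_nonneg_right (aux _ _ ?_) (pow_pos hσ 2).le
    rw [abs_le]
    constructor <;> nlinarith [sq_nonneg y]
  · refine div_le_div_of_nonneg_right (aux _ _ ?_) (pow_pos hσ 3).le
    have h4 : |y| ^ 3 ≤ G.R ^ 3 := pow_le_pow_left₀ (abs_nonneg _) hy 3
    have h5 : 3 * G.R ≤ G.R ^ 3 := by nlinarith [mul_nonneg G.R_pos.le G.R_pos.le]
    calc |y ^ 3 - 3 * y| ≤ |y ^ 3| + |3 * y| := abs_sub _ _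
      _ = |y| ^ 3 + 3 * |y| := by rw [abs_pow, abs_mul]; norm_num
      _ ≤ 2 * G.R ^ 3 := by linarith

/-- The numerators are boundary values proportional to `α`, and `Z` is at least `ασ / 2`, so `α`
cancels. -/
lemma abs_Z_ratio_le {φ : ℝ} (hφ : φ ∈ Set.Icc G.l G.u) :
    |G.Z₁ φ / G.Z φ| ≤ 2 / G.σ ∧ |G.Z₂ φ / G.Z φ| ≤ 4 * G.R / G.σ ^ 2 ∧
      |G.Z₃ φ / G.Z φ| ≤ 4 * G.R ^ 2 / G.σ ^ 3 := by
  have hσ := G.hσ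
  have hα := G.hα
  have hR := G.R_ge
  have hZ : G.α * G.σ / 2 ≤ G.Z φ := by
    linarith [G.le_Z hφ, mul_pos G.hβ G.length_pos]
  have hZ0 : 0 < G.α * G.σ / 2 := by positivity
  have aux : ∀ a b : ℝ, 0 ≤ b → |a| ≤ G.α * b → |a / G.Z φ| ≤ 2 * b / G.σ := fun a b hb hab => by
    rw [abs_div, abs_of_pos (G.Z_pos φ)]
    calc |a| / G.Z φ ≤ G.α * b / (G.α * G.σ / 2) :=
          div_le_div₀ (by positivity) hab hZ0 hZ
      _ = 2 * b / G.σ := by field_simp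
  have hend : ∀ x ∈ Set.Icc G.l G.u, |x - φ| ≤ G.R * G.σ := fun x hx => by
    rw [← G.length_eq, abs_le]
    constructor <;> linarith [hx.1, hx.2, hφ.1, hφ.2]
  have hq₁ : ∀ x ∈ Set.Icc G.l G.u, |G.q₁ x φ| ≤ G.α * (G.R / G.σ) := fun x hx => by
    unfold q₁
    rw [abs_mul, abs_of_pos hα, abs_mul, abs_of_pos (bump_pos _ _ _), abs_div,
      abs_of_pos (pow_pos hσ 2)]
    refine mul_le_mul_of_nonneg_left ?_ hα.le
    calc bump G.σ x φ * (|x - φ| / G.σ ^ 2) ≤ 1 * (G.R * G.σ / G.σ ^ 2) := by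
          gcongr
          · exact bump_le_one _ _ _
          · exact hend x hx
      _ = G.R / G.σ := by field_simp
  have hq₂ : ∀ x ∈ Set.Icc G.l G.u, |G.q₂ x φ| ≤ G.α * (G.R ^ 2 / G.σ ^ 2) := fun x hx => by
    unfold q₂
    rw [abs_mul, abs_of_pos hα, abs_mul, abs_of_pos (bump_pos _ _ _)]
    refine mul_le_mul_of_nonneg_left ?_ hα.le
    have h1 : (x - φ) ^ 2 ≤ (G.R * G.σ) ^ 2 :=
      sq_le_sq' (by linarith [(abs_le.mp (hend x hx)).1]) (abs_le.mp (hend x hx)).2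
    have h2 : |(x - φ) ^ 2 / G.σ ^ 4 - 1 / G.σ ^ 2| ≤ G.R ^ 2 / G.σ ^ 2 := by
      have h3 : (x - φ) ^ 2 / G.σ ^ 4 ≤ G.R ^ 2 / G.σ ^ 2 := by
        rw [div_le_div_iff₀ (by positivity) (by positivity)]
        calc (x - φ) ^ 2 * G.σ ^ 2 ≤ (G.R * G.σ) ^ 2 * G.σ ^ 2 := by gcongr
          _ = G.R ^ 2 * G.σ ^ 4 := by ring
      have h4 : 1 / G.σ ^ 2 ≤ G.R ^ 2 / G.σ ^ 2 := by
        gcongr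
        nlinarith
      have h5 : 0 ≤ (x - φ) ^ 2 / G.σ ^ 4 := by positivity
      have h6 : 0 ≤ 1 / G.σ ^ 2 := by positivity
      rw [abs_le]
      constructor <;> linarith
    calc bump G.σ x φ * |(x - φ) ^ 2 / G.σ ^ 4 - 1 / G.σ ^ 2| ≤ 1 * (G.R ^ 2 / G.σ ^ 2) := by
          gcongr
          exact bump_le_one _ _ _
      _ = G.R ^ 2 / G.σ ^ 2 := one_mul _
  have hl : G.l ∈ Set.Icc G.l G.u := Set.left_mem_Icc.mpr G.l_lt_u.le
  have hu : G.u ∈ Set.Icc G.l G.u := Set.right_mem_Icc.mpr G.l_lt_u.le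
  refine ⟨?_, ?_, ?_⟩
  · have := aux (G.Z₁ φ) 1 one_pos.le ?_
    · simpa using this
    · unfold Z₁
      rw [abs_mul, abs_of_pos hα]
      refine mul_le_mul_of_nonneg_left ?_ hα.le
      have a1 := bump_pos G.σ G.l φ
      have a2 := bump_pos G.σ G.u φ
      have a3 := bump_le_one G.σ G.l φ
      have a4 := bump_le_one G.σ G.u φ
      rw [abs_le]
      constructor <;> linarith
  · refine (aux (G.Z₂ φ) (2 * (G.R / G.σ)) (by have := G.R_pos; positivity) ?_).trans
      (le_of_eq ?_)
    · exact (abs_sub _ _).trans (by linarith [hq₁ _ hl, hq₁ _ hu])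
    · field_simp
      ring
  · refine (aux (G.Z₃ φ) (2 * (G.R ^ 2 / G.σ ^ 2)) (by positivity) ?_).trans (le_of_eq ?_)
    · exact (abs_sub _ _).trans (by linarith [hq₂ _ hl, hq₂ _ hu])
    · field_simp
      ring

lemma abs_m₁_le {x φ : ℝ} (hx : x ∈ Set.Icc G.l G.u) (hφ : φ ∈ Set.Icc G.l G.u) :
    |G.m₁ x φ| ≤ 2 * G.R / G.σ := by
  have h1 := (G.abs_q_ratio_le hx hφ).1
  have h2 := (G.abs_Z_ratio_le hφ).1
  have hσ := G.hσ
  have hR := G.R_ge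
  calc |G.m₁ x φ| ≤ G.R / G.σ + 2 / G.σ := (abs_sub _ _).trans (add_le_add h1 h2)
    _ = (G.R + 2) / G.σ := by ring
    _ ≤ 2 * G.R / G.σ := by gcongr; linarith

lemma abs_m₂_le {x φ : ℝ} (hx : x ∈ Set.Icc G.l G.u) (hφ : φ ∈ Set.Icc G.l G.u) :
    |G.m₂ x φ| ≤ 3 * G.R ^ 2 / G.σ ^ 2 := by
  obtain ⟨h1, h2, -⟩ := G.abs_q_ratio_le hx hφ
  obtain ⟨h3, h4, -⟩ := G.abs_Z_ratio_le hφ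
  have hσ := G.hσ
  have hR := G.R_ge
  have h1' := pow_le_pow_left₀ (abs_nonneg _) h1 2
  have h3' := pow_le_pow_left₀ (abs_nonneg _) h3 2
  rw [← abs_pow] at h1' h3'
  calc |G.m₂ x φ| ≤ (G.R ^ 2 / G.σ ^ 2 + (G.R / G.σ) ^ 2) +
        (4 * G.R / G.σ ^ 2 + (2 / G.σ) ^ 2) :=
        (abs_sub _ _).trans (add_le_add ((abs_sub _ _).trans (add_le_add h2 h1'))
          ((abs_sub _ _).trans (add_le_add h4 h3')))
    _ = (2 * G.R ^ 2 + 4 * G.R + 4) / G.σ ^ 2 := by field_simp; ring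
    _ ≤ 3 * G.R ^ 2 / G.σ ^ 2 := by gcongr; nlinarith

lemma abs_log_third_le {a b c A B C : ℝ} (ha : |a| ≤ A) (hb : |b| ≤ B) (hc : |c| ≤ C) :
    |c - 3 * b * a + 2 * a ^ 3| ≤ C + 3 * (B * A) + 2 * A ^ 3 := by
  have h1 : |b * a| ≤ B * A := by
    rw [abs_mul]
    exact mul_le_mul hb ha (abs_nonneg _) ((abs_nonneg _).trans hb)
  have h2 : |a ^ 3| ≤ A ^ 3 := by
    rw [abs_pow]
    exact pow_le_pow_left₀ (abs_nonneg _) ha 3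
  rw [abs_le] at *
  constructor <;> linarith [h1.1, h1.2, h2.1, h2.2]

lemma abs_m₃_le {x φ : ℝ} (hx : x ∈ Set.Icc G.l G.u) (hφ : φ ∈ Set.Icc G.l G.u) :
    |G.m₃ x φ| ≤ 8 * G.R ^ 3 / G.σ ^ 3 := by
  obtain ⟨h1, h2, h3⟩ := G.abs_q_ratio_le hx hφ
  obtain ⟨k1, k2, k3⟩ := G.abs_Z_ratio_le hφ
  have hσ := G.hσ
  have hR := G.R_ge
  have hR2 : 48 * G.R ≤ G.R ^ 2 := by nlinarith
  have hR3 : 48 * G.R ^ 2 ≤ G.R ^ 3 := by nlinarith [sq_nonneg G.R]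
  calc |G.m₃ x φ| ≤ (2 * G.R ^ 3 / G.σ ^ 3 + 3 * (G.R ^ 2 / G.σ ^ 2 * (G.R / G.σ)) +
          2 * (G.R / G.σ) ^ 3) + (4 * G.R ^ 2 / G.σ ^ 3 +
          3 * (4 * G.R / G.σ ^ 2 * (2 / G.σ)) + 2 * (2 / G.σ) ^ 3) :=
        (abs_sub _ _).trans (add_le_add (abs_log_third_le h1 h2 h3) (abs_log_third_le k1 k2 k3))
    _ = (7 * G.R ^ 3 + 4 * G.R ^ 2 + 24 * G.R + 16) / G.σ ^ 3 := by field_simp; ring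
    _ ≤ 8 * G.R ^ 3 / G.σ ^ 3 := by gcongr; linarith

lemma lipschitz_of_deriv {f f' : ℝ → ℝ} {l u C : ℝ}
    (hd : ∀ φ, HasDerivAt f (f' φ) φ) (hC : ∀ φ ∈ Set.Icc l u, |f' φ| ≤ C) {φ φ' : ℝ}
    (hφ : φ ∈ Set.Icc l u) (hφ' : φ' ∈ Set.Icc l u) : |f φ - f φ'| ≤ C * |φ - φ'| :=
  Convex.norm_image_sub_le_of_norm_hasDerivWithin_le (f' := f')
    (fun ψ _ => (hd ψ).hasDerivWithinAt) hC (convex_Icc l u) hφ' hφ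

lemma abs_m_sub_le {x φ φ' : ℝ} (hx : x ∈ Set.Icc G.l G.u) (hφ : φ ∈ Set.Icc G.l G.u)
    (hφ' : φ' ∈ Set.Icc G.l G.u) : |G.m x φ - G.m x φ'| ≤ 2 * G.R / G.σ * |φ - φ'| :=
  lipschitz_of_deriv (G.hasDerivAt_m x) (fun _ hψ => G.abs_m₁_le hx hψ) hφ hφ'

lemma abs_m₁_sub_le {x φ φ' : ℝ} (hx : x ∈ Set.Icc G.l G.u) (hφ : φ ∈ Set.Icc G.l G.u)
    (hφ' : φ' ∈ Set.Icc G.l G.u) : |G.m₁ x φ - G.m₁ x φ'| ≤ 3 * G.R ^ 2 / G.σ ^ 2 * |φ - φ'| :=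
  lipschitz_of_deriv (G.hasDerivAt_m₁ x) (fun _ hψ => G.abs_m₂_le hx hψ) hφ hφ'

lemma abs_m₂_sub_le {x φ φ' : ℝ} (hx : x ∈ Set.Icc G.l G.u) (hφ : φ ∈ Set.Icc G.l G.u)
    (hφ' : φ' ∈ Set.Icc G.l G.u) : |G.m₂ x φ - G.m₂ x φ'| ≤ 8 * G.R ^ 3 / G.σ ^ 3 * |φ - φ'| :=
  lipschitz_of_deriv (G.hasDerivAt_m₂ x) (fun _ hψ => G.abs_m₃_le hx hψ) hφ hφ'

/-- The log-density is bounded on the window. -/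
lemma exists_abs_m_le : ∃ B, ∀ x ∈ Set.Icc G.l G.u, ∀ φ ∈ Set.Icc G.l G.u, |G.m x φ| ≤ B := by
  obtain ⟨B, hB⟩ := (isCompact_Icc (a := G.l) (b := G.u)).exists_bound_of_continuousOn
    (G.continuous_m G.θ₀).continuousOn
  refine ⟨B + 2 * G.R / G.σ * (G.u - G.l), fun x hx φ hφ => ?_⟩
  have h1 := hB x hx
  rw [Real.norm_eq_abs] at h1
  have h2 := G.abs_m_sub_le hx hφ G.center_mem
  have h3 : |φ - G.θ₀| ≤ G.u - G.l := by
    rw [abs_le]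
    constructor <;> linarith [hφ.1, hφ.2, G.center_mem.1, G.center_mem.2]
  have h4 : 0 ≤ 2 * G.R / G.σ := by
    have := G.R_pos
    have := G.hσ
    positivity
  have h5 := mul_le_mul_of_nonneg_left h3 h4
  have h6 : |G.m x φ| ≤ |G.m x φ - G.m x G.θ₀| + |G.m x G.θ₀| := by
    simpa using abs_add_le (G.m x φ - G.m x G.θ₀) (G.m x G.θ₀)
  linarith

/-! ### Lower bound on the Fisher information -/

/-- The signal-to-noise ratio that governs the curvature of the mean log-likelihood. -/
noncomputable def snr : ℝ := G.σ * G.α ^ 2 / (G.α + G.β)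

/-- The constant in the lower bounds on the likelihood gap and on the Fisher information. -/
noncomputable def gapConst : ℝ := Real.exp (-68) / 1008

lemma gapConst_pos : 0 < gapConst := by
  unfold gapConst
  positivity

lemma gapConst_le : gapConst ≤ 1 / 1008 := by
  unfold gapConst
  have : Real.exp (-68) ≤ 1 := Real.exp_le_one_iff.mpr (by norm_num)
  linarith

lemma snr_pos : 0 < G.snr := by
  have := G.hα
  have := G.hβ
  have := G.hσ
  unfold snr
  positivity

/-- The Fisher information of the unnormalized model at the true centre. -/
noncomputable def fisher : ℝ := ∫ x in G.l..G.u, G.q x G.θ₀ * G.m₁ x G.θ₀ ^ 2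

lemma le_integral_of_fold {f : ℝ → ℝ} (hf : Continuous f) (hf0 : ∀ x, 0 ≤ f x) {l u a b c d : ℝ}
    (hla : l ≤ a) (hab : a ≤ b) (hbc : b ≤ c) (hcd : c ≤ d) (hdu : d ≤ u) :
    (∫ x in a..b, f x) + ∫ x in c..d, f x ≤ ∫ x in l..u, f x := by
  have hi : ∀ s t, IntervalIntegrable f volume s t := fun s t => hf.intervalIntegrable s t
  have h1 : 0 ≤ ∫ x in b..c, f x := intervalIntegral.integral_nonneg hbc fun x _ => hf0 x
  have h2 := integral_le_of_subinterval hf hf0 hla (hab.trans (hbc.trans hcd)) hdu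
  have h3 := intervalIntegral.integral_add_adjacent_intervals (hi a b) (hi b c)
  have h4 := intervalIntegral.integral_add_adjacent_intervals (hi a c) (hi c d)
  linarith

/-- Only the strips between one and two widths on either side of the centre are kept; they lie in
the window because the centre is at least `48σ / 6 = 8σ` from its ends. Mirror pairs allow
quantities that are even about `θ₀` to be eliminated without knowing them. -/
lemma le_integral_of_reflect {f : ℝ → ℝ} (hf : Continuous f) (hf0 : ∀ x, 0 ≤ f x) {κ : ℝ}
    (h : ∀ x ∈ Set.Icc (G.θ₀ + G.σ) (G.θ₀ + 2 * G.σ), κ ≤ f x + f (2 * G.θ₀ - x)) :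
    G.σ * κ ≤ ∫ x in G.l..G.u, f x := by
  have hσ := G.hσ
  have hlen := G.le_length
  have h1 := le_integral_of_fold hf hf0 (l := G.l) (u := G.u) (a := G.θ₀ - 2 * G.σ)
    (b := G.θ₀ - G.σ) (c := G.θ₀ + G.σ) (d := G.θ₀ + 2 * G.σ) (by linarith [G.hl]) (by linarith)
    (by linarith) (by linarith) (by linarith [G.hu])
  have h2 : ∫ x in (G.θ₀ + G.σ)..(G.θ₀ + 2 * G.σ), f (2 * G.θ₀ - x) =
      ∫ x in (G.θ₀ - 2 * G.σ)..(G.θ₀ - G.σ), f x := by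
    rw [intervalIntegral.integral_comp_sub_left]
    congr 1 <;> ring
  have hf' : Continuous fun x => f (2 * G.θ₀ - x) := hf.comp (by fun_prop)
  rw [← h2, add_comm, ← intervalIntegral.integral_add (hf.intervalIntegrable _ _)
    (hf'.intervalIntegrable _ _)] at h1
  refine le_trans ?_ h1
  have h3 := const_mul_le_integral (hf.add hf') (a := G.θ₀ + G.σ) (b := G.θ₀ + 2 * G.σ)
    (by linarith) h
  have h4 : G.θ₀ + 2 * G.σ - (G.θ₀ + G.σ) = G.σ := by ring
  rwa [h4] at h3

lemma le_integral_of_shift {f : ℝ → ℝ} (hf : Continuous f) (hf0 : ∀ x, 0 ≤ f x) {κ : ℝ}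
    (h : ∀ x ∈ Set.Icc G.θ₀ (G.θ₀ + G.σ / 2), κ ≤ f x + f (x + 2 * G.σ)) :
    G.σ / 2 * κ ≤ ∫ x in G.l..G.u, f x := by
  have hσ := G.hσ
  have hlen := G.le_length
  have h1 := le_integral_of_fold hf hf0 (l := G.l) (u := G.u) (a := G.θ₀)
    (b := G.θ₀ + G.σ / 2) (c := G.θ₀ + 2 * G.σ) (d := G.θ₀ + G.σ / 2 + 2 * G.σ)
    (by linarith [G.hl]) (by linarith)
    (by linarith) (by linarith) (by linarith [G.hu])
  have hf' : Continuous fun x => f (x + 2 * G.σ) := hf.comp (by fun_prop)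
  rw [← intervalIntegral.integral_comp_add_right, ← intervalIntegral.integral_add
    (hf.intervalIntegrable _ _) (hf'.intervalIntegrable _ _)] at h1
  refine le_trans ?_ h1
  have h3 := const_mul_le_integral (hf.add hf') (a := G.θ₀) (b := G.θ₀ + G.σ / 2)
    (by linarith) h
  have h4 : G.θ₀ + G.σ / 2 - G.θ₀ = G.σ / 2 := by ring
  rwa [h4] at h3

lemma bump_reflect (σ x φ : ℝ) : bump σ (2 * φ - x) φ = bump σ x φ := by
  unfold bump
  congr 2
  ring

lemma q_reflect (x : ℝ) : G.q (2 * G.θ₀ - x) G.θ₀ = G.q x G.θ₀ := by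
  unfold q
  rw [bump_reflect]

lemma q₁_reflect (x : ℝ) : G.q₁ (2 * G.θ₀ - x) G.θ₀ = -G.q₁ x G.θ₀ := by
  unfold q₁
  rw [bump_reflect]
  ring

lemma bump_scaled {σ : ℝ} (hσ : 0 < σ) (φ y : ℝ) :
    bump σ (φ + y * σ) φ = Real.exp (-y ^ 2 / 2) := by
  unfold bump
  congr 1
  field_simp
  ring

/-- At `θ₀` the score is an odd function `a` of `x - θ₀` minus an unknown constant `z`. Over a
mirror pair the cross terms cancel, `(a - z)² + (-a - z)² ≥ 2a²`, so the normalization cannot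
destroy the information. -/
lemma snr_le_fisher : gapConst * G.snr / G.σ ^ 2 ≤ G.fisher := by
  have hσ := G.hσ
  have hα := G.hα
  have hβ := G.hβ
  have hc : Continuous fun x => G.q x G.θ₀ * G.m₁ x G.θ₀ ^ 2 :=
    (G.continuous_q _).mul ((G.continuous_m₁ _).pow 2)
  have h0 : ∀ x, 0 ≤ G.q x G.θ₀ * G.m₁ x G.θ₀ ^ 2 := fun x =>
    mul_nonneg (G.q_pos _ _).le (sq_nonneg _)
  set κ : ℝ := 2 * (G.α * Real.exp (-2) / G.σ) ^ 2 / (G.α + G.β) with hκ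
  have key := G.le_integral_of_reflect hc h0 (κ := κ) ?_
  · refine le_trans ?_ key
    have he : Real.exp (-68) ≤ Real.exp (-2) ^ 2 := by
      rw [← Real.exp_nat_mul]
      exact Real.exp_le_exp.mpr (by norm_num)
    have hg : gapConst ≤ 2 * Real.exp (-2) ^ 2 := by
      unfold gapConst
      have := Real.exp_pos (-68)
      linarith
    have e1 : G.σ * κ = 2 * Real.exp (-2) ^ 2 * (G.snr / G.σ ^ 2) := by
      rw [hκ]
      unfold snr
      field_simp
    rw [e1, mul_div_assoc]
    exact mul_le_mul_of_nonneg_right hg (div_nonneg G.snr_pos.le (sq_nonneg _))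
  · intro x hx
    have hq := G.q_pos x G.θ₀
    rw [G.q_reflect]
    have hq1 : G.m₁ (2 * G.θ₀ - x) G.θ₀ =
        -(G.q₁ x G.θ₀ / G.q x G.θ₀) - G.Z₁ G.θ₀ / G.Z G.θ₀ := by
      unfold m₁
      rw [G.q_reflect, G.q₁_reflect, neg_div]
    rw [hq1]
    unfold m₁
    set a := G.q₁ x G.θ₀ / G.q x G.θ₀ with ha
    set z := G.Z₁ G.θ₀ / G.Z G.θ₀ with hz
    have h1 : G.q x G.θ₀ * (2 * a ^ 2) ≤
        G.q x G.θ₀ * (a - z) ^ 2 + G.q x G.θ₀ * (-a - z) ^ 2 := by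
      rw [← mul_add]
      refine mul_le_mul_of_nonneg_left ?_ hq.le
      nlinarith [sq_nonneg z]
    refine le_trans ?_ h1
    have h2 : G.q x G.θ₀ * (2 * a ^ 2) = 2 * G.q₁ x G.θ₀ ^ 2 / G.q x G.θ₀ := by
      rw [ha]
      field_simp
    rw [h2, hκ]
    obtain ⟨y, hy⟩ : ∃ y, x = G.θ₀ + y * G.σ := ⟨(x - G.θ₀) / G.σ, by field_simp; ring⟩
    have hy1 : 1 ≤ y := by
      have : 1 * G.σ ≤ y * G.σ := by linarith [hx.1]
      exact le_of_mul_le_mul_right this hσ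
    have hy2 : y ≤ 2 := by
      have : y * G.σ ≤ 2 * G.σ := by linarith [hx.2]
      exact le_of_mul_le_mul_right this hσ
    have hb : Real.exp (-2) ≤ bump G.σ x G.θ₀ := by
      rw [hy, bump_scaled hσ]
      exact Real.exp_le_exp.mpr (by nlinarith)
    have h3 : G.α * Real.exp (-2) / G.σ ≤ G.q₁ x G.θ₀ := by
      have h4 : 1 / G.σ ≤ (x - G.θ₀) / G.σ ^ 2 := by
        rw [div_le_div_iff₀ hσ (by positivity)]
        nlinarith [hx.1]
      unfold q₁
      rw [mul_div_assoc]
      refine mul_le_mul_of_nonneg_left ?_ hα.le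
      calc Real.exp (-2) / G.σ = Real.exp (-2) * (1 / G.σ) := by ring
        _ ≤ _ := mul_le_mul hb h4 (by positivity) (bump_pos _ _ _).le
    have h5 : 0 ≤ G.α * Real.exp (-2) / G.σ := by positivity
    exact div_le_div₀ (by positivity)
      (mul_le_mul_of_nonneg_left (pow_le_pow_left₀ h5 h3 2) (by norm_num)) hq (G.q_le _ _)

lemma fisher_pos : 0 < G.fisher := by
  refine lt_of_lt_of_le ?_ G.snr_le_fisher
  have := gapConst_pos
  have := G.snr_pos
  have := G.hσ
  positivity

/-- The information equality. -/
lemma integral_q_mul_m₂ : ∫ x in G.l..G.u, G.q x G.θ₀ * G.m₂ x G.θ₀ = -G.fisher := by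
  have hZ := (G.Z_pos G.θ₀).ne'
  unfold fisher
  rw [eq_neg_iff_add_eq_zero, ← intervalIntegral.integral_add]
  · have hpt : ∀ x, G.q x G.θ₀ * G.m₂ x G.θ₀ + G.q x G.θ₀ * G.m₁ x G.θ₀ ^ 2 =
        G.q₂ x G.θ₀ - 2 * (G.Z₁ G.θ₀ / G.Z G.θ₀) * G.q₁ x G.θ₀ +
          (2 * (G.Z₁ G.θ₀ / G.Z G.θ₀) ^ 2 - G.Z₂ G.θ₀ / G.Z G.θ₀) * G.q x G.θ₀ := by
      intro x
      have hq := (G.q_pos x G.θ₀).ne'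
      unfold m₁ m₂
      field_simp
      ring
    simp_rw [hpt]
    have i0 := (G.continuous_q G.θ₀).intervalIntegrable (μ := volume) G.l G.u
    have i1 := (G.continuous_q₁ G.θ₀).intervalIntegrable (μ := volume) G.l G.u
    have i2 := (G.continuous_q₂ G.θ₀).intervalIntegrable (μ := volume) G.l G.u
    rw [intervalIntegral.integral_add (i2.sub (i1.const_mul _)) (i0.const_mul _),
      intervalIntegral.integral_sub i2 (i1.const_mul _), intervalIntegral.integral_const_mul,
      intervalIntegral.integral_const_mul, G.integral_q₁, G.integral_q₂]
    change _ + _ * G.Z G.θ₀ = 0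
    field_simp
    ring
  · exact ((G.continuous_q _).mul (G.continuous_m₂ _)).intervalIntegrable _ _
  · exact ((G.continuous_q _).mul ((G.continuous_m₁ _).pow 2)).intervalIntegrable _ _

end PeakModel

/-- Pointwise comparison of Kullback-Leibler with Hellinger: `log s ≤ s - 1` at `s = √b / √a` bounds
the right side below by `(√a - √b)²`, and `(√a + √b)² ≤ 2(a + b)`. -/
lemma sq_sub_div_le_mul_log {a b : ℝ} (ha : 0 < a) (hb : 0 < b) :
    (a - b) ^ 2 / (2 * (a + b)) ≤ a * (Real.log a - Real.log b) - a + b := by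
  obtain ⟨p, hp, rfl⟩ : ∃ p, 0 < p ∧ a = p ^ 2 :=
    ⟨√a, Real.sqrt_pos.mpr ha, (Real.sq_sqrt ha.le).symm⟩
  obtain ⟨r, hr, rfl⟩ : ∃ r, 0 < r ∧ b = r ^ 2 :=
    ⟨√b, Real.sqrt_pos.mpr hb, (Real.sq_sqrt hb.le).symm⟩
  have h1 := Real.log_le_sub_one_of_pos (div_pos hr hp)
  rw [Real.log_div hr.ne' hp.ne'] at h1
  have h2 : p ^ 2 * (Real.log (p ^ 2) - Real.log (r ^ 2)) ≥ 2 * p ^ 2 - 2 * (p * r) := by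
    rw [Real.log_pow, Real.log_pow]
    have h3 : p ^ 2 * (Real.log r - Real.log p) ≤ p ^ 2 * (r / p - 1) :=
      mul_le_mul_of_nonneg_left h1 (sq_nonneg p)
    have h4 : p ^ 2 * (r / p - 1) = p * r - p ^ 2 := by field_simp
    push_cast
    linarith
  have h5 : (p ^ 2 - r ^ 2) ^ 2 / (2 * (p ^ 2 + r ^ 2)) ≤ (p - r) ^ 2 := by
    rw [div_le_iff₀ (by positivity)]
    have : (p ^ 2 - r ^ 2) ^ 2 = (p - r) ^ 2 * (p + r) ^ 2 := by ring
    rw [this]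
    refine mul_le_mul_of_nonneg_left ?_ (sq_nonneg _)
    nlinarith [sq_nonneg (p - r)]
  linarith [h5, h2, sub_sq p r]

/-! ### Likelihood gap between the true centre and any other centre -/

namespace PeakModel

variable (G : PeakModel)

/-- The Kullback-Leibler divergence dominates a squared `L²` distance. -/
lemma integral_sq_le_gap {φ : ℝ} (hφ : φ ∈ Set.Icc G.l G.u) :
    (∫ x in G.l..G.u, (G.q x G.θ₀ - G.Z G.θ₀ / G.Z φ * G.q x φ) ^ 2) / (14 * (G.α + G.β)) ≤
      ∫ x in G.l..G.u, G.q x G.θ₀ * (G.m x G.θ₀ - G.m x φ) := by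
  set k : ℝ := G.Z G.θ₀ / G.Z φ with hk
  have hk0 : 0 < k := div_pos (G.Z_pos _) (G.Z_pos _)
  have hk6 : k ≤ 6 := by
    rw [hk, div_le_iff₀ (G.Z_pos _)]
    exact G.Z_le_six_mul_Z hφ
  have hα := G.hα
  have hβ := G.hβ
  have c0 := G.continuous_q G.θ₀
  have cφ := G.continuous_q φ
  have i0 := c0.intervalIntegrable (μ := volume) G.l G.u
  have iφ := (cφ.const_mul k).intervalIntegrable (μ := volume) G.l G.u
  have cm : Continuous fun x => G.q x G.θ₀ * (G.m x G.θ₀ - G.m x φ) :=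
    c0.mul ((G.continuous_m _).sub (G.continuous_m _))
  have im := cm.intervalIntegrable (μ := volume) G.l G.u
  -- The factor `k` gives both densities the same mass, so the linear terms needed for a pointwise
  -- bound can be inserted for free. As `k ≤ 6`, the two densities sum to at most `7(α + β)`, whence
  -- the `14`.
  have hbal : ∫ x in G.l..G.u, k * G.q x φ = ∫ x in G.l..G.u, G.q x G.θ₀ := by
    rw [intervalIntegral.integral_const_mul]
    change k * G.Z φ = G.Z G.θ₀
    rw [hk, div_mul_cancel₀ _ (G.Z_pos φ).ne']
  have heq : ∫ x in G.l..G.u, G.q x G.θ₀ * (G.m x G.θ₀ - G.m x φ) =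
      ∫ x in G.l..G.u, (G.q x G.θ₀ * (G.m x G.θ₀ - G.m x φ) - G.q x G.θ₀ + k * G.q x φ) := by
    rw [intervalIntegral.integral_add (im.sub i0) iφ, intervalIntegral.integral_sub im i0, hbal]
    ring
  rw [heq, ← intervalIntegral.integral_div]
  have cw : Continuous fun x => (G.q x G.θ₀ - k * G.q x φ) ^ 2 / (14 * (G.α + G.β)) := by fun_prop
  refine intervalIntegral.integral_mono_on G.l_lt_u.le (cw.intervalIntegrable _ _)
    ((im.sub i0).add iφ) fun x _ => ?_
  have hq0 := G.q_pos x G.θ₀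
  have hqφ := G.q_pos x φ
  have hlog : G.m x G.θ₀ - G.m x φ = Real.log (G.q x G.θ₀) - Real.log (k * G.q x φ) := by
    unfold m
    rw [Real.log_mul hk0.ne' hqφ.ne', hk, Real.log_div (G.Z_pos _).ne' (G.Z_pos _).ne']
    ring
  rw [hlog]
  refine le_trans ?_ (sq_sub_div_le_mul_log hq0 (mul_pos hk0 hqφ))
  refine div_le_div_of_nonneg_left (sq_nonneg _) (by positivity) ?_
  have h1 : k * G.q x φ ≤ 6 * (G.α + G.β) :=
    mul_le_mul hk6 (G.q_le x φ) hqφ.le (by norm_num)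
  linarith [G.q_le x G.θ₀]

lemma sq_le_sq_exp_sub_exp_neg (t : ℝ) : t ^ 2 ≤ (Real.exp t - Real.exp (-t)) ^ 2 := by
  have key : ∀ s : ℝ, 0 ≤ s → s ^ 2 ≤ (Real.exp s - Real.exp (-s)) ^ 2 := fun s hs => by
    have h1 := Real.add_one_le_exp s
    have h2 : Real.exp (-s) ≤ 1 := Real.exp_le_one_iff.mpr (by linarith)
    exact pow_le_pow_left₀ hs (by linarith) 2
  rcases le_total 0 t with h | h
  · exact key t h
  · have := key (-t) (by linarith)
    rw [neg_neg] at this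
    calc t ^ 2 = (-t) ^ 2 := by ring
      _ ≤ _ := this
      _ = _ := by ring

lemma bump_offset {σ : ℝ} (hσ : 0 < σ) (θ y d : ℝ) :
    bump σ (θ + y * σ) (θ + d * σ) = Real.exp (-(y - d) ^ 2 / 2) := by
  unfold bump
  congr 1
  field_simp
  ring

/-- Lower bound on the likelihood gap for centres within eight widths. -/
lemma gap_near {φ d : ℝ} (hφ : φ ∈ Set.Icc G.l G.u) (hd : φ = G.θ₀ + d * G.σ) (hd8 : |d| ≤ 8) :
    gapConst * G.snr * d ^ 2 ≤ ∫ x in G.l..G.u, G.q x G.θ₀ * (G.m x G.θ₀ - G.m x φ) := by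
  have hσ := G.hσ
  have hα := G.hα
  have hβ := G.hβ
  refine le_trans ?_ (G.integral_sq_le_gap hφ)
  set k : ℝ := G.Z G.θ₀ / G.Z φ with hk
  have hk6 : 1 / 6 ≤ k := by
    rw [hk, le_div_iff₀ (G.Z_pos _)]
    linarith [G.Z_le_six_mul_Z (φ := φ) G.center_mem]
  have c0 := G.continuous_q G.θ₀
  have cφ := G.continuous_q φ
  have cw : Continuous fun x => (G.q x G.θ₀ - k * G.q x φ) ^ 2 := by fun_prop
  -- Origin of `gapConst`: `1008 = 14 * 72`, and `68 = 2² + 8²` comes from `y ≤ 2` and `|d| ≤ 8`.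
  have key := G.le_integral_of_reflect cw (fun x => sq_nonneg _)
    (κ := G.α ^ 2 * (Real.exp (-68) * d ^ 2) / 72) ?_
  · rw [le_div_iff₀ (by positivity)]
    refine le_trans (le_of_eq ?_) key
    unfold gapConst snr
    field_simp
    ring
  · intro x hx
    obtain ⟨y, hy⟩ : ∃ y, x = G.θ₀ + y * G.σ := ⟨(x - G.θ₀) / G.σ, by field_simp; ring⟩
    have hy1 : 1 ≤ y := by
      have : 1 * G.σ ≤ y * G.σ := by linarith [hx.1]
      exact le_of_mul_le_mul_right this hσ
    have hy2 : y ≤ 2 := by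
      have : y * G.σ ≤ 2 * G.σ := by linarith [hx.2]
      exact le_of_mul_le_mul_right this hσ
    have hy' : 2 * G.θ₀ - x = G.θ₀ + (-y) * G.σ := by rw [hy]; ring
    rw [G.q_reflect]
    set a := G.q x G.θ₀ with ha
    -- The true density takes the same value `a` at both points of a mirror pair, so `a` and the
    -- floor drop out of the difference, which is a hyperbolic sine in `y * d`. The pair then
    -- controls it through `(u - w)² ≤ 2(u² + w²)`.
    have hdiff : (k * G.q x φ - k * G.q (2 * G.θ₀ - x) φ) ^ 2 ≥
        G.α ^ 2 * (Real.exp (-68) * d ^ 2) / 36 := by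
      have e1 : k * G.q x φ - k * G.q (2 * G.θ₀ - x) φ =
          k * G.α * (Real.exp (-(y ^ 2 + d ^ 2) / 2) *
            (Real.exp (y * d) - Real.exp (-(y * d)))) := by
        unfold q
        rw [hy', hy, hd, bump_offset hσ, bump_offset hσ, mul_sub, ← Real.exp_add, ← Real.exp_add]
        have e2 : -(y - d) ^ 2 / 2 = -(y ^ 2 + d ^ 2) / 2 + y * d := by ring
        have e3 : -(-y - d) ^ 2 / 2 = -(y ^ 2 + d ^ 2) / 2 + -(y * d) := by ring
        rw [e2, e3]
        ring
      rw [e1, mul_pow, mul_pow, mul_pow]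
      have h1 : (1 / 36 : ℝ) ≤ k ^ 2 := by nlinarith
      have h2 : Real.exp (-68) ≤ Real.exp (-(y ^ 2 + d ^ 2) / 2) ^ 2 := by
        rw [← Real.exp_nat_mul]
        refine Real.exp_le_exp.mpr ?_
        have hd2 : d ^ 2 ≤ 8 ^ 2 := sq_le_sq' (by linarith [(abs_le.mp hd8).1]) (abs_le.mp hd8).2
        have hyy : y ^ 2 ≤ 4 := by nlinarith
        push_cast
        linarith
      have h3 : d ^ 2 ≤ (Real.exp (y * d) - Real.exp (-(y * d))) ^ 2 := by
        refine le_trans ?_ (sq_le_sq_exp_sub_exp_neg (y * d))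
        rw [mul_pow]
        have : 1 ≤ y ^ 2 := by nlinarith
        nlinarith [sq_nonneg d]
      calc G.α ^ 2 * (Real.exp (-68) * d ^ 2) / 36 =
            (1 / 36 * G.α ^ 2) * (Real.exp (-68) * d ^ 2) := by ring
        _ ≤ _ := by gcongr
    nlinarith [sq_nonneg ((a - k * G.q x φ) + (a - k * G.q (2 * G.θ₀ - x) φ))]

/-- Lower bound on the likelihood gap for centres more than eight widths away. -/
lemma gap_far {φ d : ℝ} (hφ : φ ∈ Set.Icc G.l G.u) (hd : φ = G.θ₀ + d * G.σ) (hd8 : 8 ≤ |d|) :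
    gapConst * G.snr ≤ ∫ x in G.l..G.u, G.q x G.θ₀ * (G.m x G.θ₀ - G.m x φ) := by
  have hσ := G.hσ
  have hα := G.hα
  have hβ := G.hβ
  refine le_trans ?_ (G.integral_sq_le_gap hφ)
  set k : ℝ := G.Z G.θ₀ / G.Z φ with hk
  have hk0 : 0 < k := div_pos (G.Z_pos _) (G.Z_pos _)
  have hk6 : k ≤ 6 := by
    rw [hk, div_le_iff₀ (G.Z_pos _)]
    exact G.Z_le_six_mul_Z hφ
  have c0 := G.continuous_q G.θ₀
  have cφ := G.continuous_q φ
  have cw : Continuous fun x => (G.q x G.θ₀ - k * G.q x φ) ^ 2 := by fun_prop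
  -- Comparing `x` with `x + 2σ` removes both floors. The true bump drops from at least `7/8` to at
  -- most `1/4`, while the displaced one, scaled by `k ≤ 6`, supplies at most `6/24` at `x`. The
  -- difference is at least `3α/8`, and half its square exceeds `α² / 16`.
  have key := G.le_integral_of_shift cw (fun x => sq_nonneg _) (κ := G.α ^ 2 / 16) ?_
  · rw [le_div_iff₀ (by positivity)]
    refine le_trans ?_ key
    have e1 : G.snr * (14 * (G.α + G.β)) = 14 * (G.σ * G.α ^ 2) := by
      unfold snr
      field_simp
    have h1 := gapConst_le
    have h2 : 0 ≤ G.σ * G.α ^ 2 := by positivity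
    rw [mul_assoc, e1]
    nlinarith
  · intro x hx
    obtain ⟨y, hy⟩ : ∃ y, x = G.θ₀ + y * G.σ := ⟨(x - G.θ₀) / G.σ, by field_simp; ring⟩
    have hy1 : 0 ≤ y := by
      have : 0 * G.σ ≤ y * G.σ := by linarith [hx.1]
      exact le_of_mul_le_mul_right this hσ
    have hy2 : y ≤ 1 / 2 := by
      have : y * G.σ ≤ 1 / 2 * G.σ := by linarith [hx.2]
      exact le_of_mul_le_mul_right this hσ
    have hy' : x + 2 * G.σ = G.θ₀ + (y + 2) * G.σ := by rw [hy]; ring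
    have hfar : ∀ z : ℝ, 0 ≤ z → z ≤ 5 / 2 → Real.exp (-(z - d) ^ 2 / 2) ≤ 1 / 24 := by
      intro z hz0 hz1
      have hzd : 11 / 2 ≤ |z - d| := by
        rcases le_abs.mp hd8 with h | h
        · rw [abs_of_nonpos (by linarith)]
          linarith
        · rw [abs_of_nonneg (by linarith)]
          linarith
      have hsq : (121 / 4 : ℝ) ≤ (z - d) ^ 2 := by
        rw [← sq_abs]
        nlinarith
      have h1 : Real.exp (-(z - d) ^ 2 / 2) ≤ Real.exp (-(5 : ℕ)) := by
        refine Real.exp_le_exp.mpr ?_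
        push_cast
        linarith
      refine h1.trans ?_
      rw [Real.exp_neg, ← one_div]
      refine one_div_le_one_div_of_le (by norm_num) ?_
      rw [← Real.exp_one_pow]
      have h2 := Real.add_one_le_exp (1 : ℝ)
      calc (24 : ℝ) ≤ 2 ^ 5 := by norm_num
        _ ≤ Real.exp 1 ^ 5 := pow_le_pow_left₀ (by norm_num) (by linarith) 5
    have b1 : 7 / 8 ≤ bump G.σ x G.θ₀ := by
      rw [hy, bump_scaled hσ]
      have := Real.add_one_le_exp (-y ^ 2 / 2)
      nlinarith
    have b2 : bump G.σ (x + 2 * G.σ) G.θ₀ ≤ 1 / 4 := by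
      rw [hy', bump_scaled hσ]
      have h1 : Real.exp (-(y + 2) ^ 2 / 2) ≤ Real.exp (-(2 : ℕ)) := by
        refine Real.exp_le_exp.mpr ?_
        push_cast
        nlinarith
      refine h1.trans ?_
      rw [Real.exp_neg, ← one_div]
      refine one_div_le_one_div_of_le (by norm_num) ?_
      rw [← Real.exp_one_pow]
      have h2 := Real.add_one_le_exp (1 : ℝ)
      nlinarith
    have b3 : bump G.σ x φ ≤ 1 / 24 := by
      rw [hy, hd, bump_offset hσ]
      exact hfar y hy1 (by linarith)
    have b4 := bump_pos G.σ (x + 2 * G.σ) φ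
    have hkb : k * bump G.σ x φ ≤ 6 * (1 / 24) :=
      mul_le_mul hk6 b3 (bump_pos _ _ _).le (by norm_num)
    have hkb' := mul_pos hk0 b4
    have hdiff : G.α * (3 / 8) ≤ (G.q x G.θ₀ - k * G.q x φ) -
        (G.q (x + 2 * G.σ) G.θ₀ - k * G.q (x + 2 * G.σ) φ) := by
      have e1 : (G.q x G.θ₀ - k * G.q x φ) -
        (G.q (x + 2 * G.σ) G.θ₀ - k * G.q (x + 2 * G.σ) φ) =
          G.α * (bump G.σ x G.θ₀ - bump G.σ (x + 2 * G.σ) G.θ₀ - k * bump G.σ x φ +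
            k * bump G.σ (x + 2 * G.σ) φ) := by
        unfold q
        ring
      rw [e1]
      refine mul_le_mul_of_nonneg_left ?_ hα.le
      linarith
    set a := G.q x G.θ₀ - k * G.q x φ
    set b := G.q (x + 2 * G.σ) G.θ₀ - k * G.q (x + 2 * G.σ) φ
    have h1 := pow_le_pow_left₀ (by positivity) hdiff 2
    nlinarith [sq_nonneg (a + b), sq_nonneg G.α]

lemma gap {φ : ℝ} (hφ : φ ∈ Set.Icc G.l G.u) :
    gapConst * G.snr * min 1 (((φ - G.θ₀) / G.σ) ^ 2) ≤
      ∫ x in G.l..G.u, G.q x G.θ₀ * (G.m x G.θ₀ - G.m x φ) := by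
  have hσ := G.hσ.ne'
  have hd : φ = G.θ₀ + (φ - G.θ₀) / G.σ * G.σ := by field_simp; ring
  have h0 : 0 ≤ gapConst * G.snr := mul_nonneg gapConst_pos.le G.snr_pos.le
  rcases le_total |(φ - G.θ₀) / G.σ| 8 with h | h
  · exact (mul_le_mul_of_nonneg_left (min_le_right _ _) h0).trans (G.gap_near hφ hd h)
  · refine (mul_le_mul_of_nonneg_left (min_le_left _ _) h0).trans ?_
    rw [mul_one]
    exact G.gap_far hφ hd h

end PeakModel

/-! ### Stability of the maximum under contamination -/

namespace PeakModel

variable (G : PeakModel)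

lemma intervalIntegrable_q_mul {h : ℝ → ℝ} (hh : Continuous h) :
    IntervalIntegrable (fun x => G.q x G.θ₀ * h x) volume G.l G.u :=
  ((G.continuous_q _).mul hh).intervalIntegrable _ _

/-- The density `p` is that of the model up to a small nonnegative contamination. -/
structure Contaminated (G : PeakModel) (p : ℝ → ℝ) (η : ℝ) : Prop where
  meas : Measurable p
  le : ∀ x ∈ Set.Icc G.l G.u, G.q x G.θ₀ ≤ p x
  ge : ∀ x ∈ Set.Icc G.l G.u, p x ≤ G.q x G.θ₀ + η

variable {G}

namespace Contaminated

variable {p : ℝ → ℝ} {η : ℝ}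

lemma nonneg (hp : G.Contaminated p η) : 0 ≤ η := by
  have h1 := hp.le G.θ₀ G.center_mem
  have h2 := hp.ge G.θ₀ G.center_mem
  linarith

lemma pos (hp : G.Contaminated p η) {x : ℝ} (hx : x ∈ Set.Icc G.l G.u) : 0 < p x :=
  (G.q_pos x G.θ₀).trans_le (hp.le x hx)

lemma abs_le (hp : G.Contaminated p η) {x : ℝ} (hx : x ∈ Set.Icc G.l G.u) :
    |p x| ≤ G.α + G.β + η := by
  rw [abs_of_pos (hp.pos hx)]
  linarith [hp.ge x hx, G.q_le x G.θ₀]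

lemma intervalIntegrable (hp : G.Contaminated p η) : IntervalIntegrable p volume G.l G.u := by
  rw [intervalIntegrable_iff_integrableOn_Icc_of_le G.l_lt_u.le]
  refine Measure.integrableOn_of_bounded (M := G.α + G.β + η) (by simp)
    hp.meas.aestronglyMeasurable ?_
  exact (ae_restrict_mem measurableSet_Icc).mono fun x hx => hp.abs_le hx

lemma intervalIntegrable_mul (hp : G.Contaminated p η) {h : ℝ → ℝ} (hh : Continuous h) :
    IntervalIntegrable (fun x => p x * h x) volume G.l G.u :=
  hp.intervalIntegrable.mul_continuousOn hh.continuousOn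

lemma uIoc_subset : Set.uIoc G.l G.u ⊆ Set.Icc G.l G.u := by
  rw [Set.uIoc_of_le G.l_lt_u.le]
  exact Set.Ioc_subset_Icc_self

lemma abs_integral_sub_le (hp : G.Contaminated p η) {h : ℝ → ℝ} (hh : Continuous h) {C : ℝ}
    (hC : ∀ x ∈ Set.Icc G.l G.u, |h x| ≤ C) :
    |(∫ x in G.l..G.u, p x * h x) - ∫ x in G.l..G.u, G.q x G.θ₀ * h x| ≤
      η * (G.u - G.l) * C := by
  rw [← intervalIntegral.integral_sub (hp.intervalIntegrable_mul hh)
    (G.intervalIntegrable_q_mul hh)]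
  have := intervalIntegral.norm_integral_le_of_norm_le_const (a := G.l) (b := G.u) (C := η * C)
    (f := fun x => p x * h x - G.q x G.θ₀ * h x) fun x hx => by
      have hx' := uIoc_subset hx
      rw [← sub_mul, norm_mul]
      refine mul_le_mul ?_ (hC x hx') (norm_nonneg _) hp.nonneg
      rw [Real.norm_eq_abs, abs_of_nonneg (by linarith [hp.le x hx'])]
      linarith [hp.ge x hx']
  rw [Real.norm_eq_abs, abs_of_pos G.length_pos] at this
  linarith

lemma lipschitz_integral (hp : G.Contaminated p η) {φ φ' : ℝ} (hφ : φ ∈ Set.Icc G.l G.u)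
    (hφ' : φ' ∈ Set.Icc G.l G.u) :
    |(∫ x in G.l..G.u, p x * G.m x φ) - ∫ x in G.l..G.u, p x * G.m x φ'| ≤
      (G.α + G.β + η) * (2 * G.R / G.σ) * (G.u - G.l) * |φ - φ'| := by
  rw [← intervalIntegral.integral_sub (hp.intervalIntegrable_mul (G.continuous_m _))
    (hp.intervalIntegrable_mul (G.continuous_m _))]
  have := intervalIntegral.norm_integral_le_of_norm_le_const (a := G.l) (b := G.u)
    (C := (G.α + G.β + η) * (2 * G.R / G.σ * |φ - φ'|))
    (f := fun x => p x * G.m x φ - p x * G.m x φ') fun x hx => by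
      have hx' := uIoc_subset hx
      rw [← mul_sub, norm_mul]
      exact mul_le_mul (hp.abs_le hx') (G.abs_m_sub_le hx' hφ hφ') (norm_nonneg _)
        ((abs_nonneg _).trans (hp.abs_le hx'))
  rw [Real.norm_eq_abs, abs_of_pos G.length_pos] at this
  linarith

lemma continuousOn_integral (hp : G.Contaminated p η) :
    ContinuousOn (fun φ => ∫ x in G.l..G.u, p x * G.m x φ) (Set.Icc G.l G.u) := by
  have hC : 0 ≤ (G.α + G.β + η) * (2 * G.R / G.σ) * (G.u - G.l) := by
    have := G.hα
    have := G.hβ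
    have := hp.nonneg
    have := G.R_pos
    have := G.hσ
    have := G.length_pos
    positivity
  have : LipschitzOnWith (Real.toNNReal ((G.α + G.β + η) * (2 * G.R / G.σ) * (G.u - G.l)))
      (fun φ => ∫ x in G.l..G.u, p x * G.m x φ) (Set.Icc G.l G.u) := by
    refine LipschitzOnWith.of_dist_le_mul fun φ hφ φ' hφ' => ?_
    rw [Real.dist_eq, Real.dist_eq, Real.coe_toNNReal _ hC]
    exact hp.lipschitz_integral hφ hφ'
  exact this.continuousOn

lemma hasDerivAt_integral (hp : G.Contaminated p η) {f f' : ℝ → ℝ → ℝ} {C : ℝ}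
    (hf : ∀ φ, Continuous fun x => f x φ) (hf' : ∀ φ, Continuous fun x => f' x φ)
    (hd : ∀ x φ, HasDerivAt (f x) (f' x φ) φ)
    (hC : ∀ x ∈ Set.Icc G.l G.u, ∀ φ ∈ Set.Icc G.l G.u, |f' x φ| ≤ C) {φ : ℝ}
    (hφ : φ ∈ Set.Ioo G.l G.u) :
    HasDerivAt (fun φ => ∫ x in G.l..G.u, p x * f x φ) (∫ x in G.l..G.u, p x * f' x φ) φ := by
  have hms : ∀ h : ℝ → ℝ, Continuous h →
      AEStronglyMeasurable (fun x => p x * h x) (volume.restrict (Set.uIoc G.l G.u)) :=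
    fun h hh => (hp.meas.mul hh.measurable).aestronglyMeasurable
  refine (intervalIntegral.hasDerivAt_integral_of_dominated_loc_of_deriv_le
    (F := fun φ x => p x * f x φ) (F' := fun φ x => p x * f' x φ)
    (bound := fun _ => (G.α + G.β + η) * C) (Icc_mem_nhds hφ.1 hφ.2)
    (Eventually.of_forall fun φ => hms _ (hf φ)) (hp.intervalIntegrable_mul (hf φ))
    (hms _ (hf' φ)) (ae_of_all _ fun x hx ψ hψ => ?_) intervalIntegrable_const
    (ae_of_all _ fun x _ ψ _ => (hd x ψ).const_mul (p x))).2
  have hx' := uIoc_subset hx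
  rw [norm_mul]
  exact mul_le_mul (hp.abs_le hx') (hC x hx' ψ hψ) (norm_nonneg _)
    ((abs_nonneg _).trans (hp.abs_le hx'))

end Contaminated

variable (G)

lemma abs_integral_q_mul_le {h : ℝ → ℝ} (hh : Continuous h) {C : ℝ}
    (hC : ∀ x ∈ Set.Icc G.l G.u, |h x| ≤ C) :
    |∫ x in G.l..G.u, G.q x G.θ₀ * h x| ≤ G.Z G.θ₀ * C := by
  have hc := (G.continuous_q G.θ₀).mul hh
  calc |∫ x in G.l..G.u, G.q x G.θ₀ * h x| ≤ ∫ x in G.l..G.u, |G.q x G.θ₀ * h x| :=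
        intervalIntegral.abs_integral_le_integral_abs G.l_lt_u.le
    _ ≤ ∫ x in G.l..G.u, G.q x G.θ₀ * C := by
        refine intervalIntegral.integral_mono_on G.l_lt_u.le (hc.abs.intervalIntegrable _ _)
          (((G.continuous_q _).mul continuous_const).intervalIntegrable _ _) fun x hx => ?_
        rw [abs_mul, abs_of_pos (G.q_pos _ _)]
        exact mul_le_mul_of_nonneg_left (hC x hx) (G.q_pos _ _).le
    _ = G.Z G.θ₀ * C := intervalIntegral.integral_mul_const _ _

variable {G}

namespace Contaminated

variable {p : ℝ → ℝ} {η : ℝ}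

lemma curvature_small (hZ : G.Z G.θ₀ ≤ 2) : gapConst * G.snr ≤ 1 := by
  have h1 : G.snr ≤ G.α * G.σ := by
    have := G.hα
    have := G.hβ
    have := G.hσ
    unfold snr
    rw [div_le_iff₀ (by positivity)]
    nlinarith [mul_pos (mul_pos G.hα G.hσ) G.hβ]
  have h2 := G.le_Z G.center_mem
  have h3 := mul_pos G.hβ G.length_pos
  have h4 := gapConst_le
  have h5 := gapConst_pos
  have h6 := G.snr_pos
  nlinarith

/-- The displacement of the maximum, in units of the width, that the contamination can cause. -/
noncomputable def shift (G : PeakModel) (η : ℝ) : ℝ :=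
  2 * (η * (G.u - G.l)) * G.R / (gapConst * G.snr)

/-- One hypothesis serves three purposes: no maximizer lies a width or more away, the curvature and
the score change little over the ball of radius `σ * shift`, and that ball lies inside the window.
As `gapConst * snr ≤ 1`, its square in the hypothesis may be weakened to the first power. -/
lemma smallness (hp : G.Contaminated p η) (hZ : G.Z G.θ₀ ≤ 2)
    (hS : 192 * (η * (G.u - G.l)) * G.R ^ 4 ≤ (gapConst * G.snr) ^ 2) :
    16 * (η * (G.u - G.l)) * G.R ^ 2 ≤ gapConst * G.snr ∧
    96 * (G.R ^ 3 * shift G η) ≤ gapConst * G.snr ∧ shift G η < 1 ∧ 0 ≤ shift G η := by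
  have hc : 0 < gapConst * G.snr := mul_pos gapConst_pos G.snr_pos
  have hc1 := curvature_small hZ
  have he : 0 ≤ η * (G.u - G.l) := mul_nonneg hp.nonneg G.length_pos.le
  have hR := G.R_ge
  have hR2 : (1 : ℝ) ≤ G.R ^ 2 := by nlinarith
  have h1 : 16 * (η * (G.u - G.l)) * G.R ^ 2 ≤ gapConst * G.snr := by
    have : 16 * (η * (G.u - G.l)) * G.R ^ 2 ≤ 192 * (η * (G.u - G.l)) * G.R ^ 4 := by
      have h2 : 0 ≤ η * (G.u - G.l) * G.R ^ 2 := by positivity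
      nlinarith
    nlinarith
  have h2 : 96 * (G.R ^ 3 * shift G η) ≤ gapConst * G.snr := by
    unfold shift
    rw [← mul_div_assoc, ← mul_div_assoc, div_le_iff₀ hc]
    nlinarith
  have h3 : 0 ≤ shift G η := by
    unfold shift
    have := G.R_pos
    positivity
  refine ⟨h1, h2, ?_, h3⟩
  have hR3 : (1 : ℝ) ≤ G.R ^ 3 := one_le_pow₀ (by linarith)
  nlinarith

/-- Every centre that is at least as likely as the true one is close to it. -/
lemma abs_sub_le_of_le (hp : G.Contaminated p η) (hZ : G.Z G.θ₀ ≤ 2)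
    (hS : 192 * (η * (G.u - G.l)) * G.R ^ 4 ≤ (gapConst * G.snr) ^ 2) {θ : ℝ}
    (hθ : θ ∈ Set.Icc G.l G.u)
    (hle : ∫ x in G.l..G.u, p x * G.m x G.θ₀ ≤ ∫ x in G.l..G.u, p x * G.m x θ) :
    |θ - G.θ₀| ≤ G.σ * shift G η := by
  have hσ := G.hσ
  have hc : 0 < gapConst * G.snr := mul_pos gapConst_pos G.snr_pos
  obtain ⟨h16, -, -, -⟩ := hp.smallness hZ hS
  set e : ℝ := η * (G.u - G.l) with he
  have he0 : 0 ≤ e := mul_nonneg hp.nonneg G.length_pos.le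
  set c : ℝ := gapConst * G.snr with hcdef
  have hR := G.R_ge
  set y : ℝ := (θ - G.θ₀) / G.σ with hy
  have hyθ : |θ - G.θ₀| = |y| * G.σ := by
    rw [hy, abs_div, abs_of_pos hσ]
    field_simp
  have hyR : |y| ≤ G.R := by
    rw [hy, abs_div, abs_of_pos hσ, div_le_iff₀ hσ, ← G.length_eq, _root_.abs_le]
    constructor <;> linarith [hθ.1, hθ.2, G.center_mem.1, G.center_mem.2]
  have hgap := G.gap hθ
  have hcont := hp.abs_integral_sub_le (h := fun x => G.m x G.θ₀ - G.m x θ)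
    ((G.continuous_m _).sub (G.continuous_m _)) (C := 2 * G.R / G.σ * |G.θ₀ - θ|)
    fun x hx => G.abs_m_sub_le hx G.center_mem hθ
  have hsplit : ∫ x in G.l..G.u, p x * (G.m x G.θ₀ - G.m x θ) =
      (∫ x in G.l..G.u, p x * G.m x G.θ₀) - ∫ x in G.l..G.u, p x * G.m x θ := by
    rw [← intervalIntegral.integral_sub (hp.intervalIntegrable_mul (G.continuous_m _))
      (hp.intervalIntegrable_mul (G.continuous_m _))]
    simp_rw [mul_sub]
  have hconst : e * (2 * G.R / G.σ * |G.θ₀ - θ|) = 2 * e * G.R * |y| := by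
    rw [abs_sub_comm, hyθ]
    field_simp
  rw [hconst] at hcont
  -- The gap of the clean model must be paid for by the contamination. The right side vanishes
  -- linearly in `|y|` because the log-density is Lipschitz in the centre; dividing by `|y|` in the
  -- quadratic regime gives the bound, and `|y| ≤ R` excludes the flat regime.
  have hmain : c * min 1 (y ^ 2) ≤ 2 * e * G.R * |y| := by
    have := (_root_.abs_le.mp hcont).1
    linarith
  have hy2 : y ^ 2 = |y| ^ 2 := (sq_abs y).symm
  rw [hyθ, mul_comm]
  refine mul_le_mul_of_nonneg_left ?_ hσ.le
  unfold shift
  rw [← he, ← hcdef, le_div_iff₀ hc]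
  rcases le_total 1 (y ^ 2) with h | h
  · rw [min_eq_left h, mul_one] at hmain
    exfalso
    have h2 : 2 * e * G.R * |y| ≤ 2 * e * G.R * G.R :=
      mul_le_mul_of_nonneg_left hyR (by have := G.R_pos; positivity)
    nlinarith
  · rw [min_eq_right h, hy2] at hmain
    rcases (abs_nonneg y).eq_or_lt with h0 | h0
    · rw [← h0]
      have := G.R_pos
      rw [zero_mul]
      positivity
    · refine le_of_mul_le_mul_right ?_ h0
      linarith

/-- Two errors, each at most a quarter of the Fisher information: replacing `p` by the clean density
at `θ`, and moving from `θ` to `θ₀` under the clean density, where the information equality applies.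
-/
lemma abs_curvature_add_fisher_le (hp : G.Contaminated p η) (hZ : G.Z G.θ₀ ≤ 2)
    (hS : 192 * (η * (G.u - G.l)) * G.R ^ 4 ≤ (gapConst * G.snr) ^ 2) {θ : ℝ}
    (hθ : θ ∈ Set.Icc G.l G.u) (hclose : |θ - G.θ₀| ≤ G.σ * shift G η) :
    |(∫ x in G.l..G.u, p x * G.m₂ x θ) + G.fisher| ≤ G.fisher / 2 := by
  have hσ := G.hσ
  obtain ⟨h1, h2, -, h4⟩ := hp.smallness hZ hS
  have hF := G.snr_le_fisher
  have hR := G.R_pos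
  have hA := hp.abs_integral_sub_le (G.continuous_m₂ θ) fun x hx => G.abs_m₂_le hx hθ
  have hB := G.abs_integral_q_mul_le (h := fun x => G.m₂ x θ - G.m₂ x G.θ₀)
    ((G.continuous_m₂ θ).sub (G.continuous_m₂ G.θ₀))
    (C := 8 * G.R ^ 3 / G.σ ^ 3 * (G.σ * shift G η)) fun x hx =>
      (G.abs_m₂_sub_le hx hθ G.center_mem).trans
        (mul_le_mul_of_nonneg_left hclose (by positivity))
  have hsplit : ∫ x in G.l..G.u, G.q x G.θ₀ * (G.m₂ x θ - G.m₂ x G.θ₀) =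
      (∫ x in G.l..G.u, G.q x G.θ₀ * G.m₂ x θ) + G.fisher := by
    have := G.integral_q_mul_m₂
    simp_rw [mul_sub]
    rw [intervalIntegral.integral_sub (G.intervalIntegrable_q_mul (G.continuous_m₂ _))
      (G.intervalIntegrable_q_mul (G.continuous_m₂ _)), this]
    ring
  rw [hsplit] at hB
  have hB' : G.Z G.θ₀ * (8 * G.R ^ 3 / G.σ ^ 3 * (G.σ * shift G η)) ≤
      gapConst * G.snr / G.σ ^ 2 / 4 := by
    calc G.Z G.θ₀ * (8 * G.R ^ 3 / G.σ ^ 3 * (G.σ * shift G η))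
        ≤ 2 * (8 * G.R ^ 3 / G.σ ^ 3 * (G.σ * shift G η)) :=
          mul_le_mul_of_nonneg_right hZ (by positivity)
      _ = 16 * (G.R ^ 3 * shift G η) / G.σ ^ 2 := by field_simp; ring
      _ ≤ (gapConst * G.snr / 4) / G.σ ^ 2 := by
          refine div_le_div_of_nonneg_right ?_ (sq_nonneg _)
          nlinarith [mul_pos gapConst_pos G.snr_pos]
      _ = _ := by ring
  have hA' : η * (G.u - G.l) * (3 * G.R ^ 2 / G.σ ^ 2) ≤ gapConst * G.snr / G.σ ^ 2 / 4 := by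
    calc η * (G.u - G.l) * (3 * G.R ^ 2 / G.σ ^ 2)
        = 3 * (η * (G.u - G.l)) * G.R ^ 2 / G.σ ^ 2 := by ring
      _ ≤ (gapConst * G.snr / 4) / G.σ ^ 2 := by
          refine div_le_div_of_nonneg_right ?_ (sq_nonneg _)
          nlinarith [mul_pos gapConst_pos G.snr_pos]
      _ = _ := by ring
  rw [_root_.abs_le] at *
  constructor <;> linarith [hA.1, hA.2, hB.1, hB.2]

lemma abs_score_sq_sub_fisher_le (hp : G.Contaminated p η) (hZ : G.Z G.θ₀ ≤ 2)
    (hS : 192 * (η * (G.u - G.l)) * G.R ^ 4 ≤ (gapConst * G.snr) ^ 2) {θ : ℝ}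
    (hθ : θ ∈ Set.Icc G.l G.u) (hclose : |θ - G.θ₀| ≤ G.σ * shift G η) :
    |(∫ x in G.l..G.u, p x * G.m₁ x θ ^ 2) - G.fisher| ≤ G.fisher / 2 := by
  have hσ := G.hσ
  obtain ⟨h1, h2, -, h4⟩ := hp.smallness hZ hS
  have hF := G.snr_le_fisher
  have hR := G.R_pos
  have hc : ∀ φ, Continuous fun x => G.m₁ x φ ^ 2 := fun φ => (G.continuous_m₁ φ).pow 2
  have hA := hp.abs_integral_sub_le (hc θ) (C := (2 * G.R / G.σ) ^ 2)
    fun x hx => by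
      rw [abs_pow]
      exact pow_le_pow_left₀ (abs_nonneg _) (G.abs_m₁_le hx hθ) 2
  have hB := G.abs_integral_q_mul_le (h := fun x => G.m₁ x θ ^ 2 - G.m₁ x G.θ₀ ^ 2)
    ((hc θ).sub (hc G.θ₀))
    (C := 3 * G.R ^ 2 / G.σ ^ 2 * (G.σ * shift G η) * (4 * G.R / G.σ)) fun x hx => by
      rw [sq_sub_sq, mul_comm, abs_mul]
      refine mul_le_mul ((G.abs_m₁_sub_le hx hθ G.center_mem).trans
        (mul_le_mul_of_nonneg_left hclose (by positivity))) ?_ (abs_nonneg _) (by positivity)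
      refine (abs_add_le _ _).trans ?_
      have := G.abs_m₁_le hx hθ
      have := G.abs_m₁_le hx G.center_mem
      calc _ ≤ 2 * G.R / G.σ + 2 * G.R / G.σ := by linarith
        _ = _ := by ring
  have hsplit : ∫ x in G.l..G.u, G.q x G.θ₀ * (G.m₁ x θ ^ 2 - G.m₁ x G.θ₀ ^ 2) =
      (∫ x in G.l..G.u, G.q x G.θ₀ * G.m₁ x θ ^ 2) - G.fisher := by
    simp_rw [mul_sub]
    rw [intervalIntegral.integral_sub (G.intervalIntegrable_q_mul (hc θ))
      (G.intervalIntegrable_q_mul (hc G.θ₀))]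
    rfl
  rw [hsplit] at hB
  have hB' : G.Z G.θ₀ * (3 * G.R ^ 2 / G.σ ^ 2 * (G.σ * shift G η) * (4 * G.R / G.σ)) ≤
      gapConst * G.snr / G.σ ^ 2 / 4 := by
    calc G.Z G.θ₀ * (3 * G.R ^ 2 / G.σ ^ 2 * (G.σ * shift G η) * (4 * G.R / G.σ))
        ≤ 2 * (3 * G.R ^ 2 / G.σ ^ 2 * (G.σ * shift G η) * (4 * G.R / G.σ)) :=
          mul_le_mul_of_nonneg_right hZ (by positivity)
      _ = 24 * (G.R ^ 3 * shift G η) / G.σ ^ 2 := by field_simp; ring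
      _ ≤ (gapConst * G.snr / 4) / G.σ ^ 2 := by
          refine div_le_div_of_nonneg_right ?_ (sq_nonneg _)
          linarith
      _ = _ := by ring
  have hA' : η * (G.u - G.l) * (2 * G.R / G.σ) ^ 2 ≤ gapConst * G.snr / G.σ ^ 2 / 4 := by
    calc η * (G.u - G.l) * (2 * G.R / G.σ) ^ 2
        = 4 * (η * (G.u - G.l)) * G.R ^ 2 / G.σ ^ 2 := by field_simp; ring
      _ ≤ (gapConst * G.snr / 4) / G.σ ^ 2 := by
          refine div_le_div_of_nonneg_right ?_ (sq_nonneg _)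
          linarith
      _ = _ := by ring
  rw [_root_.abs_le] at *
  constructor <;> linarith [hA.1, hA.2, hB.1, hB.2]

/-- If the contamination is small, then the mean log-likelihood has a unique maximum; it is close
to the true centre, and the score and the curvature there are governed by the Fisher
information. -/
theorem exists_strict_max (hp : G.Contaminated p η) (hZ : G.Z G.θ₀ ≤ 2)
    (hS : 192 * (η * (G.u - G.l)) * G.R ^ 4 ≤ (gapConst * G.snr) ^ 2) :
    ∃ θ ∈ Set.Ioo G.l G.u, |θ - G.θ₀| ≤ G.σ * shift G η ∧
      (∀ φ ∈ Set.Icc G.l G.u, φ ≠ θ →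
        ∫ x in G.l..G.u, p x * G.m x φ < ∫ x in G.l..G.u, p x * G.m x θ) ∧
      |(∫ x in G.l..G.u, p x * G.m₂ x θ) + G.fisher| ≤ G.fisher / 2 ∧
      |(∫ x in G.l..G.u, p x * G.m₁ x θ ^ 2) - G.fisher| ≤ G.fisher / 2 := by
  have hσ := G.hσ
  obtain ⟨-, -, hs1, hs0⟩ := hp.smallness hZ hS
  obtain ⟨θ, hθ, hmax⟩ := isCompact_Icc.exists_isMaxOn ⟨G.θ₀, G.center_mem⟩
    hp.continuousOn_integral
  have hmax' : ∀ φ ∈ Set.Icc G.l G.u,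
      ∫ x in G.l..G.u, p x * G.m x φ ≤ ∫ x in G.l..G.u, p x * G.m x θ := fun φ hφ => hmax hφ
  have hin : ∀ ψ, |ψ - G.θ₀| ≤ G.σ * shift G η → ψ ∈ Set.Ioo G.l G.u := by
    intro ψ hψ
    have h1 : G.σ * shift G η ≤ G.σ * 1 := mul_le_mul_of_nonneg_left hs1.le hσ.le
    have h2 := _root_.abs_le.mp hψ
    have h3 := G.le_length
    exact ⟨by linarith [G.hl], by linarith [G.hu]⟩
  have hd : ∀ φ ∈ Set.Ioo G.l G.u, HasDerivAt (fun φ => ∫ x in G.l..G.u, p x * G.m x φ)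
      (∫ x in G.l..G.u, p x * G.m₁ x φ) φ := fun φ hφ =>
    hp.hasDerivAt_integral G.continuous_m G.continuous_m₁ G.hasDerivAt_m
      (fun x hx ψ hψ => G.abs_m₁_le hx hψ) hφ
  have hd₁ : ∀ φ ∈ Set.Ioo G.l G.u, HasDerivAt (fun φ => ∫ x in G.l..G.u, p x * G.m₁ x φ)
      (∫ x in G.l..G.u, p x * G.m₂ x φ) φ := fun φ hφ =>
    hp.hasDerivAt_integral G.continuous_m₁ G.continuous_m₂ G.hasDerivAt_m₁
      (fun x hx ψ hψ => G.abs_m₂_le hx hψ) hφ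
  have hcrit : ∀ ψ ∈ Set.Icc G.l G.u,
      (∀ φ ∈ Set.Icc G.l G.u,
        ∫ x in G.l..G.u, p x * G.m x φ ≤ ∫ x in G.l..G.u, p x * G.m x ψ) →
      |ψ - G.θ₀| ≤ G.σ * shift G η ∧ ∫ x in G.l..G.u, p x * G.m₁ x ψ = 0 := by
    intro ψ hψ hψmax
    have hcl := hp.abs_sub_le_of_le hZ hS hψ (hψmax _ G.center_mem)
    have hψ' := hin ψ hcl
    exact ⟨hcl, IsLocalMax.hasDerivAt_eq_zero
      (Filter.eventually_of_mem (Icc_mem_nhds hψ'.1 hψ'.2) fun φ hφ => hψmax φ hφ) (hd ψ hψ')⟩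
  -- Rolle: two zeros of the mean score near `θ₀` would enclose a point of zero curvature, but the
  -- curvature is at most `-fisher / 2` on the whole ball.
  have hno : ∀ a b, a < b → |a - G.θ₀| ≤ G.σ * shift G η → |b - G.θ₀| ≤ G.σ * shift G η →
      ∫ x in G.l..G.u, p x * G.m₁ x a = 0 → ∫ x in G.l..G.u, p x * G.m₁ x b = 0 → False := by
    intro a b hab ha hb ha0 hb0
    have hmid : ∀ ξ ∈ Set.Icc a b, |ξ - G.θ₀| ≤ G.σ * shift G η := fun ξ hξ => by
      rw [_root_.abs_le] at *
      constructor <;> linarith [hξ.1, hξ.2, ha.1, hb.2]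
    obtain ⟨ξ, hξ, h0⟩ := exists_hasDerivAt_eq_zero
      (f := fun φ => ∫ x in G.l..G.u, p x * G.m₁ x φ)
      (f' := fun φ => ∫ x in G.l..G.u, p x * G.m₂ x φ) hab
      (fun ξ hξ => (hd₁ ξ (hin ξ (hmid ξ hξ))).continuousAt.continuousWithinAt)
      (ha0.trans hb0.symm)
      (fun ξ hξ => hd₁ ξ (hin ξ (hmid ξ (Set.Ioo_subset_Icc_self hξ))))
    have hξc := hmid ξ (Set.Ioo_subset_Icc_self hξ)
    have := hp.abs_curvature_add_fisher_le hZ hS (Set.Ioo_subset_Icc_self (hin ξ hξc)) hξc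
    rw [h0, zero_add, abs_of_pos G.fisher_pos] at this
    linarith [G.fisher_pos]
  obtain ⟨hcl, hθ0⟩ := hcrit θ hθ hmax'
  refine ⟨θ, hin θ hcl, hcl, ?_, hp.abs_curvature_add_fisher_le hZ hS hθ hcl,
    hp.abs_score_sq_sub_fisher_le hZ hS hθ hcl⟩
  intro φ hφ hne
  refine lt_of_le_of_ne (hmax' φ hφ) fun heq => ?_
  obtain ⟨hcl', hφ0⟩ := hcrit φ hφ fun ψ hψ => heq ▸ hmax' ψ hψ
  rcases lt_or_gt_of_ne hne with h | h
  · exact hno φ θ h hcl' hcl hφ0 hθ0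
  · exact hno θ φ h hcl hcl' hθ0 hφ0

end Contaminated

end PeakModel

/-! ### Asymptotics of the estimator for a contaminated peak -/

namespace PeakModel

variable {G : PeakModel}

/-- The probability measure on the window with unnormalized density `p`. -/
noncomputable def windowMeasure (G : PeakModel) (p : ℝ → ℝ) : Measure ℝ :=
  (volume.restrict (Set.Icc G.l G.u)).withDensity
    fun x => ENNReal.ofReal (p x / ∫ y in Set.Icc G.l G.u, p y)

lemma setIntegral_Icc (f : ℝ → ℝ) : ∫ x in Set.Icc G.l G.u, f x = ∫ x in G.l..G.u, f x := by
  rw [integral_Icc_eq_integral_Ioc, intervalIntegral.integral_of_le G.l_lt_u.le]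

namespace Contaminated

variable {p : ℝ → ℝ} {η : ℝ}

lemma integral_pos (hp : G.Contaminated p η) : 0 < ∫ x in G.l..G.u, p x := by
  refine lt_of_lt_of_le (G.Z_pos G.θ₀) ?_
  exact intervalIntegral.integral_mono_on G.l_lt_u.le ((G.continuous_q _).intervalIntegrable _ _)
    hp.intervalIntegrable hp.le

lemma integral_le (hp : G.Contaminated p η) :
    ∫ x in G.l..G.u, p x ≤ G.Z G.θ₀ + η * (G.u - G.l) := by
  have := hp.abs_integral_sub_le (h := fun _ => 1) continuous_const (C := 1) (by simp)
  simp only [mul_one] at this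
  have h2 := (_root_.abs_le.mp this).2
  change _ - G.Z G.θ₀ ≤ _ at h2
  linarith

lemma integral_windowMeasure (hp : G.Contaminated p η) (h : ℝ → ℝ) :
    ∫ x, h x ∂(G.windowMeasure p) = (∫ x in G.l..G.u, p x * h x) / ∫ x in G.l..G.u, p x := by
  have hA := hp.integral_pos
  unfold windowMeasure
  have hm : Measurable fun x => ENNReal.ofReal (p x / ∫ y in Set.Icc G.l G.u, p y) :=
    (hp.meas.div_const _).ennreal_ofReal
  rw [integral_withDensity_eq_integral_toReal_smul hm (by simp), setIntegral_Icc p,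
    ← intervalIntegral.integral_div,
    ← setIntegral_Icc (G := G) fun x => p x * h x / ∫ x in G.l..G.u, p x]
  refine setIntegral_congr_fun (measurableSet_Icc (a := G.l) (b := G.u)) fun x hx => ?_
  simp only [smul_eq_mul]
  rw [ENNReal.toReal_ofReal (div_nonneg (hp.pos hx).le hA.le)]
  ring

lemma isProbabilityMeasure (hp : G.Contaminated p η) :
    IsProbabilityMeasure (G.windowMeasure p) := by
  have hA := hp.integral_pos
  constructor
  unfold windowMeasure
  rw [withDensity_apply _ MeasurableSet.univ, Measure.restrict_univ, setIntegral_Icc,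
    ← ofReal_integral_eq_lintegral_ofReal]
  · rw [setIntegral_Icc, intervalIntegral.integral_div, div_self hA.ne', ENNReal.ofReal_one]
  · have := hp.intervalIntegrable.div_const (∫ x in G.l..G.u, p x)
    rwa [intervalIntegrable_iff_integrableOn_Icc_of_le G.l_lt_u.le] at this
  · exact (ae_restrict_mem measurableSet_Icc).mono fun x hx => div_nonneg (hp.pos hx).le hA.le

lemma ae_mem (p : ℝ → ℝ) : ∀ᵐ x ∂(G.windowMeasure p), x ∈ Set.Icc G.l G.u :=
  (withDensity_absolutelyContinuous _ _).ae_le (ae_restrict_mem measurableSet_Icc)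

lemma regularContrast (hp : G.Contaminated p η) {θ : ℝ} (hθ : θ ∈ Set.Ioo G.l G.u)
    (hmax : ∀ φ ∈ Set.Icc G.l G.u, φ ≠ θ →
      ∫ x in G.l..G.u, p x * G.m x φ < ∫ x in G.l..G.u, p x * G.m x θ)
    (hneg : ∫ x in G.l..G.u, p x * G.m₂ x θ < 0) :
    ∃ B, RegularContrast (G.windowMeasure p) (Set.Icc G.l G.u) G.l G.u θ B G.m G.m₁ G.m₂ := by
  obtain ⟨B, hB⟩ := G.exists_abs_m_le
  have hA := hp.integral_pos
  have h1 : B ≤ max (max B (2 * G.R / G.σ)) (max (3 * G.R ^ 2 / G.σ ^ 2)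
      (8 * G.R ^ 3 / G.σ ^ 3)) := (le_max_left _ _).trans (le_max_left _ _)
  have h2 : 2 * G.R / G.σ ≤ max (max B (2 * G.R / G.σ)) (max (3 * G.R ^ 2 / G.σ ^ 2)
      (8 * G.R ^ 3 / G.σ ^ 3)) := (le_max_right _ _).trans (le_max_left _ _)
  have h3 : 3 * G.R ^ 2 / G.σ ^ 2 ≤ max (max B (2 * G.R / G.σ)) (max (3 * G.R ^ 2 / G.σ ^ 2)
      (8 * G.R ^ 3 / G.σ ^ 3)) := (le_max_left _ _).trans (le_max_right _ _)
  have h4 : 8 * G.R ^ 3 / G.σ ^ 3 ≤ max (max B (2 * G.R / G.σ)) (max (3 * G.R ^ 2 / G.σ ^ 2)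
      (8 * G.R ^ 3 / G.σ ^ 3)) := (le_max_right _ _).trans (le_max_right _ _)
  refine ⟨_, ⟨ae_mem p, fun φ => (G.continuous_m φ).measurable,
    fun φ => (G.continuous_m₁ φ).measurable, fun φ => (G.continuous_m₂ φ).measurable,
    fun x _ φ _ => G.hasDerivAt_m x φ, fun x _ φ _ => G.hasDerivAt_m₁ x φ,
    fun x hx φ hφ => (hB x hx φ hφ).trans h1, fun x hx φ hφ => (G.abs_m₁_le hx hφ).trans h2,
    fun x hx φ hφ => (G.abs_m₂_le hx hφ).trans h3,
    fun x hx φ hφ φ' hφ' => (G.abs_m₂_sub_le hx hφ hφ').trans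
      (mul_le_mul_of_nonneg_right h4 (abs_nonneg _)), hθ, fun φ hφ hne => ?_, ?_⟩⟩
  · rw [hp.integral_windowMeasure, hp.integral_windowMeasure]
    exact div_lt_div_of_pos_right (hmax φ hφ hne) hA
  · rw [hp.integral_windowMeasure]
    exact div_neg_of_neg_of_pos hneg hA

/-- Asymptotics of the maximum likelihood estimator of the centre of a contaminated peak. -/
theorem tendsto_mean_and_variance (hp : G.Contaminated p η) (hZ : G.Z G.θ₀ ≤ 2)
    (hS : 192 * (η * (G.u - G.l)) * G.R ^ 4 ≤ (gapConst * G.snr) ^ 2)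
    {est : (M : ℕ) → (Fin M → ℝ) → ℝ} (hmeas : ∀ M, Measurable (est M))
    (hmem : ∀ M (x : Fin M → ℝ), (∀ j, x j ∈ Set.Icc G.l G.u) → est M x ∈ Set.Icc G.l G.u)
    (hmax : ∀ M (x : Fin M → ℝ), (∀ j, x j ∈ Set.Icc G.l G.u) → ∀ φ ∈ Set.Icc G.l G.u,
      empiricalMean (fun y => G.m y φ) x ≤ empiricalMean (fun y => G.m y (est M x)) x) :
    ∃ θ v : ℝ, |θ - G.θ₀| ≤ G.σ * shift G η ∧ 0 < v ∧
      v ≤ 6 * (∫ x in G.l..G.u, p x) * G.σ ^ 2 / (gapConst * G.snr) ∧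
      Tendsto (fun M : ℕ => ∫ x, est M x ∂(Measure.pi fun _ : Fin M => G.windowMeasure p)) atTop
        (𝓝 θ) ∧
      Tendsto (fun M : ℕ => (M : ℝ) *
        ProbabilityTheory.variance (est M) (Measure.pi fun _ : Fin M => G.windowMeasure p)) atTop
        (𝓝 v) := by
  obtain ⟨θ, hθ, hcl, hθmax, hcurv, hscore⟩ := hp.exists_strict_max hZ hS
  have := hp.isProbabilityMeasure
  have hI := G.fisher_pos
  have hA := hp.integral_pos
  have hc : 0 < gapConst * G.snr := mul_pos gapConst_pos G.snr_pos
  have hσ := G.hσ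
  rw [_root_.abs_le] at hcurv hscore
  have hneg : ∫ x in G.l..G.u, p x * G.m₂ x θ < 0 := by linarith [hcurv.2]
  obtain ⟨B, hreg⟩ := hp.regularContrast hθ hθmax hneg
  obtain ⟨hmean, hvar⟩ := hreg.tendsto_mean_and_variance hmeas hmem hmax
  set A := ∫ x in G.l..G.u, p x with hAdef
  set J := ∫ x in G.l..G.u, p x * G.m₁ x θ ^ 2 with hJ
  set D := ∫ x in G.l..G.u, p x * G.m₂ x θ with hD
  have hv : (∫ x, G.m₁ x θ ^ 2 ∂(G.windowMeasure p)) / (∫ x, G.m₂ x θ ∂(G.windowMeasure p)) ^ 2 =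
      J * A / D ^ 2 := by
    have hD0 := hneg.ne
    rw [hp.integral_windowMeasure, hp.integral_windowMeasure, ← hJ, ← hD, ← hAdef]
    field_simp
  rw [hv] at hvar
  have hJ0 : 0 < J := by linarith [hscore.1]
  refine ⟨θ, J * A / D ^ 2, hcl, div_pos (mul_pos hJ0 hA) (sq_pos_of_neg hneg), ?_, hmean,
    hvar⟩
  have hD2 : G.fisher ^ 2 / 4 ≤ D ^ 2 := by nlinarith [hcurv.2]
  have hF := G.snr_le_fisher
  -- The sandwich variance `J A / D²`: `J` is at most three halves and `|D|` at least one half of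
  -- the Fisher information.
  calc J * A / D ^ 2 ≤ (3 / 2 * G.fisher * A) / (G.fisher ^ 2 / 4) := by
        refine div_le_div₀ (by positivity) ?_ (by positivity) hD2
        exact mul_le_mul_of_nonneg_right (by linarith [hscore.2]) hA.le
    _ = 6 * A / G.fisher := by field_simp; ring
    _ ≤ 6 * A / (gapConst * G.snr / G.σ ^ 2) :=
        div_le_div_of_nonneg_left (by positivity) (by positivity) hF
    _ = 6 * A * G.σ ^ 2 / (gapConst * G.snr) := by field_simp

end Contaminated

end PeakModel

/-! ### The periodic Gaussian kernel -/

section Kernel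

variable {σ : ℝ}

/-- The normalization constant of the Gaussian kernel. -/
noncomputable def kernelMass (σ : ℝ) : ℝ := ∫ y in (-π)..π, Real.exp (-y ^ 2 / (2 * σ ^ 2))

lemma kernelMass_eq (σ : ℝ) : kernelMass σ = ∫ y in (-π)..π, bump σ y 0 := by
  unfold kernelMass bump
  simp

lemma kernelMass_le (hσ : 0 < σ) : kernelMass σ ≤ 3 * σ := by
  rw [kernelMass_eq]
  exact integral_bump_le hσ (by linarith [Real.pi_pos]) 0

lemma le_kernelMass (hσ : 0 < σ) (hσπ : σ ≤ π) : σ / 2 ≤ kernelMass σ := by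
  rw [kernelMass_eq]
  exact le_integral_bump hσ (by linarith) ⟨by linarith [Real.pi_pos], Real.pi_pos.le⟩

lemma kernelMass_pos (hσ : 0 < σ) (hσπ : σ ≤ π) : 0 < kernelMass σ :=
  lt_of_lt_of_le (by linarith) (le_kernelMass hσ hσπ)

lemma kernelMass_nonneg (σ : ℝ) : 0 ≤ kernelMass σ :=
  intervalIntegral.integral_nonneg (by linarith [Real.pi_pos]) fun _ _ => (Real.exp_pos _).le

lemma integral_bump_le_kernelMass (σ : ℝ) {l u φ : ℝ} (hl : -π ≤ l - φ) (hlu : l ≤ u)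
    (hu : u - φ ≤ π) : ∫ x in l..u, bump σ x φ ≤ kernelMass σ := by
  have h1 : ∫ x in l..u, bump σ x φ = ∫ x in (l - φ)..(u - φ), bump σ x 0 := by
    rw [← intervalIntegral.integral_comp_sub_right (fun x => bump σ x 0)]
    unfold bump
    simp
  rw [h1, kernelMass_eq]
  exact integral_le_of_subinterval (continuous_bump σ 0) (fun x => (bump_pos σ x 0).le) hl
    (by linarith) hu

lemma gaussianKernel_sub_eq (σ : ℝ) {x φ : ℝ} (h : |x - φ| ≤ π) :
    gaussianKernel σ (x - φ) = bump σ x φ / kernelMass σ := by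
  have key : (toIocMod Real.two_pi_pos (-π) (x - φ)) ^ 2 = (x - φ) ^ 2 := by
    have h' := abs_le.mp h
    -- The representatives lie in `(-π, π]`, so `-π` is sent to `π`; the square is the same.
    rcases h'.1.eq_or_lt with h1 | h1
    · rw [← h1, toIocMod_apply_left]
      ring
    · rw [(toIocMod_eq_self Real.two_pi_pos).mpr ⟨h1, by linarith [h'.2]⟩]
  unfold gaussianKernel bump kernelMass
  rw [key]

lemma gaussianKernel_nonneg (σ x : ℝ) : 0 ≤ gaussianKernel σ x :=
  div_nonneg (Real.exp_pos _).le (kernelMass_nonneg σ)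

lemma gaussianKernel_le (σ : ℝ) {x δ : ℝ} (hδ : 0 ≤ δ)
    (h : δ ≤ |toIocMod Real.two_pi_pos (-π) x|) :
    gaussianKernel σ x ≤ Real.exp (-δ ^ 2 / (2 * σ ^ 2)) / kernelMass σ := by
  refine div_le_div_of_nonneg_right (Real.exp_le_exp.mpr ?_) (kernelMass_nonneg σ)
  refine div_le_div_of_nonneg_right (neg_le_neg ?_) (by positivity)
  rw [← sq_abs (toIocMod Real.two_pi_pos (-π) x)]
  exact pow_le_pow_left₀ hδ h 2

lemma measurable_gaussianKernel (σ : ℝ) : Measurable (gaussianKernel σ) := by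
  have h : Measurable fun x : ℝ => toIocMod Real.two_pi_pos (-π) x := by
    have h1 : (fun x : ℝ => toIocMod Real.two_pi_pos (-π) x) =
        fun x => x + (⌊(-π + 2 * π - x) / (2 * π)⌋ : ℝ) * (2 * π) := by
      ext x
      rw [← self_sub_toIocDiv_mul, toIocDiv_eq_neg_floor]
      push_cast
      ring
    rw [h1]
    fun_prop
  unfold gaussianKernel
  fun_prop

end Kernel

/-! ### Weights, and distance of the other phases from the window -/

section Input

variable {ι : Type u} {H : Type v} [Fintype ι] [NormedAddCommGroup H] [InnerProductSpace ℂ H]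

lemma Input.weight_nonneg (S : Input ι H) (j : ι) : 0 ≤ S.weight j := sq_nonneg _

lemma Input.sum_weight (S : Input ι H) : ∑ j, S.weight j = 1 := by
  unfold Input.weight
  rw [S.eigvec.sum_sq_norm_inner_right, S.norm_ψ, one_pow]

lemma Input.measurable_noisyDensity (S : Input ι H) (F σ : ℝ) :
    Measurable (S.noisyDensity F σ) := by
  have := measurable_gaussianKernel σ
  unfold Input.noisyDensity
  fun_prop

/-- The phases other than `φ_{j₀}` keep a distance `Δ / 6` on the circle from the window. -/
lemma le_abs_toIocMod {x φ φ₀ guess Δ : ℝ} (hx : x ∈ filterInterval guess Δ)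
    (hD : filterInterval guess Δ ⊆ Set.Ico (Δ / 6) (2 * π - Δ / 6))
    (hφ : φ ∈ Set.Ico 0 (2 * π)) (hsep : Δ < |φ - φ₀|) (hguess : |φ₀ - guess| < Δ / 3) :
    Δ / 6 ≤ |toIocMod Real.two_pi_pos (-π) (x - φ)| := by
  by_contra hcon
  rw [not_le] at hcon
  have hxD := hD hx
  have hr := abs_lt.mp hcon
  have hz := toIocMod_add_toIocDiv_mul Real.two_pi_pos (-π) (x - φ)
  set r := toIocMod Real.two_pi_pos (-π) (x - φ) with hrdef
  set n : ℤ := toIocDiv Real.two_pi_pos (-π) (x - φ) with hn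
  have hπ := Real.pi_pos
  -- The buffer of `Δ / 6` at both ends of the circle excludes winding, so `n = 0` and `|x - φ| < Δ
  -- / 6`.
  have h1 : (n : ℝ) * (2 * π) < 1 * (2 * π) := by linarith [hxD.2, hφ.1, hr.1]
  have h2 : -1 * (2 * π) < (n : ℝ) * (2 * π) := by linarith [hxD.1, hφ.2, hr.2]
  have h1' : (n : ℝ) < 1 := lt_of_mul_lt_mul_right h1 (by linarith)
  have h2' : (-1 : ℝ) < n := lt_of_mul_lt_mul_right h2 (by linarith)
  have hn0 : n = 0 := by
    have h3 : n < 1 := by exact_mod_cast h1'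
    have h4 : -1 < n := by exact_mod_cast h2'
    omega
  rw [hn0, Int.cast_zero, zero_mul, add_zero] at hz
  have hg := abs_lt.mp hguess
  -- The distances from `φ` to `x`, to the guess and to `φ₀` add up to less than `Δ / 6 + Δ / 2 + Δ
  -- / 3 = Δ`.
  rcases lt_abs.mp hsep with h | h <;> linarith [hx.1, hx.2]

end Input

/-! ### The target phase as a peak model -/

/-- The peak that the target phase contributes to the filtered distribution. -/
noncomputable def targetPeak {F a₀ σ guess Δ φ₀ : ℝ} (hF : F ∈ Set.Ioo (0 : ℝ) 1) (ha : 0 < a₀)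
    (hσ : 0 < σ) (hR : 48 ≤ Δ / σ) (hΔ : Δ ≤ π) (hguess : |φ₀ - guess| < Δ / 3) : PeakModel where
  α := F * a₀ / kernelMass σ
  β := (1 - F) * (1 / (2 * π))
  σ := σ
  l := guess - Δ / 2
  u := guess + Δ / 2
  θ₀ := φ₀
  hα := by
    have h : 48 * σ ≤ Δ := by rwa [le_div_iff₀ hσ] at hR
    exact div_pos (mul_pos hF.1 ha) (kernelMass_pos hσ (by linarith))
  hβ := mul_pos (by linarith [hF.2]) (by have := Real.pi_pos; positivity)
  hσ := hσ
  hR := by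
    have h : guess + Δ / 2 - (guess - Δ / 2) = Δ := by ring
    rwa [h]
  hl := by linarith [(abs_lt.mp hguess).1]
  hu := by linarith [(abs_lt.mp hguess).2]

section TargetPeak

variable {F a₀ σ guess Δ φ₀ : ℝ} (hF : F ∈ Set.Ioo (0 : ℝ) 1) (ha : 0 < a₀)
    (hσ : 0 < σ) (hR : 48 ≤ Δ / σ) (hΔ : Δ ≤ π) (hguess : |φ₀ - guess| < Δ / 3)

include hσ hR in
lemma le_of_ratio : 48 * σ ≤ Δ := by rwa [le_div_iff₀ hσ] at hR

include hΔ in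
lemma abs_sub_le_pi {x φ : ℝ} (hx : x ∈ filterInterval guess Δ) (hφ : φ ∈ filterInterval guess Δ) :
    |x - φ| ≤ π := by
  have := hx.1
  have := hx.2
  have := hφ.1
  have := hφ.2
  rw [abs_le]
  constructor <;> linarith

lemma targetPeak_q {x φ : ℝ} (hx : x ∈ filterInterval guess Δ) (hφ : φ ∈ filterInterval guess Δ) :
    F * a₀ * gaussianKernel σ (x - φ) + (1 - F) * (1 / (2 * π)) =
      (targetPeak hF ha hσ hR hΔ hguess).q x φ := by
  rw [gaussianKernel_sub_eq σ (abs_sub_le_pi hΔ hx hφ)]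
  simp only [PeakModel.q, targetPeak]
  ring

lemma targetPeak_R : (targetPeak hF ha hσ hR hΔ hguess).R = Δ / σ := by
  simp only [PeakModel.R, targetPeak]
  ring

lemma log_modelDensity {x φ : ℝ} (hx : x ∈ filterInterval guess Δ)
    (hφ : φ ∈ filterInterval guess Δ) :
    Real.log (modelDensity F a₀ σ (filterInterval guess Δ) x φ) =
      (targetPeak hF ha hσ hR hΔ hguess).m x φ := by
  set G := targetPeak hF ha hσ hR hΔ hguess with hG
  have hΔ0 : 0 < Δ := by linarith [le_of_ratio hσ hR]
  have hZ : F * a₀ * (∫ y in filterInterval guess Δ, gaussianKernel σ (y - φ)) +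
      (1 - F) * (volume.real (filterInterval guess Δ) / (2 * π)) = G.Z φ := by
    have h1 : ∫ y in filterInterval guess Δ, gaussianKernel σ (y - φ) =
        (∫ y in G.l..G.u, bump σ y φ) / kernelMass σ := by
      rw [← intervalIntegral.integral_div, ← PeakModel.setIntegral_Icc (G := G)]
      exact setIntegral_congr_fun measurableSet_Icc fun y hy =>
        gaussianKernel_sub_eq σ (abs_sub_le_pi hΔ hy hφ)
    have h2 : volume.real (filterInterval guess Δ) = Δ := by
      unfold filterInterval
      rw [Real.volume_real_Icc_of_le (by linarith)]
      ring
    rw [h1, h2, G.integral_q]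
    simp only [hG, targetPeak]
    ring
  unfold modelDensity PeakModel.m
  rw [hZ, targetPeak_q hF ha hσ hR hΔ hguess hx hφ, ← hG,
    Real.log_div (G.q_pos x φ).ne' (G.Z_pos φ).ne']

lemma targetPeak_α_mul_σ_ge : F * a₀ / 3 ≤ (targetPeak hF ha hσ hR hΔ hguess).α * σ := by
  have h := le_of_ratio hσ hR
  have hN := kernelMass_pos hσ (by linarith)
  have hN' := kernelMass_le hσ
  have hFa := mul_pos hF.1 ha
  simp only [targetPeak]
  rw [div_mul_eq_mul_div, div_le_div_iff₀ (by norm_num) hN]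
  nlinarith

lemma targetPeak_α_mul_σ_le : (targetPeak hF ha hσ hR hΔ hguess).α * σ ≤ 2 * (F * a₀) := by
  have h := le_of_ratio hσ hR
  have hN := kernelMass_pos hσ (by linarith)
  have hN' := le_kernelMass hσ (by linarith)
  have hFa := mul_pos hF.1 ha
  simp only [targetPeak]
  rw [div_mul_eq_mul_div, div_le_iff₀ hN]
  nlinarith

include hF in
lemma floor_le : (1 - F) * (1 / (2 * π)) ≤ 1 / 6 := by
  have h1 : 1 / (2 * π) ≤ 1 / 6 :=
    one_div_le_one_div_of_le (by norm_num) (by linarith [Real.pi_gt_three])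
  have h2 : 0 ≤ 1 / (2 * π) := by have := Real.pi_pos; positivity
  nlinarith [hF.1, hF.2]

include ha in
lemma targetPeak_Z_le (ha1 : a₀ ≤ 1) : (targetPeak hF ha hσ hR hΔ hguess).Z φ₀ ≤ 2 := by
  set G := targetPeak hF ha hσ hR hΔ hguess with hG
  have h := le_of_ratio hσ hR
  have hN := kernelMass_pos hσ (by linarith)
  have hg := abs_lt.mp hguess
  have h1 : ∫ x in G.l..G.u, bump σ x φ₀ ≤ kernelMass σ :=
    integral_bump_le_kernelMass σ (by simp only [hG, targetPeak]; linarith) G.l_lt_u.le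
      (by simp only [hG, targetPeak]; linarith)
  have h2 : G.α * ∫ x in G.l..G.u, bump σ x φ₀ ≤ 1 := by
    calc G.α * ∫ x in G.l..G.u, bump σ x φ₀ ≤ G.α * kernelMass σ :=
          mul_le_mul_of_nonneg_left h1 G.hα.le
      _ = F * a₀ := by
          simp only [hG, targetPeak]
          field_simp
      _ ≤ 1 := by nlinarith [hF.1, hF.2]
  have h3 : G.β * (G.u - G.l) ≤ 1 := by
    have hb : G.β ≤ 1 / 6 := floor_le hF
    have hl : G.u - G.l ≤ 4 := by
      simp only [hG, targetPeak]
      linarith [Real.pi_lt_four]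
    nlinarith [G.hβ, G.length_pos]
  rw [G.integral_q]
  exact (add_le_add h2 h3).trans (by norm_num)

include ha in
-- Unconditional bound: `snr = (ασ)² / (ασ + βσ)` with `ασ` comparable to `F a₀` and the denominator
-- at most `3`. It is quadratic in `F a₀` and serves for the smallness condition, the bias and the
-- number of calls.
lemma le_targetPeak_snr (ha1 : a₀ ≤ 1) :
    (F * a₀) ^ 2 / 27 ≤ (targetPeak hF ha hσ hR hΔ hguess).snr := by
  set G := targetPeak hF ha hσ hR hΔ hguess with hG
  have h := le_of_ratio hσ hR
  have h1 := targetPeak_α_mul_σ_ge hF ha hσ hR hΔ hguess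
  have h2 := targetPeak_α_mul_σ_le hF ha hσ hR hΔ hguess
  rw [← hG] at h1 h2
  have hb : G.β ≤ 1 / 6 := floor_le hF
  have hFa := mul_pos hF.1 ha
  have hα := G.hα
  have hβ := G.hβ
  have e1 : G.snr = (G.α * σ) ^ 2 / (G.α * σ + G.β * σ) := by
    unfold PeakModel.snr
    have : G.σ = σ := rfl
    rw [this]
    field_simp
  have h3 : G.β * σ ≤ 1 := by nlinarith [Real.pi_lt_four]
  have h4 : F * a₀ ≤ 1 := by nlinarith [hF.1, hF.2]
  rw [e1]
  calc (F * a₀) ^ 2 / 27 = (F * a₀ / 3) ^ 2 / 3 := by ring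
    _ ≤ (G.α * σ) ^ 2 / (G.α * σ + G.β * σ) :=
        div_le_div₀ (by positivity) (pow_le_pow_left₀ (by positivity) h1 2) (by positivity)
          (by linarith)

/-- For a peak this narrow `α ≥ 1/3 > β`, so `snr ≥ ασ / 2` is linear in `F a₀`. This improvement
serves for the number of samples. -/
lemma le_targetPeak_snr_of_le (hs : σ ≤ F * a₀) :
    F * a₀ / 6 ≤ (targetPeak hF ha hσ hR hΔ hguess).snr := by
  set G := targetPeak hF ha hσ hR hΔ hguess with hG
  have h1 := targetPeak_α_mul_σ_ge hF ha hσ hR hΔ hguess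
  rw [← hG] at h1
  have hb : G.β ≤ 1 / 6 := floor_le hF
  have hα := G.hα
  have hβ := G.hβ
  have hβα : G.β ≤ G.α := by
    refine le_of_mul_le_mul_right ?_ hσ
    nlinarith
  have e1 : G.snr = (G.α * σ) * G.α / (G.α + G.β) := by
    unfold PeakModel.snr
    have : G.σ = σ := rfl
    rw [this]
    ring
  rw [e1, le_div_iff₀ (by positivity)]
  nlinarith

end TargetPeak

section Contamination

variable {ι : Type u} {H : Type v} [Fintype ι] [NormedAddCommGroup H] [InnerProductSpace ℂ H]
  {F a₀ σ guess Δ : ℝ}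

/-- The filtered distribution is that of the target peak, contaminated by the tails of the peaks
of the other phases. -/
lemma Input.contaminated_noisyDensity (S : Input ι H) {j₀ : ι} (hF : F ∈ Set.Ioo (0 : ℝ) 1)
    (ha : 0 < a₀) (hσ : 0 < σ) (hR : 48 ≤ Δ / σ) (hΔ : Δ ≤ π)
    (hguess : |S.phase j₀ - guess| < Δ / 3) (hw : S.weight j₀ = a₀)
    (hsep : ∀ j, j ≠ j₀ → Δ < |S.phase j - S.phase j₀|)
    (hD : filterInterval guess Δ ⊆ Set.Ico (Δ / 6) (2 * π - Δ / 6)) :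
    (targetPeak hF ha hσ hR hΔ hguess).Contaminated (S.noisyDensity F σ)
      (F * (Real.exp (-(Δ / 6) ^ 2 / (2 * σ ^ 2)) / kernelMass σ)) := by
  classical
  set G := targetPeak hF ha hσ hR hΔ hguess with hG
  have hΔ0 : 0 < Δ := by linarith [le_of_ratio hσ hR]
  set E := Real.exp (-(Δ / 6) ^ 2 / (2 * σ ^ 2)) / kernelMass σ with hE
  have hφ₀ : S.phase j₀ ∈ filterInterval guess Δ := by
    have hg := abs_lt.mp hguess
    exact ⟨by linarith, by linarith⟩
  have hsplit : ∀ x ∈ filterInterval guess Δ, S.noisyDensity F σ x = G.q x G.θ₀ +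
      F * ∑ j ∈ Finset.univ.erase j₀, S.weight j * gaussianKernel σ (x - S.phase j) := by
    intro x hx
    have h1 : G.q x G.θ₀ = _ := (targetPeak_q hF ha hσ hR hΔ hguess hx hφ₀).symm
    unfold Input.noisyDensity
    rw [h1, ← Finset.add_sum_erase _ _ (Finset.mem_univ j₀), hw]
    ring
  have hE0 : 0 ≤ E := div_nonneg (Real.exp_pos _).le (kernelMass_nonneg σ)
  refine ⟨S.measurable_noisyDensity F σ, fun x hx => ?_, fun x hx => ?_⟩
  · rw [hsplit x hx]
    have : 0 ≤ ∑ j ∈ Finset.univ.erase j₀, S.weight j * gaussianKernel σ (x - S.phase j) :=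
      Finset.sum_nonneg fun j _ => mul_nonneg (S.weight_nonneg j) (gaussianKernel_nonneg _ _)
    linarith [mul_nonneg hF.1.le this]
  · rw [hsplit x hx]
    have h1 : ∑ j ∈ Finset.univ.erase j₀, S.weight j * gaussianKernel σ (x - S.phase j) ≤
        ∑ j ∈ Finset.univ.erase j₀, S.weight j * E := by
      refine Finset.sum_le_sum fun j hj => mul_le_mul_of_nonneg_left ?_ (S.weight_nonneg j)
      exact gaussianKernel_le σ (by positivity) (le_abs_toIocMod hx hD (S.phase_mem j)
        (hsep j (Finset.ne_of_mem_erase hj)) hguess)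
    have h2 : ∑ j ∈ Finset.univ.erase j₀, S.weight j ≤ 1 := by
      rw [← S.sum_weight]
      exact Finset.sum_le_sum_of_subset_of_nonneg (Finset.erase_subset _ _)
        fun j _ _ => S.weight_nonneg j
    rw [← Finset.sum_mul] at h1
    have h3 := mul_le_mul_of_nonneg_right h2 hE0
    have h4 := mul_le_mul_of_nonneg_left (h1.trans h3) hF.1.le
    linarith

end Contamination

/-! ### Gaussian tails against the logarithmic condition on `t` -/

lemma exists_ratio_bound (K : ℝ) :
    ∃ k : ℝ, 48 ≤ k ∧ ∀ R : ℝ, k ≤ R → K * R ^ 5 * Real.exp (-R ^ 2 / 144) ≤ 1 := by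
  have h := (Real.tendsto_pow_mul_exp_neg_atTop_nhds_zero 5).const_mul |K|
  rw [mul_zero] at h
  obtain ⟨k₀, hk₀⟩ := eventually_atTop.mp (h.eventually_lt_const one_pos)
  -- From `144` on, `R² / 144 ≥ R`, so the Gaussian is dominated by `exp (-R)`.
  refine ⟨max k₀ 144, le_trans (by norm_num) (le_max_right _ _), fun R hR => ?_⟩
  have h1 := hk₀ R ((le_max_left _ _).trans hR)
  have h2 : 144 ≤ R := (le_max_right _ _).trans hR
  have h3 : Real.exp (-R ^ 2 / 144) ≤ Real.exp (-R) := Real.exp_le_exp.mpr (by nlinarith)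
  calc K * R ^ 5 * Real.exp (-R ^ 2 / 144) ≤ |K| * R ^ 5 * Real.exp (-R) := by
        gcongr
        exact le_abs_self K
    _ = |K| * (R ^ 5 * Real.exp (-R)) := by ring
    _ ≤ 1 := h1.le

/-- The exponent is split into halves: one absorbs `K * R ^ 5`, the other gives `X⁻³` because `R² ≥
432 log X` and `432 = 3 * 144`. -/
lemma tail_le_of_sqrt_log_le {K k R X : ℝ} (hk48 : 48 ≤ k)
    (hk : ∀ R : ℝ, k ≤ R → K * R ^ 5 * Real.exp (-R ^ 2 / 144) ≤ 1) (hX : 3 ≤ X)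
    (hR : k * √(Real.log X) ≤ R) :
    k ≤ R ∧ K * R ^ 5 * Real.exp (-R ^ 2 / 72) ≤ (X ^ 3)⁻¹ := by
  have hX0 : 0 < X := by linarith
  have hlog : 1 ≤ Real.log X := by
    rw [Real.le_log_iff_exp_le hX0]
    linarith [Real.exp_one_lt_d9]
  have hs : 1 ≤ √(Real.log X) := Real.one_le_sqrt.mpr hlog
  have hkR : k ≤ R := by nlinarith
  refine ⟨hkR, ?_⟩
  have h1 : 432 * Real.log X ≤ R ^ 2 := by
    have h2 := pow_le_pow_left₀ (by positivity) hR 2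
    rw [mul_pow, Real.sq_sqrt (by linarith)] at h2
    have h3 : 432 ≤ k ^ 2 := by nlinarith
    nlinarith
  have h3 : Real.exp (-R ^ 2 / 144) ≤ (X ^ 3)⁻¹ := by
    have h4 : (X ^ 3)⁻¹ = Real.exp (-(3 * Real.log X)) := by
      rw [Real.exp_neg, ← Real.exp_log (pow_pos hX0 3), Real.log_pow]
      norm_num
    rw [h4]
    exact Real.exp_le_exp.mpr (by linarith)
  have h5 : Real.exp (-R ^ 2 / 72) = Real.exp (-R ^ 2 / 144) * Real.exp (-R ^ 2 / 144) := by
    rw [← Real.exp_add]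
    ring_nf
  rw [h5, ← mul_assoc]
  calc K * R ^ 5 * Real.exp (-R ^ 2 / 144) * Real.exp (-R ^ 2 / 144) ≤ 1 * (X ^ 3)⁻¹ :=
        mul_le_mul (hk R hkR) h3 (Real.exp_pos _).le zero_le_one
    _ = (X ^ 3)⁻¹ := one_mul _

/-- The constant in the condition that the contamination be small. -/
noncomputable def tailConst : ℝ := 384 * 729 / PeakModel.gapConst ^ 2

lemma le_tailConst : 216 / PeakModel.gapConst ≤ tailConst := by
  have h1 := PeakModel.gapConst_pos
  have h2 := PeakModel.gapConst_le
  unfold tailConst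
  rw [div_le_div_iff₀ h1 (by positivity)]
  nlinarith

lemma tailConst_pos : 0 < tailConst := by
  have := PeakModel.gapConst_pos
  unfold tailConst
  positivity

/-! ### Asymptotic bias and variance of the fMPE -/

section Limits

variable {ι : Type u} {H : Type v} [Fintype ι] [NormedAddCommGroup H] [InnerProductSpace ℂ H]
  {F a₀ σ guess Δ : ℝ}

lemma memLp_of_mem_Icc {P : Measure ℝ} [IsProbabilityMeasure P] {l u : ℝ}
    (hP : ∀ᵐ x ∂P, x ∈ Set.Icc l u) {M : ℕ} {f : (Fin M → ℝ) → ℝ} (hf : Measurable f)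
    (hmem : ∀ x : Fin M → ℝ, (∀ j, x j ∈ Set.Icc l u) → f x ∈ Set.Icc l u) :
    MemLp f 2 (Measure.pi fun _ : Fin M => P) :=
  MemLp.of_bound hf.aestronglyMeasurable (max |l| |u|)
    ((ae_forall_mem_pi hP M).mono fun x hx => abs_le_max_abs_abs (hmem x hx).1 (hmem x hx).2)

lemma integral_sq_sub_eq {Ω : Type*} [MeasurableSpace Ω] {μ : Measure Ω} [IsProbabilityMeasure μ]
    {f : Ω → ℝ} (hf : MemLp f 2 μ) (θ : ℝ) :
    ∫ x, (f x - θ) ^ 2 ∂μ = ProbabilityTheory.variance f μ + (∫ x, f x ∂μ - θ) ^ 2 := by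
  rw [← ProbabilityTheory.variance_sub_const hf.aestronglyMeasurable θ,
    ProbabilityTheory.variance_eq_sub (X := fun x => f x - θ) (hf.sub (memLp_const θ))]
  simp only [Pi.pow_apply]
  rw [integral_sub (hf.integrable (by norm_num)) (integrable_const _)]
  simp

/-- Existence and size of the asymptotic bias and variance of the fMPE. -/
theorem Input.exists_limits (S : Input ι H) {j₀ : ι} (hF : F ∈ Set.Ioo (0 : ℝ) 1)
    (ha : a₀ ∈ Set.Ioc (0 : ℝ) 1) (hσ : 0 < σ) (hR : 48 ≤ Δ / σ) (hΔ : Δ ≤ π)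
    (hguess : |S.phase j₀ - guess| < Δ / 3) (hw : S.weight j₀ = a₀)
    (hsep : ∀ j, j ≠ j₀ → Δ < |S.phase j - S.phase j₀|)
    (hD : filterInterval guess Δ ⊆ Set.Ico (Δ / 6) (2 * π - Δ / 6))
    (hsmall : tailConst * (Δ / σ) ^ 5 * Real.exp (-(Δ / σ) ^ 2 / 72) ≤ F ^ 3 * a₀ ^ 4)
    {est : (M : ℕ) → (Fin M → ℝ) → ℝ} (hest : IsFMPE F a₀ σ (filterInterval guess Δ) est) :
    ∃ b v : ℝ, HasAsymptoticBiasVariance (S.samples F σ (filterInterval guess Δ)) est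
        (S.phase j₀) b v ∧
      2 * |b| * (F * a₀ ^ 2) ≤
        Δ * (tailConst * (Δ / σ) ^ 5 * Real.exp (-(Δ / σ) ^ 2 / 72)) ∧
      0 < v ∧ 0 < S.acceptProb F σ (filterInterval guess Δ) ∧
      v * (PeakModel.gapConst * (F * a₀) ^ 2) ≤
        162 * S.acceptProb F σ (filterInterval guess Δ) * σ ^ 2 ∧
      (σ ≤ F * a₀ → v * (PeakModel.gapConst * (F * a₀)) ≤ 108 * σ ^ 2) ∧
      ∀ M, ∫ x, (est M x - S.phase j₀) ^ 2 ∂(S.samples F σ (filterInterval guess Δ) M) =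
        ProbabilityTheory.variance (est M) (S.samples F σ (filterInterval guess Δ) M) +
        (∫ x, est M x ∂(S.samples F σ (filterInterval guess Δ) M) - S.phase j₀) ^ 2 := by
  set G := targetPeak hF ha.1 hσ hR hΔ hguess with hG
  set E := Real.exp (-(Δ / σ) ^ 2 / 72) with hE
  set R := Δ / σ with hRdef
  set γ := PeakModel.gapConst with hγ
  have hγ0 : 0 < γ := PeakModel.gapConst_pos
  have hE0 : 0 < E := Real.exp_pos _
  have hE1 : E ≤ 1 := Real.exp_le_one_iff.mpr (by rw [neg_div]; exact neg_nonpos.mpr (by positivity))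
  have hFa := mul_pos hF.1 ha.1
  have hΔR : Δ = R * σ := by rw [hRdef]; field_simp
  have hEeq : Real.exp (-(Δ / 6) ^ 2 / (2 * σ ^ 2)) = E := by
    rw [hE, hΔR]
    congr 1
    field_simp
    norm_num
  have hGR : G.R = R := targetPeak_R hF ha.1 hσ hR hΔ hguess
  have hp := S.contaminated_noisyDensity hF ha.1 hσ hR hΔ hguess hw hsep hD
  rw [← hG, hEeq] at hp
  set η := F * (E / kernelMass σ) with hη
  have h48 := le_of_ratio hσ hR
  have hlen : G.u - G.l = Δ := by simp only [hG, targetPeak]; ring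
  have he : η * (G.u - G.l) ≤ 2 * F * E * R := by
    have hN := kernelMass_pos hσ (by linarith)
    have hN' := le_kernelMass hσ (by linarith)
    have h1 : E / kernelMass σ ≤ E / (σ / 2) :=
      div_le_div_of_nonneg_left hE0.le (by linarith) hN'
    have h2 : E / (σ / 2) * Δ = 2 * E * R := by rw [hΔR]; field_simp
    rw [hlen, hη, mul_assoc]
    calc F * (E / kernelMass σ * Δ) ≤ F * (E / (σ / 2) * Δ) :=
          mul_le_mul_of_nonneg_left (mul_le_mul_of_nonneg_right h1 (by linarith)) hF.1.le
      _ = 2 * F * E * R := by rw [h2]; ring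
  have hZ : G.Z G.θ₀ ≤ 2 := targetPeak_Z_le hF ha.1 hσ hR hΔ hguess ha.2
  have hsnr : (F * a₀) ^ 2 / 27 ≤ G.snr := le_targetPeak_snr hF ha.1 hσ hR hΔ hguess ha.2
  have hR0 : 0 < R := by linarith
  -- The constants in `tailConst`: `384 = 192 * 2`, with the `2` from the bound on the total
  -- contamination, and `729 = 27²` from the lower bound on `snr`.
  have htail : 384 * E * R ^ 5 ≤ γ ^ 2 * (F ^ 3 * a₀ ^ 4) / 729 := by
    have h1 : tailConst * R ^ 5 * E = (384 * E * R ^ 5) * (729 / γ ^ 2) := by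
      unfold tailConst
      ring
    rw [h1, mul_div_assoc', div_le_iff₀ (by positivity)] at hsmall
    linarith
  have hS : 192 * (η * (G.u - G.l)) * G.R ^ 4 ≤ (γ * G.snr) ^ 2 := by
    rw [hGR]
    calc 192 * (η * (G.u - G.l)) * R ^ 4 ≤ 192 * (2 * F * E * R) * R ^ 4 := by gcongr
      _ = F * (384 * E * R ^ 5) := by ring
      _ ≤ F * (γ ^ 2 * (F ^ 3 * a₀ ^ 4) / 729) := mul_le_mul_of_nonneg_left htail hF.1.le
      _ = (γ * ((F * a₀) ^ 2 / 27)) ^ 2 := by ring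
      _ ≤ (γ * G.snr) ^ 2 := by gcongr
  have hset : filterInterval guess Δ = Set.Icc G.l G.u := rfl
  have hmax : ∀ M (x : Fin M → ℝ), (∀ j, x j ∈ Set.Icc G.l G.u) → ∀ φ ∈ Set.Icc G.l G.u,
      empiricalMean (fun y => G.m y φ) x ≤ empiricalMean (fun y => G.m y (est M x)) x := by
    intro M x hx φ hφ
    have heq : ∀ ψ ∈ Set.Icc G.l G.u,
        logLikelihood F a₀ σ (filterInterval guess Δ) x ψ = empiricalMean (fun y => G.m y ψ) x := by
      intro ψ hψ
      unfold logLikelihood empiricalMean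
      congr 1
      exact Finset.sum_congr rfl fun j _ => log_modelDensity hF ha.1 hσ hR hΔ hguess (hx j) hψ
    have := hest.isMax M x hx φ hφ
    rwa [heq φ hφ, heq _ (hest.mem M x hx)] at this
  obtain ⟨θ, v, hθ, hv0, hv, hmean, hvar⟩ :=
    hp.tendsto_mean_and_variance hZ hS hest.measurable hest.mem hmax
  have hsamples : ∀ M, S.samples F σ (filterInterval guess Δ) M =
      Measure.pi fun _ : Fin M => G.windowMeasure (S.noisyDensity F σ) := fun M => rfl
  have hAeq : S.acceptProb F σ (filterInterval guess Δ) =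
      ∫ x in G.l..G.u, S.noisyDensity F σ x := PeakModel.setIntegral_Icc (G := G) _
  have hA0 := hp.integral_pos
  have hA3 : ∫ x in G.l..G.u, S.noisyDensity F σ x ≤ 3 := by
    have h1 := hp.integral_le
    have h2 : η * (G.u - G.l) ≤ 1 := by
      have h3 : (1 : ℝ) ≤ R ^ 4 := one_le_pow₀ (by linarith)
      have h4 : 2 * F * E * R ≤ 384 * E * R ^ 5 := by
        have h5 : 0 ≤ E * R := by positivity
        have h6 : F * (E * R) ≤ 1 * (E * R) := mul_le_mul_of_nonneg_right hF.2.le h5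
        have h7 : E * R * 1 ≤ E * R * R ^ 4 := mul_le_mul_of_nonneg_left h3 h5
        nlinarith
      have h8 : γ ^ 2 * (F ^ 3 * a₀ ^ 4) ≤ 1 * (1 * 1) := by
        have g1 : γ ≤ 1 := PeakModel.gapConst_le.trans (by norm_num)
        have g2 : γ ^ 2 ≤ 1 := pow_le_one₀ hγ0.le g1
        have g3 : F ^ 3 ≤ 1 := pow_le_one₀ hF.1.le hF.2.le
        have g4 : a₀ ^ 4 ≤ 1 := pow_le_one₀ ha.1.le ha.2
        have := hF.1
        have := ha.1
        gcongr
      linarith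
    linarith
  rw [hAeq]
  have hprob := hp.isProbabilityMeasure
  have hsnr0 := G.snr_pos
  rw [le_div_iff₀ (by positivity)] at hv
  change v * (γ * G.snr) ≤ 6 * (∫ x in G.l..G.u, S.noisyDensity F σ x) * σ ^ 2 at hv
  refine ⟨θ - S.phase j₀, v, ⟨hmean.sub_const _, hvar⟩, ?_, hv0, hA0, ?_, ?_, fun M => ?_⟩
  · have h1 : |θ - S.phase j₀| ≤ σ * (2 * (η * (G.u - G.l)) * R / (γ * G.snr)) := by
      have : |θ - S.phase j₀| ≤ σ * (2 * (η * (G.u - G.l)) * G.R / (γ * G.snr)) := hθ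
      rwa [hGR] at this
    have h2 : 2 * (η * (G.u - G.l)) * R / (γ * G.snr) ≤
        2 * (2 * F * E * R) * R / (γ * ((F * a₀) ^ 2 / 27)) := by
      have := hF.1
      gcongr
    have h3 : |θ - S.phase j₀| ≤ σ * (2 * (2 * F * E * R) * R / (γ * ((F * a₀) ^ 2 / 27))) :=
      h1.trans (mul_le_mul_of_nonneg_left h2 hσ.le)
    have hF0 := hF.1
    have ha0 := ha.1
    calc 2 * |θ - S.phase j₀| * (F * a₀ ^ 2)
        ≤ 2 * (σ * (2 * (2 * F * E * R) * R / (γ * ((F * a₀) ^ 2 / 27)))) * (F * a₀ ^ 2) := by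
          gcongr
      _ = Δ * (216 / γ * R * E) := by
          rw [hΔR]
          field_simp
          ring
      _ ≤ Δ * (tailConst * R ^ 5 * E) := by
          have h4 : R ≤ R ^ 5 := le_self_pow₀ (by linarith) (by norm_num)
          have h5 := le_tailConst
          have h6 := tailConst_pos
          have h7 : 0 ≤ Δ := by linarith
          gcongr
  -- Here `162 = 6 * 27`. In the next bound `108 = 6 * 3 * 6`, where the acceptance probability is
  -- replaced by `3`.
  · have h1 : v * (γ * ((F * a₀) ^ 2 / 27)) ≤ v * (γ * G.snr) := by gcongr
    linarith
  · intro hs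
    have h1 := le_targetPeak_snr_of_le hF ha.1 hσ hR hΔ hguess hs
    rw [← hG] at h1
    have h2 : v * (γ * (F * a₀ / 6)) ≤ v * (γ * G.snr) := by gcongr
    have h3 : (∫ x in G.l..G.u, S.noisyDensity F σ x) * σ ^ 2 ≤ 3 * σ ^ 2 := by gcongr
    linarith
  · rw [hsamples]
    exact integral_sq_sub_eq (memLp_of_mem_Icc
      (PeakModel.Contaminated.ae_mem (G := G) (S.noisyDensity F σ)) (hest.measurable M)
      (hest.mem M)) _

end Limits

/-! ### Choice of the number of samples, and two readings of the condition on `t` -/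

/-- A number of samples that is at least `y` and at most `max 1 (2 * y)`. -/
lemma exists_sample_number {y : ℝ} :
    ∃ n : ℕ, 1 ≤ n ∧ y ≤ n ∧ (n = 1 ∨ (n : ℝ) ≤ 2 * y) := by
  rcases le_total y 1 with h | h
  · exact ⟨1, le_rfl, by simpa using h, Or.inl rfl⟩
  · have h1 := Nat.le_ceil y
    have h2 := Nat.ceil_lt_add_one (by linarith : 0 ≤ y)
    refine ⟨⌈y⌉₊, ?_, h1, Or.inr (by linarith)⟩
    exact_mod_cast h.trans h1

lemma asymptoticRMS_le {b v ε : ℝ} {M : ℕ} (hM : 0 < M) (hε : 0 < ε) (hb : |b| ≤ ε / 2)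
    (hv : 4 * v / ε ^ 2 ≤ M) : asymptoticRMS b v M ≤ ε := by
  have hMr : (0 : ℝ) < M := by exact_mod_cast hM
  unfold asymptoticRMS
  refine Real.sqrt_le_iff.mpr ⟨hε.le, ?_⟩
  have h1 : v / M ≤ ε ^ 2 / 4 := by
    rw [div_le_iff₀ (by positivity)] at hv
    rw [div_le_iff₀ hMr]
    linarith
  have h2 : b ^ 2 ≤ (ε / 2) ^ 2 := by
    rw [← sq_abs b]
    exact pow_le_pow_left₀ (abs_nonneg _) hb 2
  nlinarith

/-- The condition forces `t` to grow as `ε` decreases, so any prescribed `T` is exceeded once `ε` is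
below an explicit threshold. This is the source of `ε₀`. -/
lemma ratio_ge_of_condition {Δ ε A c T : ℝ} (hΔ : 0 < Δ) (hε : 0 < ε) (hA : 0 < A)
    (hε₀ : ε ≤ Δ * A * Real.exp (-(T * Δ / c) ^ 2)) (hc : 0 < c) {t : ℝ}
    (ht : c * Δ⁻¹ * √(Real.log (Δ * ε⁻¹ * A)) ≤ t) : T ≤ t := by
  have h1 : Real.exp ((T * Δ / c) ^ 2) ≤ Δ * ε⁻¹ * A := by
    have e1 : Δ * ε⁻¹ * A = Δ * A / ε := by ring
    rw [e1, le_div_iff₀ hε]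
    calc Real.exp ((T * Δ / c) ^ 2) * ε
        ≤ Real.exp ((T * Δ / c) ^ 2) * (Δ * A * Real.exp (-(T * Δ / c) ^ 2)) := by gcongr
      _ = Δ * A * (Real.exp ((T * Δ / c) ^ 2) * Real.exp (-(T * Δ / c) ^ 2)) := by ring
      _ = Δ * A := by rw [← Real.exp_add, add_neg_cancel, Real.exp_zero, mul_one]
  have h2 : (T * Δ / c) ^ 2 ≤ Real.log (Δ * ε⁻¹ * A) := by
    rwa [Real.le_log_iff_exp_le (by positivity)]
  have h3 : T * Δ / c ≤ √(Real.log (Δ * ε⁻¹ * A)) := Real.le_sqrt_of_sq_le h2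
  calc T = c * Δ⁻¹ * (T * Δ / c) := by field_simp
    _ ≤ c * Δ⁻¹ * √(Real.log (Δ * ε⁻¹ * A)) := by gcongr
    _ ≤ t := ht

/-- The same condition solved for `ε`: a fixed `t` admits only accuracies above a positive bound.
This makes an `N₀` independent of `ε` possible. -/
lemma accuracy_ge_of_condition {Δ ε A c : ℝ} (hΔ : 0 < Δ) (hε : 0 < ε) (hA : 0 < A)
    (hc : 0 < c) {t : ℝ} (ht0 : 0 ≤ t)
    (ht : c * Δ⁻¹ * √(Real.log (Δ * ε⁻¹ * A)) ≤ t) :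
    Δ * A * Real.exp (-(t * Δ / c) ^ 2) ≤ ε := by
  have h1 : √(Real.log (Δ * ε⁻¹ * A)) ≤ t * Δ / c := by
    rw [le_div_iff₀ hc]
    calc √(Real.log (Δ * ε⁻¹ * A)) * c = c * Δ⁻¹ * √(Real.log (Δ * ε⁻¹ * A)) * Δ := by field_simp
      _ ≤ t * Δ := by gcongr
  have h2 : Real.log (Δ * ε⁻¹ * A) ≤ (t * Δ / c) ^ 2 :=
    (Real.sqrt_le_left (by positivity)).mp h1
  rw [Real.log_le_iff_le_exp (by positivity)] at h2
  have e1 : Δ * ε⁻¹ * A = Δ * A / ε := by ring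
  rw [e1, div_le_iff₀ hε] at h2
  calc Δ * A * Real.exp (-(t * Δ / c) ^ 2)
      ≤ Real.exp ((t * Δ / c) ^ 2) * ε * Real.exp (-(t * Δ / c) ^ 2) := by gcongr
    _ = ε * (Real.exp ((t * Δ / c) ^ 2) * Real.exp (-(t * Δ / c) ^ 2)) := by ring
    _ = ε := by rw [← Real.exp_add, add_neg_cancel, Real.exp_zero, mul_one]

/-- The condition on `t` makes the contamination negligible. -/
lemma tail_le_of_condition {k κ₂ F Δ a₀ ε σ t : ℝ} (hk48 : 48 ≤ k)
    (hk : ∀ R : ℝ, k ≤ R → tailConst * R ^ 5 * Real.exp (-R ^ 2 / 144) ≤ 1) (hκ₂ : 0 < κ₂)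
    (hF : F ∈ Set.Ioo (0 : ℝ) 1) (hΔ : 0 < Δ) (ha : a₀ ∈ Set.Ioc (0 : ℝ) 1)
    (hε : 0 < ε) (hεΔ : ε ≤ Δ / 3) (hσ : 0 < σ) (htσ : t * σ ≤ κ₂)
    (ht : κ₂ * k * Δ⁻¹ * √(Real.log (Δ * ε⁻¹ * (a₀ ^ 2)⁻¹ * F⁻¹)) ≤ t) :
    48 ≤ Δ / σ ∧
    tailConst * (Δ / σ) ^ 5 * Real.exp (-(Δ / σ) ^ 2 / 72) ≤ F ^ 3 * a₀ ^ 4 ∧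
    Δ * (tailConst * (Δ / σ) ^ 5 * Real.exp (-(Δ / σ) ^ 2 / 72)) ≤ ε * (F * a₀ ^ 2) := by
  have hF0 := hF.1
  have ha0 := ha.1
  set X : ℝ := Δ * ε⁻¹ * (a₀ ^ 2)⁻¹ * F⁻¹ with hX
  have ha2 : a₀ ^ 2 ≤ 1 := pow_le_one₀ ha0.le ha.2
  have hFa : F * a₀ ^ 2 ≤ 1 := by nlinarith [hF.2]
  have hXε : X * (ε * (F * a₀ ^ 2)) = Δ := by
    rw [hX]
    field_simp
  have hX0 : 0 < X := by positivity
  -- The restriction `ε ≤ Δ / 3` is used here: it keeps `log X` above `1` and makes `X⁻¹ ≤ F a₀²`.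
  have hX3 : 3 ≤ X * (F * a₀ ^ 2) := by
    have h1 : X * (F * a₀ ^ 2) * ε = Δ := by rw [← hXε]; ring
    have h2 : 3 * ε ≤ X * (F * a₀ ^ 2) * ε := by linarith
    exact le_of_mul_le_mul_right h2 hε
  have hX3' : 3 ≤ X := by nlinarith
  have hR : k * √(Real.log X) ≤ Δ / σ := by
    rw [le_div_iff₀ hσ]
    have h1 : k * √(Real.log X) * κ₂ ≤ t * Δ := by
      calc k * √(Real.log X) * κ₂ = κ₂ * k * Δ⁻¹ * √(Real.log X) * Δ := by field_simp
        _ ≤ t * Δ := by gcongr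
    have h2 : 0 ≤ k * √(Real.log X) := by positivity
    have h3 : k * √(Real.log X) * σ * κ₂ ≤ Δ * κ₂ := by
      calc k * √(Real.log X) * σ * κ₂ = (k * √(Real.log X) * κ₂) * σ := by ring
        _ ≤ t * Δ * σ := by gcongr
        _ = Δ * (t * σ) := by ring
        _ ≤ Δ * κ₂ := by gcongr
    exact le_of_mul_le_mul_right h3 hκ₂
  obtain ⟨hkR, htail⟩ := tail_le_of_sqrt_log_le hk48 hk hX3' hR
  refine ⟨hk48.trans hkR, htail.trans ?_, ?_⟩
  · have h1 : (X ^ 3)⁻¹ ≤ (F * a₀ ^ 2) ^ 3 := by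
      refine inv_le_of_inv_le₀ (by positivity) ?_
      rw [← inv_pow]
      refine pow_le_pow_left₀ (by positivity) ?_ 3
      refine inv_le_of_inv_le₀ hX0 ?_
      rw [inv_le_comm₀ hX0 (by positivity)]
      refine (inv_le_iff_one_le_mul₀ (by positivity)).mpr ?_
      linarith
    refine h1.trans ?_
    have h2 : (F * a₀ ^ 2) ^ 3 = F ^ 3 * a₀ ^ 4 * a₀ ^ 2 := by ring
    rw [h2]
    exact mul_le_of_le_one_right (by positivity) ha2
  · have h1 : (X ^ 3)⁻¹ ≤ X⁻¹ := by
      refine inv_anti₀ hX0 ?_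
      exact le_self_pow₀ (by linarith) (by norm_num)
    calc Δ * (tailConst * (Δ / σ) ^ 5 * Real.exp (-(Δ / σ) ^ 2 / 72)) ≤ Δ * X⁻¹ := by
          refine mul_le_mul_of_nonneg_left (htail.trans h1) hΔ.le
      _ = ε * (F * a₀ ^ 2) := by
          rw [← hXε]
          field_simp

end QPE

/-! ### The main theorem -/

theorem theorem4 (κ₁ κ₂ : ℝ) (hκ₁ : 0 < κ₁) (hκ₂ : κ₁ ≤ κ₂) :
    ∃ c > 0, ∃ CT > 0, ∀ F ∈ Set.Ioo (0 : ℝ) 1, ∃ CM > 0,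
      ∀ Δ ∈ Set.Ioc (0 : ℝ) π, ∀ a₀ ∈ Set.Ioc (0 : ℝ) 1, ∃ ε₀ > 0,
      ∀ (ι : Type u) (H : Type v) [Fintype ι] [NormedAddCommGroup H] [InnerProductSpace ℂ H]
        (S : QPE.Input ι H) (j₀ : ι) (guess : ℝ),
        S.weight j₀ = a₀ →
        (∀ j, j ≠ j₀ → Δ < |S.phase j - S.phase j₀|) →
        |S.phase j₀ - guess| < Δ / 3 →
        QPE.filterInterval guess Δ ⊆ Set.Ico (Δ / 6) (2 * π - Δ / 6) →
      ∀ (t : ℕ) (σ : ℝ), 0 < σ → κ₁ ≤ t * σ → t * σ ≤ κ₂ →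
      ∀ est : (M : ℕ) → (Fin M → ℝ) → ℝ,
        QPE.IsFMPE F a₀ σ (QPE.filterInterval guess Δ) est →
      ∃ N₀ : ℕ, ∀ ε : ℝ, 0 < ε → ε ≤ Δ / 3 →
        c * Δ⁻¹ * √(Real.log (Δ * ε⁻¹ * (a₀ ^ 2)⁻¹ * F⁻¹)) ≤ t →
        ∃ b v : ℝ,
          QPE.HasAsymptoticBiasVariance (S.samples F σ (QPE.filterInterval guess Δ)) est
            (S.phase j₀) b v ∧
          ∃ Mε : ℕ, 1 ≤ Mε ∧
            (ε ≤ ε₀ → (Mε : ℝ) ≤ max 1 (CM * (a₀⁻¹ * ((t : ℝ) ^ 2)⁻¹ * (ε ^ 2)⁻¹))) ∧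
            S.calls F σ (QPE.filterInterval guess Δ) t Mε ≤
              max (S.calls F σ (QPE.filterInterval guess Δ) t 1)
                (CT * ((ε ^ 2)⁻¹ * (t : ℝ)⁻¹ * (F ^ 2)⁻¹ * (a₀ ^ 2)⁻¹)) ∧
            ∀ M : ℕ, Mε ≤ M →
              QPE.asymptoticRMS b v M ≤ ε ∧
              (N₀ ≤ M → QPE.rmsError (S.samples F σ (QPE.filterInterval guess Δ)) est
                (S.phase j₀) M ≤ ε) := by
  have hκ₂0 : 0 < κ₂ := hκ₁.trans_le hκ₂
  obtain ⟨k, hk48, hk⟩ := QPE.exists_ratio_bound QPE.tailConst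
  have hk0 : 0 < k := by linarith
  have hγ0 := QPE.PeakModel.gapConst_pos
  set γ := QPE.PeakModel.gapConst with hγ
  -- As `tσ ≤ κ₂`, the choice `c = κ₂ k` turns the condition on `t` into `Δ / σ ≥ k √(log X)`. The
  -- sample number is at most `2 * (4v / ε²)` unless it is `1`, so `1296 = 8 * 162`, and below `864
  -- = 8 * 108`.
  refine ⟨κ₂ * k, by positivity, 1296 * κ₂ ^ 2 / γ, by positivity, fun F hF => ?_⟩
  have hF0 := hF.1
  refine ⟨864 * κ₂ ^ 2 / (γ * F), by positivity, fun Δ hΔ a₀ ha => ?_⟩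
  have ha0 := ha.1
  have hΔ0 := hΔ.1
  -- The threshold at which the condition yields `t ≥ κ₂ / (F a₀)`, hence `σ ≤ F a₀`.
  refine ⟨Δ * ((a₀ ^ 2)⁻¹ * F⁻¹) * Real.exp (-(κ₂ / (F * a₀) * Δ / (κ₂ * k)) ^ 2), by positivity,
    fun ι H _ _ _ S j₀ guess hw hsep hguess hD t σ hσ htσ₁ htσ est hest => ?_⟩
  have ht0 : (0 : ℝ) < t := by
    by_contra hcon
    have : (t : ℝ) * σ ≤ 0 := mul_nonpos_of_nonpos_of_nonneg (not_lt.mp hcon) hσ.le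
    linarith
  set D := QPE.filterInterval guess Δ with hDdef
  -- `N₀` has to be chosen before `ε`. If some accuracy is admissible, it already provides `b` and
  -- `v`, which do not depend on it; otherwise there is nothing to prove.
  by_cases hex : ∃ ε : ℝ, 0 < ε ∧ ε ≤ Δ / 3 ∧
      κ₂ * k * Δ⁻¹ * √(Real.log (Δ * ε⁻¹ * (a₀ ^ 2)⁻¹ * F⁻¹)) ≤ t
  swap
  · refine ⟨0, fun ε hε hεΔ ht => ?_⟩
    exact absurd ⟨ε, hε, hεΔ, ht⟩ hex
  obtain ⟨ε₁, hε₁, hε₁Δ, ht₁⟩ := hex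
  obtain ⟨hR, hsmall, -⟩ :=
    QPE.tail_le_of_condition hk48 hk hκ₂0 hF hΔ0 ha hε₁ hε₁Δ hσ htσ ht₁
  obtain ⟨b, v, hbv, hb, hv0, hA0, hv, hv', hmse⟩ :=
    S.exists_limits hF ha hσ hR hΔ.2 hguess hw hsep hD hsmall hest
  set εmin : ℝ := Δ * ((a₀ ^ 2)⁻¹ * F⁻¹) * Real.exp (-(t * Δ / (κ₂ * k)) ^ 2) with hεmin
  have hεmin0 : 0 < εmin := by positivity
  obtain ⟨N₁, hN₁⟩ := (Metric.tendsto_atTop.mp hbv.1) (εmin / 8) (by positivity)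
  obtain ⟨N₂, hN₂⟩ := (Metric.tendsto_atTop.mp hbv.2) v hv0
  -- From here on the bias is within `εmin / 8 ≤ ε / 8` of its limit and `M · Var` is below `2v`.
  refine ⟨max N₁ N₂, fun ε hε hεΔ ht => ⟨b, v, hbv, ?_⟩⟩
  obtain ⟨-, -, hbias⟩ := QPE.tail_le_of_condition hk48 hk hκ₂0 hF hΔ0 ha hε hεΔ hσ htσ ht
  have hbε : |b| ≤ ε / 2 := by
    have h1 := hb.trans hbias
    have h2 := le_of_mul_le_mul_right h1 (by positivity)
    linarith
  have hassoc : Δ * ε⁻¹ * (a₀ ^ 2)⁻¹ * F⁻¹ = Δ * ε⁻¹ * ((a₀ ^ 2)⁻¹ * F⁻¹) := by ring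
  rw [hassoc] at ht
  have hmin : εmin ≤ ε := QPE.accuracy_ge_of_condition hΔ0 hε (by positivity) (by positivity)
    ht0.le ht
  have hσt : σ ^ 2 ≤ κ₂ ^ 2 * ((t : ℝ) ^ 2)⁻¹ := by
    rw [← div_eq_mul_inv, le_div_iff₀ (by positivity)]
    calc σ ^ 2 * (t : ℝ) ^ 2 = (t * σ) ^ 2 := by ring
      _ ≤ κ₂ ^ 2 := pow_le_pow_left₀ (by positivity) htσ 2
  obtain ⟨n, hn1, hnv, hn⟩ := QPE.exists_sample_number (y := 4 * v / ε ^ 2)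
  refine ⟨n, hn1, fun hε₀ => ?_, ?_, fun M hM => ?_⟩
  · rcases hn with rfl | hn
    · simp
    · refine le_max_of_le_right (hn.trans ?_)
      have hT : κ₂ / (F * a₀) ≤ t := QPE.ratio_ge_of_condition hΔ0 hε (by positivity) hε₀
        (by positivity) ht
      have hσF : σ ≤ F * a₀ := by
        rw [div_le_iff₀ (by positivity)] at hT
        have h1 : t * σ ≤ t * (F * a₀) := htσ.trans hT
        exact le_of_mul_le_mul_left h1 ht0
      have h1 : v ≤ 108 * (κ₂ ^ 2 * ((t : ℝ) ^ 2)⁻¹) / (γ * (F * a₀)) := by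
        rw [le_div_iff₀ (by positivity)]
        exact (hv' hσF).trans (by gcongr)
      calc 2 * (4 * v / ε ^ 2)
          ≤ 2 * (4 * (108 * (κ₂ ^ 2 * ((t : ℝ) ^ 2)⁻¹) / (γ * (F * a₀))) / ε ^ 2) := by gcongr
        _ = 864 * κ₂ ^ 2 / (γ * F) * (a₀⁻¹ * ((t : ℝ) ^ 2)⁻¹ * (ε ^ 2)⁻¹) := by
          field_simp
          norm_num
  · rcases hn with rfl | hn
    · exact le_max_left _ _
    · refine le_max_of_le_right ?_
      unfold QPE.Input.calls
      set A := S.acceptProb F σ D with hA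
      have h1 : v ≤ 162 * A * (κ₂ ^ 2 * ((t : ℝ) ^ 2)⁻¹) / (γ * (F * a₀) ^ 2) := by
        rw [le_div_iff₀ (by positivity)]
        exact hv.trans (by gcongr)
      calc (n : ℝ) * t / A
          ≤ 2 * (4 * (162 * A * (κ₂ ^ 2 * ((t : ℝ) ^ 2)⁻¹) / (γ * (F * a₀) ^ 2)) / ε ^ 2) * t / A := by
            refine div_le_div_of_nonneg_right (mul_le_mul_of_nonneg_right (hn.trans ?_) ht0.le)
              hA0.le
            gcongr
        _ = 1296 * κ₂ ^ 2 / γ * ((ε ^ 2)⁻¹ * (t : ℝ)⁻¹ * (F ^ 2)⁻¹ * (a₀ ^ 2)⁻¹) := by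
            field_simp
            norm_num
  · have hMpos : 0 < M := lt_of_lt_of_le hn1 hM
    have hMr : (0 : ℝ) < M := by exact_mod_cast hMpos
    have hMv : 4 * v / ε ^ 2 ≤ M := hnv.trans (by exact_mod_cast hM)
    refine ⟨QPE.asymptoticRMS_le hMpos hε hbε hMv, fun hN => ?_⟩
    unfold QPE.rmsError
    refine Real.sqrt_le_iff.mpr ⟨hε.le, ?_⟩
    rw [hmse M]
    have h1 := hN₁ M ((le_max_left _ _).trans hN)
    have h2 := hN₂ M ((le_max_right _ _).trans hN)
    rw [Real.dist_eq] at h1 h2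
    set mean := (∫ x, est M x ∂(S.samples F σ D M)) - S.phase j₀ with hmean
    set V := ProbabilityTheory.variance (est M) (S.samples F σ D M) with hV
    have h3 : |mean| ≤ 5 / 8 * ε := by
      have h4 : |mean| ≤ |mean - b| + |b| := by simpa using abs_add_le (mean - b) b
      linarith
    have h5 : mean ^ 2 ≤ (5 / 8 * ε) ^ 2 := by
      rw [← sq_abs]
      exact pow_le_pow_left₀ (abs_nonneg _) h3 2
    have h6 : V ≤ ε ^ 2 / 2 := by
      have h7 : M * V ≤ 2 * v := by linarith [(abs_lt.mp h2).2]
      rw [div_le_iff₀ (by positivity)] at hMv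
      have h8 : M * V ≤ M * (ε ^ 2 / 2) := by linarith
      exact le_of_mul_le_mul_left h8 hMr
    -- The budget is `(5/8)² + 1/2 = 57/64 < 1`.
    nlinarith [sq_nonneg ε]
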